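/- **Setting.** Let $M$ be a $3$-dimensional smooth ($C^\infty$) Riemannian manifold without boundary (Hausdorff, $\sigma$-compact; connectedness is not assumed). A *$C^r$-triple* $(U,X,Y)$ consists of an open set $U\subset M$ with compact closure and two complete vector fields $X,Y$ of class $C^r$ on $M$ with $[X,Y]=0$, such that $Y$ has no zero in $U$ and $X$ has no zero on $\partial U$. For $c\in\mathbf R$ put $$K_c=\mathrm{Zero}(X-cY)\cap\overline U,\qquad \mathrm{Col}_U(X,Y)=\bigcup_{c\in\mathbf R}K_c .$$ Where $Y\neq0$, the *quotient function* is $\mu=\langle X,Y\rangle/\langle Y,Y\rangle$, i.e. $X=N+\mu Y$ with $N$ orthogonal to $Y$; below, $\mu^{-1}(c)$ denotes $\{x\in\overline U:\mu(x)=c\}$. The *Poincaré–Hopf index* $\mathrm{Ind}(X,x)$ of an isolated zero $x$ of a continuous vector field $X$ is the topological degree of the Gauss map $X/\|X\|$ on a small sphere around $x$ in a chart. $\mathrm{Ind}(X,U)$ is the integer $\sum_{x\in \mathrm{Zero}(X')\cap U}\mathrm{Ind}(X',x)$, where $X'$ is any continuous vector field sufficiently $C^0$-close to $X$ on $\overline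 U$ with finitely many zeros in $U$. The triple is a *$C^r$-counterexample* if $\mathrm{Ind}(X,U)\neq0$. A $C^r$-triple $(U,X,Y)$ is *prepared* if there is $\varepsilon>0$ such that 1. $\overline U$ is trivially foliated by the level sets $\mu^{-1}(c)$, $c\in[-\varepsilon,\varepsilon]$: there are a compact connected surface $S$ of class $C^r$, possibly with boundary, and a $C^r$-diffeomorphism $\Phi:S\times[-\varepsilon,\varepsilon]\to\overline U$ with $\mu(\Phi(s,c))=c$; 2. $Y$ is nowhere orthogonal to the level sets of $\mu$: for every $x\in\overline U$ some $v\in\ker d\mu_x$ satisfies $\langle Y(x),v\rangle\neq0$; 3. $0$ is a continuity point of the map $c\mapsto K_c$ for the Hausdorff distance; 4. $K_c\cap\partial\mu^{-1}(c)=\emptyset$ for every $c\in[-\varepsilon,\varepsilon]$, where $\partial\mu^{-1}(c)=\Phi(\partial S\times\{c\})$. A *$C^r$-prepared counterexample* is a prepared $C^r$-triple with $\mathrm{Ind}(X,U)\ne0$. **Theorem (Simplification of counterexamples).** Let $(U,X,Y)$ be a $C^3$-counterexample on $M$. Then there exist $\widetilde U\subset U$ and a complete $C^3$ vector field $\widetilde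 X$ on $M$ commuting with $Y$ such that $$\mathrm{Col}_{\widetilde U}(\widetilde X,Y)=\mathrm{Col}_U(X,Y)\cap\overline{\widetilde U}$$ and $(\widetilde U,\widetilde X,Y)$ is a $C^3$-prepared counterexample. -/

import Mathlib

open Set Filter Topology Bundle Manifold
open scoped ContDiff

universe u

noncomputable section

namespace PreparedTriples

/-- Euclidean three-space. -/
abbrev E3 : Type := EuclideanSpace ℝ (Fin 3)

/-- The unit sphere `S²` of Euclidean three-space. -/
abbrev S2 : Type := Metric.sphere (0 : E3) 1

/-- The topological (Brouwer) degree of a continuous map `g : S² → S²`: the integer `d` such that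
`g` acts on the singular homology group `H₂(S²; ℤ) ≅ ℤ` as multiplication by `d`. -/
def sphereDegree (g : C(S2, S2)) : ℤ :=
  open Classical in
  if h : ∃ d : ℤ,
      ((AlgebraicTopology.singularHomologyFunctor (ModuleCat.{0} ℤ) 2).obj
          (ModuleCat.of ℤ ℤ)).map (TopCat.ofHom g) =
        d • CategoryTheory.CategoryStruct.id
          (((AlgebraicTopology.singularHomologyFunctor (ModuleCat.{0} ℤ) 2).obj
            (ModuleCat.of ℤ ℤ)).obj (TopCat.of S2))
  then h.choose else 0

section VectorFields

variable {M : Type u} [TopologicalSpace M] [ChartedSpace E3 M]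

/-- The set of zeros of a vector field. -/
def zeroSet (X : ∀ x : M, TangentSpace (𝓡 3) x) : Set M := {x | X x = 0}

/-- `X` is a vector field of class `C^r`. -/
def IsCrVectorField [IsManifold (𝓡 3) ∞ M] (r : ℕ∞ω) (X : ∀ x : M, TangentSpace (𝓡 3) x) : Prop :=
  ContMDiff (𝓡 3) (𝓡 3).tangent r (fun x => (⟨x, X x⟩ : TangentBundle (𝓡 3) M))

/-- `X` is complete: through every point passes an integral curve defined for all times. -/
def IsCompleteVectorField (X : ∀ x : M, TangentSpace (𝓡 3) x) : Prop :=
  ∀ x : M, ∃ γ : ℝ → M, γ 0 = x ∧ IsMIntegralCurve γ X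

/-- The set `K_c = Zero(X - cY) ∩ closure U`. -/
def levelZeros (U : Set M) (X Y : ∀ x : M, TangentSpace (𝓡 3) x) (c : ℝ) : Set M :=
  zeroSet (fun x => X x - c • Y x) ∩ closure U

/-- The collinearity locus `Col_U(X,Y)`, the union of the sets `Zero(X - cY) ∩ closure U`. -/
def collinearityLocus (U : Set M) (X Y : ∀ x : M, TangentSpace (𝓡 3) x) : Set M :=
  ⋃ c : ℝ, levelZeros U X Y c

/-- The expression of the vector field `X` in the preferred chart at `x`. -/
def chartExpression (X : ∀ x : M, TangentSpace (𝓡 3) x) (x : M) (y : E3) : E3 :=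
  mfderiv (𝓡 3) 𝓘(ℝ, E3) (extChartAt (𝓡 3) x) ((extChartAt (𝓡 3) x).symm y)
    (X ((extChartAt (𝓡 3) x).symm y))

/-- `n` is the degree of the Gauss map `X / ‖X‖` on all sufficiently small spheres around `x`, in
the chart at `x` (spheres are parametrized by `S²`). A value `g u` lies on the unit sphere, so
`X` does not vanish on these spheres. -/
def HasIndexAt (X : ∀ x : M, TangentSpace (𝓡 3) x) (x : M) (n : ℤ) : Prop :=
  ∀ᶠ ρ in 𝓝[>] (0 : ℝ), ∃ g : C(S2, S2),
    (∀ u : S2, (g u : E3) =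
      ‖chartExpression X x (extChartAt (𝓡 3) x x + ρ • (u : E3))‖⁻¹ •
        chartExpression X x (extChartAt (𝓡 3) x x + ρ • (u : E3))) ∧
    sphereDegree g = n

/-- The Poincaré-Hopf index `Ind(X,x)` of a continuous vector field at an isolated zero. -/
def indexAt (X : ∀ x : M, TangentSpace (𝓡 3) x) (x : M) : ℤ :=
  open Classical in if h : ∃ n : ℤ, HasIndexAt X x n then h.choose else 0

end VectorFields

section Riemannian

variable {M : Type u} [EMetricSpace M] [ChartedSpace E3 M] [IsManifold (𝓡 3) ∞ M]
  [RiemannianBundle (fun x : M => TangentSpace (𝓡 3) x)]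

/-- `Ind(X,U) = n`: every continuous vector field `X'` which is sufficiently `C⁰`-close to `X` on
`closure U` and has only finitely many zeros in `U` satisfies `∑ Ind(X',x) = n`, where the sum is
over its zeros in `U`. For `U` open and relatively compact and `X` continuous without zeros on
`∂U`, there is exactly one such integer `n`. -/
def HasIndex (X : ∀ x : M, TangentSpace (𝓡 3) x) (U : Set M) (n : ℤ) : Prop :=
  ∃ δ : ℝ, 0 < δ ∧ ∀ X' : ∀ x : M, TangentSpace (𝓡 3) x,
    Continuous (fun x => (⟨x, X' x⟩ : TangentBundle (𝓡 3) M)) →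
    (∀ x ∈ closure U, ‖X' x - X x‖ < δ) →
    (zeroSet X' ∩ U).Finite →
    ∑ᶠ x ∈ zeroSet X' ∩ U, indexAt X' x = n

/-- The quotient function `μ` of `X` with respect to the plane field normal to `Y`: where `Y` does
not vanish, `μ(x)` is the only real number such that `X(x) - μ(x) Y(x)` is orthogonal to `Y(x)`. -/
def quotientFunction (X Y : ∀ x : M, TangentSpace (𝓡 3) x) (x : M) : ℝ :=
  inner ℝ (X x) (Y x) / inner ℝ (Y x) (Y x)

/-- `C^r`-triples `(U,X,Y)`: `U` is open and relatively compact, `X`, `Y` are commuting complete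
vector fields of class `C^r`, `Y` has no zero in `U` and `X` has no zero on `∂U`. -/
structure IsTriple (r : ℕ∞ω) (U : Set M) (X Y : ∀ x : M, TangentSpace (𝓡 3) x) : Prop where
  isOpen : IsOpen U
  isCompact_closure : IsCompact (closure U)
  contMDiff_left : IsCrVectorField r X
  contMDiff_right : IsCrVectorField r Y
  complete_left : IsCompleteVectorField X
  complete_right : IsCompleteVectorField Y
  commute : ∀ x : M, VectorField.mlieBracket (𝓡 3) X Y x = 0
  zeroSet_right : zeroSet Y ∩ U = ∅
  zeroSet_left : zeroSet X ∩ frontier U = ∅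

/-- `C^r`-counterexamples: `C^r`-triples with `Ind(X,U) ≠ 0`. -/
def IsCounterexample (r : ℕ∞ω) (U : Set M) (X Y : ∀ x : M, TangentSpace (𝓡 3) x) : Prop :=
  IsTriple r U X Y ∧ ∃ n : ℤ, n ≠ 0 ∧ HasIndex X U n

/-- `Φ` restricts to a `C^r`-diffeomorphism from `S × [-ε,ε]` onto `closure U`, with inverse
`x ↦ (p x, μ x)`. In particular `Φ` maps each `S × {c}` diffeomorphically onto the level set
`μ⁻¹(c)` in `closure U`. -/
structure IsTrivialFoliation (r : ℕ∞ω) (U : Set M) (μ : M → ℝ) (ε : ℝ)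
    {S : Type u} [TopologicalSpace S] [ChartedSpace (EuclideanHalfSpace 2) S]
    (Φ : S × ℝ → M) (p : M → S) : Prop where
  mapsTo : ∀ s : S, ∀ c ∈ Icc (-ε) ε, Φ (s, c) ∈ closure U
  mem_Icc : ∀ x ∈ closure U, μ x ∈ Icc (-ε) ε
  right_inv : ∀ x ∈ closure U, Φ (p x, μ x) = x
  left_inv : ∀ s : S, ∀ c ∈ Icc (-ε) ε, p (Φ (s, c)) = s
  level : ∀ s : S, ∀ c ∈ Icc (-ε) ε, μ (Φ (s, c)) = c
  contMDiffOn : ContMDiffOn ((𝓡∂ 2).prod 𝓘(ℝ, ℝ)) (𝓡 3) r Φ (univ ×ˢ Icc (-ε) ε)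
  contMDiffOn_proj : ContMDiffOn (𝓡 3) (𝓡∂ 2) r p (closure U)
  contMDiffOn_level : ContMDiffOn (𝓡 3) 𝓘(ℝ, ℝ) r μ (closure U)

/-- `C^r`-prepared triples. The four conditions, in order:
* `closure U` is trivially foliated by the level sets of `μ`, which are diffeomorphic to a compact
  connected surface `S`, possibly with boundary;
* `Y` is nowhere orthogonal to the level sets (whose tangent spaces are the kernels of `dμ`);
* `0` is a continuity point of `c ↦ K_c` for the Hausdorff distance;
* `K_c` does not meet the boundary `Φ(∂S × {c})` of the level set `μ⁻¹(c)`. -/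
def IsPreparedTriple (r : ℕ∞ω) (U : Set M) (X Y : ∀ x : M, TangentSpace (𝓡 3) x) : Prop :=
  IsTriple r U X Y ∧
  ∃ (ε : ℝ) (S : Type u) (_ : TopologicalSpace S) (_ : ChartedSpace (EuclideanHalfSpace 2) S)
    (Φ : S × ℝ → M) (p : M → S),
    0 < ε ∧ IsManifold (𝓡∂ 2) r S ∧ T2Space S ∧ CompactSpace S ∧ ConnectedSpace S ∧
    IsTrivialFoliation r U (quotientFunction X Y) ε Φ p ∧
    (∀ x ∈ closure U, ∃ v : TangentSpace (𝓡 3) x,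
      mfderiv (𝓡 3) 𝓘(ℝ, ℝ) (quotientFunction X Y) x v = 0 ∧ inner ℝ (Y x) v ≠ 0) ∧
    Tendsto (fun c : ℝ => Metric.hausdorffEDist (levelZeros U X Y c) (levelZeros U X Y 0))
      (𝓝 0) (𝓝 0) ∧
    (∀ c ∈ Icc (-ε) ε, ∀ s ∈ (𝓡∂ 2).boundary S, Φ (s, c) ∉ levelZeros U X Y c)

/-- `C^r`-prepared counterexamples: `C^r`-prepared triples with `Ind(X,U) ≠ 0`. -/
def IsPreparedCounterexample (r : ℕ∞ω) (U : Set M) (X Y : ∀ x : M, TangentSpace (𝓡 3) x) :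
    Prop :=
  IsPreparedTriple r U X Y ∧ ∃ n : ℤ, n ≠ 0 ∧ HasIndex X U n

end Riemannian

end PreparedTriples

end

/-! Subtracting a small multiple `c₀ Y` from `X` is harmless. The new field still commutes with `Y`,
it is complete because the two flows commute, and for small `c₀` it has no zero on the frontier and
the same index. Its collinearity locus is only reindexed, and `μ` is shifted by `c₀`. So `c₀` may be
chosen generic. Sard's theorem for the `C³` function `μ` on a 3-manifold
(`volume_criticalValues_eq_zero`) makes the zero level regular at the zeros of the new field. A
Baire argument (`exists_generic_value`) makes these zeros persist in `K_c` for `c` near `0`; the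
other half of Hausdorff continuity is automatic by compactness. `IsCounterexample.exists_generic`
combines both.

Now the zeros of `X` in the closure of `U` form a compact part `K` of a regular level surface. The
flow of `Y` preserves the zeros of `X`, so `dμ(Y) = 0` on `K` (`mfderiv_quotientFunction_apply`):
there `Y` is nonzero and tangent to the level, hence not orthogonal to the levels near `K`
(`eventually_exists_inner_ne_zero`).

A `C³` map `p` pushes a neighbourhood of `K` into the level. A superlevel set of a bump function, at
a regular value, cuts out a compact surface with boundary containing `K` in its interior
(`exists_regular_surface`). Each of its finitely many components, thickened along the fibres of `p`
to `|μ| ≤ ε`, is a box foliated by the levels of `μ`; the boxes are disjoint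
(`exists_isFoliatedBox`). For small `ε`, the zeros of `X - cY` with `|c| ≤ ε` are so close to `K`
that they avoid the boundaries of the leaves.

All zeros of `X` in `U` lie in the interiors of the boxes, so the index is distributed among them
and some box has nonzero index (`HasIndex.exists_ne_zero`). Its interior is the required open set
(`IsCounterexample.exists_prepared`). -/

set_option linter.unusedSectionVars false

noncomputable section

namespace PreparedTriples

open MeasureTheory Measure Asymptotics
open scoped ENNReal NNReal

/-! ### Local inverses and parametrization of regular zero sets -/

section InverseFunction

variable {E : Type*} [NormedAddCommGroup E] [NormedSpace ℝ E] [CompleteSpace E]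
  {F : Type*} [NormedAddCommGroup F] [NormedSpace ℝ F]

/-- A form of the inverse function theorem in which the local inverse is of class `C^k` on the whole
target, and the source is as small as desired. -/
theorem exists_openPartialHomeomorph_contDiffOn {f : E → F} {f' : E ≃L[ℝ] F} {x : E} {k : ℕ}
    (hk : k ≠ 0) (hf : ContDiffAt ℝ k f x) (hf' : HasFDerivAt f (f' : E →L[ℝ] F) x)
    {O : Set E} (hO : O ∈ 𝓝 x) :
    ∃ e : OpenPartialHomeomorph E F, x ∈ e.source ∧ e.source ⊆ O ∧ (∀ y, e y = f y) ∧
      ContDiffOn ℝ k e e.source ∧ ContDiffOn ℝ k e.symm e.target := by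
  have hk' : (k : ℕ∞ω) ≠ 0 := by exact_mod_cast hk
  have hk1 : (1 : ℕ∞ω) ≤ k := by exact_mod_cast Nat.one_le_iff_ne_zero.2 hk
  let e₀ := hf.toOpenPartialHomeomorph f hf' hk'
  have he₀ : ∀ y, e₀ y = f y := fun y => by
    rw [show e₀ = hf.toOpenPartialHomeomorph f hf' hk' from rfl,
      ContDiffAt.toOpenPartialHomeomorph_coe]
  -- The source is cut down to points where `f` is still `C^k` with invertible derivative; the
  -- inverse is then `C^k` at every point of the target, not only at `f x`.
  have hev : ∀ᶠ y in 𝓝 x, ContDiffAt ℝ k f y := hf.eventually (by simp)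
  have hcont : ContinuousAt (fderiv ℝ f) x :=
    (hf.fderiv_right (m := 0) (by simpa using hk1)).continuousAt
  have hinv : ∀ᶠ y in 𝓝 x, fderiv ℝ f y ∈ range ((↑) : (E ≃L[ℝ] F) → E →L[ℝ] F) := by
    apply hcont.eventually_mem
    rw [hf'.fderiv]
    exact ContinuousLinearEquiv.nhds f'
  obtain ⟨V, hVsub, hVo, hxV⟩ := mem_nhds_iff.1 (hev.and (hinv.and hO))
  refine ⟨e₀.restrOpen V hVo, ?_, ?_, ?_, ?_, ?_⟩
  · exact ⟨hf.mem_toOpenPartialHomeomorph_source hf' hk', hxV⟩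
  · exact fun y hy => (hVsub hy.2).2.2
  · intro y; exact he₀ y
  · intro y hy
    have h1 : ContDiffAt ℝ k f y := (hVsub hy.2).1
    exact (h1.congr_of_eventuallyEq (Eventually.of_forall he₀)).contDiffWithinAt
  · intro z hz
    have hy := (e₀.restrOpen V hVo).map_target hz
    obtain ⟨h1, ⟨g, hg⟩, -⟩ := hVsub hy.2
    refine ContDiffAt.contDiffWithinAt ?_
    refine OpenPartialHomeomorph.contDiffAt_symm (f₀' := g) (e₀.restrOpen V hVo) hz ?_ ?_
    · rw [hg]
      exact ((h1.differentiableAt hk').hasFDerivAt).congr_of_eventuallyEq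
        (Eventually.of_forall he₀)
    · exact h1.congr_of_eventuallyEq (Eventually.of_forall he₀)

/-- Near a regular point, the zero set of a `C^k` function is contained in the image of a `C^k`
parametrization by the kernel of the derivative. -/
theorem exists_parametrization_zeros [FiniteDimensional ℝ E] {g : E → ℝ} {x : E} {k : ℕ}
    (hk : k ≠ 0) (hg : ContDiffAt ℝ k g x) (hx : fderiv ℝ g x ≠ 0) :
    ∃ (φ : (fderiv ℝ g x).ker → E) (N : Set (fderiv ℝ g x).ker) (O : Set E), IsOpen N ∧
      ContDiffOn ℝ k φ N ∧ O ∈ 𝓝 x ∧ ∀ y ∈ O, g y = 0 → y ∈ φ '' N := by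
  set L := fderiv ℝ g x with hL
  obtain ⟨v, hv⟩ : ∃ v, L v ≠ 0 := by
    by_contra! h
    exact hx (ContinuousLinearMap.ext h)
  let R : ℝ →L[ℝ] E := ContinuousLinearMap.toSpanSingleton ℝ ((L v)⁻¹ • v)
  have hR : Function.RightInverse R L := fun t => by simp [R, hv]
  let A : E ≃L[ℝ] ℝ × L.ker := ContinuousLinearEquiv.equivOfRightInverse L R hR
  -- Completing `g` by a linear projection onto the kernel gives a local diffeomorphism that carries
  -- the zeros of `g` into the slice `{0} × ker`.
  let f : E → ℝ × L.ker := fun y => (g y, (A y).2)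
  have hA1 : ∀ y, (A y).1 = L y := fun y => by simp [A]
  have hk' : (k : ℕ∞ω) ≠ 0 := by exact_mod_cast hk
  have hf : ContDiffAt ℝ k f x :=
    hg.prodMk ((ContinuousLinearMap.snd ℝ ℝ L.ker ∘L (A : E →L[ℝ] ℝ × L.ker)).contDiff.contDiffAt)
  have hf' : HasFDerivAt f (A : E →L[ℝ] ℝ × L.ker) x := by
    have h1 := (hg.differentiableAt hk').hasFDerivAt.prodMk
      ((ContinuousLinearMap.snd ℝ ℝ L.ker ∘L (A : E →L[ℝ] ℝ × L.ker)).hasFDerivAt (x := x))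
    have h2 : (A : E →L[ℝ] ℝ × L.ker) =
        L.prod (ContinuousLinearMap.snd ℝ ℝ L.ker ∘L (A : E →L[ℝ] ℝ × L.ker)) :=
      ContinuousLinearMap.ext fun y => Prod.ext (hA1 y) rfl
    rw [h2]
    exact h1
  obtain ⟨e, hxe, -, hef, -, hes⟩ := exists_openPartialHomeomorph_contDiffOn hk hf hf' univ_mem
  refine ⟨fun w => e.symm (0, w), (fun w => ((0 : ℝ), w)) ⁻¹' e.target, e.source,
    e.open_target.preimage (by fun_prop), ?_, e.open_source.mem_nhds hxe, ?_⟩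
  · exact hes.comp (by fun_prop) (fun w hw => hw)
  · intro y hy hgy
    have h2 : e y = (0, (A y).2) := by rw [hef]; simp [f, hgy]
    refine ⟨(A y).2, ?_, ?_⟩
    · change (0, (A y).2) ∈ e.target
      rw [← h2]; exact e.map_source hy
    · change e.symm (0, (A y).2) = y
      rw [← h2]; exact e.left_inv hy

end InverseFunction

/-! ### Null images of sets on which a function is flat -/

section Sard

variable {E : Type*} [NormedAddCommGroup E] [NormedSpace ℝ E]

/-- The mean value inequality on the ball of radius `‖y - x‖` around `x` raises the order of
vanishing by one. Iterated, it replaces Taylor's formula. -/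
theorem isLittleO_sub_of_isLittleO_fderiv {F : Type*} [NormedAddCommGroup F] [NormedSpace ℝ F]
    {f : E → F} {x : E} {k : ℕ}
    (hd : ∀ᶠ y in 𝓝 x, DifferentiableAt ℝ f y)
    (h : fderiv ℝ f =o[𝓝 x] fun y => ‖y - x‖ ^ k) :
    (fun y => f y - f x) =o[𝓝 x] fun y => ‖y - x‖ ^ (k + 1) := by
  refine IsLittleO.of_bound fun c hc => ?_
  obtain ⟨r, hr, hball⟩ := Metric.eventually_nhds_iff_ball.1 (hd.and (h.bound hc))
  filter_upwards [Metric.ball_mem_nhds x hr] with y hy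
  have hsub : Metric.closedBall x ‖y - x‖ ⊆ Metric.ball x r :=
    Metric.closedBall_subset_ball (by simpa [dist_eq_norm] using hy)
  have := Convex.norm_image_sub_le_of_norm_fderiv_le (𝕜 := ℝ) (f := f) (C := c * ‖y - x‖ ^ k)
    (s := Metric.closedBall x ‖y - x‖) (x := x) (y := y)
    (fun z hz => (hball z (hsub hz)).1) (fun z hz => ?_) (convex_closedBall _ _)
    (by simp) (by simp [dist_eq_norm])
  · calc ‖f y - f x‖ ≤ c * ‖y - x‖ ^ k * ‖y - x‖ := this
      _ = c * ‖‖y - x‖ ^ (k + 1)‖ := by rw [Real.norm_of_nonneg (by positivity)]; ring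
  · refine ((hball z (hsub hz)).2).trans ?_
    rw [Real.norm_of_nonneg (by positivity)]
    gcongr
    simpa [dist_eq_norm] using hz

/-- A real function which is `o(‖y - x‖ ^ n)` near every point `x` of a set, in dimension `n`, maps
this set to a set of measure zero. -/
theorem volume_image_eq_zero_of_isLittleO [FiniteDimensional ℝ E] {n : ℕ} (hn : n ≠ 0)
    (hdim : Module.finrank ℝ E = n) {f : E → ℝ} {s : Set E}
    (h : ∀ x ∈ s, (fun y => f y - f x) =o[𝓝 x] fun y => ‖y - x‖ ^ n) :
    volume (f '' s) = 0 := by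
  let _ : MeasurableSpace E := borel E
  have _ : BorelSpace E := ⟨rfl⟩
  have _ : (μH[(n : ℝ)] : Measure E).IsAddHaarMeasure := by
    rw [← hdim]; exact isAddHaarMeasure_hausdorffMeasure
  -- reduction to bounded sets
  wlog hb : Bornology.IsBounded s generalizing s with H
  · have : f '' s = ⋃ k : ℕ, f '' (s ∩ Metric.closedBall 0 k) := by
      rw [← image_iUnion, ← inter_iUnion, Metric.iUnion_closedBall_nat, inter_univ]
    rw [this, measure_iUnion_null_iff]
    intro k
    exact H (fun x hx => h x hx.1) (Metric.isBounded_closedBall.subset inter_subset_right)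
  obtain ⟨B, hB⟩ : ∃ B : ℝ≥0, μH[(n : ℝ)] s ≤ B := by
    have := hb.measure_lt_top (μ := (μH[(n : ℝ)] : Measure E))
    exact ⟨(μH[(n : ℝ)] s).toNNReal, by rw [ENNReal.coe_toNNReal this.ne]⟩
  rw [← hausdorffMeasure_real]
  have key : ∀ ε : ℝ≥0, 0 < ε → (μH[1] : Measure ℝ) (f '' s) ≤ ε * B := by
    intro ε hε
    -- The little-o bound is not uniform in `x`. On `A m` it holds at the fixed scale `1 / (m + 1)`,
    -- and the sets `A m` increase to `s`.
    let A : ℕ → Set E := fun m => {x ∈ s | ∀ y, ‖y - x‖ < ((m : ℝ) + 1)⁻¹ →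
      |f y - f x| ≤ ε * ‖y - x‖ ^ n}
    have hA : s = ⋃ m, A m := by
      refine Subset.antisymm (fun x hx => ?_) (iUnion_subset fun m x hx => hx.1)
      obtain ⟨r, hr, hball⟩ := Metric.eventually_nhds_iff_ball.1
        ((h x hx).bound (show (0 : ℝ) < ε from hε))
      obtain ⟨m, hm⟩ := exists_nat_one_div_lt hr
      refine mem_iUnion.2 ⟨m, hx, fun y hy => ?_⟩
      have := hball y (by
        rw [Metric.mem_ball, dist_eq_norm]; rw [one_div] at hm; exact hy.trans hm)
      simpa [Real.norm_of_nonneg] using this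
    have hAmono : Monotone A := by
      intro m m' hmm x hx
      refine ⟨hx.1, fun y hy => hx.2 y (hy.trans_le ?_)⟩
      gcongr
    have hAm : ∀ m, (μH[1] : Measure ℝ) (f '' A m) ≤ ε * B := by
      intro m
      -- a countable measurable partition into small pieces
      obtain ⟨D, hD⟩ := TopologicalSpace.exists_countable_dense E
      have _ : Countable D := hD.1.to_subtype
      have hr : (0 : ℝ) < ((m : ℝ) + 1)⁻¹ / 2 := by positivity
      let b : D → Set E := fun d => Metric.ball (d : E) (((m : ℝ) + 1)⁻¹ / 2)
      have hcov : ⋃ d, b d = univ := by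
        refine eq_univ_of_forall fun x => ?_
        obtain ⟨d, hd, hxd⟩ := hD.2.exists_dist_lt x hr
        exact mem_iUnion.2 ⟨⟨d, hd⟩, hxd⟩
      obtain ⟨en⟩ : Nonempty (Encodable D) := ⟨Encodable.ofCountable D⟩
      have _ : Nonempty D := (nonempty_iff_univ_nonempty.2 (by
        rw [← hcov] at *
        obtain ⟨d, hd, -⟩ := hD.2.exists_dist_lt (0 : E) hr
        exact ⟨⟨d, hd⟩, trivial⟩))
      obtain ⟨q, hq⟩ := exists_surjective_nat D
      let c : ℕ → Set E := disjointed fun i => b (q i)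
      have hcm : ∀ i, MeasurableSet (c i) :=
        fun i => MeasurableSet.disjointed (fun i => measurableSet_ball) i
      have hcu : ⋃ i, c i = univ := by
        rw [iUnion_disjointed, ← hcov]
        exact hq.iUnion_comp b
      -- On a piece of diameter below the scale, `f` is Hölder of exponent `n` with constant `ε`,
      -- which bounds the length of the image by `ε` times the `n`-dimensional Hausdorff measure of
      -- the piece.
      have hpiece : ∀ i, (μH[1] : Measure ℝ) (f '' (A m ∩ c i)) ≤ ε * μH[(n : ℝ)] (A m ∩ c i) := by
        intro i
        have hhol : HolderOnWith ε n f (A m ∩ c i) := by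
          intro x hx y hy
          have hxb : x ∈ b (q i) := disjointed_subset (fun i => b (q i)) i hx.2
          have hyb : y ∈ b (q i) := disjointed_subset (fun i => b (q i)) i hy.2
          have hlt : ‖y - x‖ < ((m : ℝ) + 1)⁻¹ := by
            rw [← dist_eq_norm]
            calc dist y x ≤ dist y (q i) + dist x (q i) := dist_triangle_right _ _ _
              _ < ((m : ℝ) + 1)⁻¹ / 2 + ((m : ℝ) + 1)⁻¹ / 2 := add_lt_add hyb hxb
              _ = _ := by ring
          have h1 := hx.1.2 y hlt
          rw [NNReal.coe_natCast, ENNReal.rpow_natCast, edist_comm, edist_comm x y, edist_dist,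
            edist_dist, ← ENNReal.ofReal_pow dist_nonneg, ← ENNReal.ofReal_coe_nnreal,
            ← ENNReal.ofReal_mul (NNReal.coe_nonneg ε), Real.dist_eq, dist_eq_norm]
          exact ENNReal.ofReal_le_ofReal h1
        have := hhol.hausdorffMeasure_image_le (by positivity) (d := 1) zero_le_one
        simpa using this
      calc (μH[1] : Measure ℝ) (f '' A m) = μH[1] (⋃ i, f '' (A m ∩ c i)) := by
            rw [← image_iUnion, ← inter_iUnion, hcu, inter_univ]
        _ ≤ ∑' i, μH[1] (f '' (A m ∩ c i)) := measure_iUnion_le _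
        _ ≤ ∑' i, ε * μH[(n : ℝ)] (A m ∩ c i) := ENNReal.tsum_le_tsum hpiece
        _ = ε * ∑' i, μH[(n : ℝ)] (A m ∩ c i) := ENNReal.tsum_mul_left
        _ ≤ ε * μH[(n : ℝ)] s := by
            gcongr
            -- `A m` need not be measurable; additivity over the measurable pieces `c i` is taken in
            -- the restricted measure.
            have h2 : ∀ i, μH[(n : ℝ)] (A m ∩ c i) =
                ((μH[(n : ℝ)] : Measure E).restrict (A m)) (c i) := fun i => by
              rw [Measure.restrict_apply (hcm i), inter_comm]
            simp_rw [h2]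
            rw [← measure_iUnion (disjoint_disjointed _) hcm, hcu, Measure.restrict_apply_univ]
            exact measure_mono fun x hx => hx.1
        _ ≤ ε * B := by gcongr
    -- Continuity from below holds for increasing sequences of arbitrary sets, so the images need
    -- not be measurable either.
    have hlim := tendsto_measure_iUnion_atTop (μ := (μH[1] : Measure ℝ))
      (s := fun m => f '' A m) (fun m m' hmm => image_mono (hAmono hmm))
    rw [← image_iUnion, ← hA] at hlim
    exact le_of_tendsto' hlim hAm
  by_contra hne
  have hpos : 0 < (μH[1] : Measure ℝ) (f '' s) := pos_iff_ne_zero.2 hne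
  have hlim : Tendsto (fun ε : ℝ≥0 => ((ε * B : ℝ≥0) : ℝ≥0∞)) (𝓝[>] 0) (𝓝 0) := by
    have : Tendsto (fun ε : ℝ≥0 => ((ε * B : ℝ≥0) : ℝ≥0∞)) (𝓝 0) (𝓝 ((0 * B : ℝ≥0) : ℝ≥0∞)) :=
      (ENNReal.continuous_coe.comp (continuous_id.mul continuous_const)).tendsto 0
    simpa using this.mono_left nhdsWithin_le_nhds
  have := ge_of_tendsto (b := (μH[1] : Measure ℝ) (f '' s)) hlim (by
    filter_upwards [self_mem_nhdsWithin] with ε hε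
    simpa using key ε hε)
  exact hne (le_antisymm this bot_le)

/-- The set function `s ↦ volume (f '' s)` is an outer measure, so in a second countable space a
locally null set is null. -/
theorem volume_image_eq_zero_of_locally {X : Type*} [TopologicalSpace X]
    [SecondCountableTopology X] {f : X → ℝ} {s : Set X}
    (h : ∀ x ∈ s, ∃ O ∈ 𝓝 x, volume (f '' (s ∩ O)) = 0) : volume (f '' s) = 0 := by
  have := measure_null_of_locally_null (μ := OuterMeasure.comap f (volume : Measure ℝ).toOuterMeasure)
    s (fun x hx => by
      obtain ⟨O, hO, h0⟩ := h x hx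
      exact ⟨s ∩ O, inter_mem self_mem_nhdsWithin (mem_nhdsWithin_of_mem_nhds hO), by
        rw [OuterMeasure.comap_apply]; exact h0⟩)
  rw [OuterMeasure.comap_apply] at this
  exact this

end Sard

end PreparedTriples

namespace PreparedTriples

open MeasureTheory Measure Asymptotics
open scoped ENNReal NNReal

/-! ### Sard's theorem in dimensions two and three -/

section Sard

variable {E : Type*} [NormedAddCommGroup E] [NormedSpace ℝ E]

theorem isLittleO_of_fderiv_eq_zero {F : Type*} [NormedAddCommGroup F] [NormedSpace ℝ F]
    {f : E → F} {x : E} (hd : DifferentiableAt ℝ f x) (h0 : fderiv ℝ f x = 0) :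
    (fun y => f y - f x) =o[𝓝 x] fun y => ‖y - x‖ ^ 1 := by
  have := hd.hasFDerivAt.isLittleO
  rw [h0] at this
  simpa using this.norm_right

theorem isLittleO_sq_of_fderiv_fderiv_eq_zero {F : Type*} [NormedAddCommGroup F] [NormedSpace ℝ F]
    {f : E → F} {x : E} (hf : ContDiffAt ℝ 2 f x) (h1 : fderiv ℝ f x = 0)
    (h2 : fderiv ℝ (fderiv ℝ f) x = 0) :
    (fun y => f y - f x) =o[𝓝 x] fun y => ‖y - x‖ ^ 2 := by
  refine isLittleO_sub_of_isLittleO_fderiv ?_ ?_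
  · exact (hf.eventually (by simp)).mono fun y hy => hy.differentiableAt (by simp)
  · have := isLittleO_of_fderiv_eq_zero
      ((hf.fderiv_right (m := 1) (by norm_num)).differentiableAt (by simp)) h2
    simpa [h1] using this

theorem isLittleO_cube_of_fderiv_fderiv_fderiv_eq_zero {F : Type*} [NormedAddCommGroup F]
    [NormedSpace ℝ F] {f : E → F} {x : E} (hf : ContDiffAt ℝ 3 f x) (h1 : fderiv ℝ f x = 0)
    (h2 : fderiv ℝ (fderiv ℝ f) x = 0) (h3 : fderiv ℝ (fderiv ℝ (fderiv ℝ f)) x = 0) :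
    (fun y => f y - f x) =o[𝓝 x] fun y => ‖y - x‖ ^ 3 := by
  refine isLittleO_sub_of_isLittleO_fderiv ?_ ?_
  · exact (hf.eventually (by simp)).mono fun y hy => hy.differentiableAt (by simp)
  · have := isLittleO_sq_of_fderiv_fderiv_eq_zero
      (hf.fderiv_right (m := 2) (by norm_num)) h2 h3
    simpa [h1] using this

theorem finrank_ker_of_ne_zero [FiniteDimensional ℝ E] {L : E →L[ℝ] ℝ} (hL : L ≠ 0) {n : ℕ}
    (hn : Module.finrank ℝ E = n + 1) : Module.finrank ℝ L.ker = n := by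
  have h1 := LinearMap.finrank_range_add_finrank_ker (L : E →ₗ[ℝ] ℝ)
  have h2 : LinearMap.range (L : E →ₗ[ℝ] ℝ) = ⊤ :=
    LinearMap.range_eq_top.2 (LinearMap.surjective (fun h => hL (by
      ext v; exact LinearMap.congr_fun h v)))
  rw [h2, finrank_top, Module.finrank_self] at h1
  have h3 : Module.finrank ℝ (LinearMap.ker (L : E →ₗ[ℝ] ℝ)) = n := by omega
  exact h3

/-- **Sard's theorem** for functions of class `C²` in dimension two. -/
theorem sard_two [FiniteDimensional ℝ E] (hdim : Module.finrank ℝ E = 2) {f : E → ℝ} {V : Set E}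
    (hV : IsOpen V) (hf : ContDiffOn ℝ 2 f V) :
    volume (f '' {x ∈ V | fderiv ℝ f x = 0}) = 0 := by
  have hfx : ∀ x ∈ V, ContDiffAt ℝ 2 f x := fun x hx => hf.contDiffAt (hV.mem_nhds hx)
  set C := {x ∈ V | fderiv ℝ f x = 0} with hC
  have hsplit : C ⊆ {x ∈ C | fderiv ℝ (fderiv ℝ f) x = 0} ∪
      {x ∈ C | fderiv ℝ (fderiv ℝ f) x ≠ 0} := fun x hx => by
    by_cases h : fderiv ℝ (fderiv ℝ f) x = 0
    · exact Or.inl ⟨hx, h⟩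
    · exact Or.inr ⟨hx, h⟩
  refine measure_mono_null (image_mono hsplit) ?_
  rw [image_union]
  refine measure_union_null ?_ ?_
  · exact volume_image_eq_zero_of_isLittleO two_ne_zero hdim
      fun x hx => isLittleO_sq_of_fderiv_fderiv_eq_zero (hfx x hx.1.1) hx.1.2 hx.2
  · refine volume_image_eq_zero_of_locally fun x hx => ?_
    -- Near `x` the critical points lie on the `C¹` curve where the derivative of `f` along `w`
    -- vanishes. Composed with a parametrization of this curve, `f` is flat to first order at them,
    -- which suffices in dimension one.
    obtain ⟨w, hw⟩ : ∃ w, (fderiv ℝ (fderiv ℝ f) x).flip w ≠ 0 := by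
      by_contra! h
      exact hx.2 (by ext v w; exact DFunLike.congr_fun (h w) v)
    let g : E → ℝ := fun y => fderiv ℝ f y w
    have hDf : ContDiffAt ℝ 1 (fderiv ℝ f) x := (hfx x hx.1.1).fderiv_right (by norm_num)
    have hg : ContDiffAt ℝ (1 : ℕ) g x := hDf.clm_apply contDiffAt_const
    have hgx : fderiv ℝ g x ≠ 0 := by
      have : fderiv ℝ g x = (fderiv ℝ (fderiv ℝ f) x).flip w := by
        ext v
        simp only [g]
        rw [fderiv_clm_apply (hDf.differentiableAt (by simp)) (by fun_prop)]
        simp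
      rwa [this]
    obtain ⟨φ, N, O, hN, hφ, hO, hON⟩ := exists_parametrization_zeros one_ne_zero hg hgx
    refine ⟨O, hO, ?_⟩
    refine measure_mono_null (t := (f ∘ φ) '' (N ∩ φ ⁻¹' C)) ?_ ?_
    · rintro _ ⟨y, ⟨hy, hyO⟩, rfl⟩
      have hgy : g y = 0 := by simp only [g]; rw [hy.1.2]; rfl
      obtain ⟨z, hz, rfl⟩ := hON y hyO hgy
      exact ⟨z, ⟨hz, hy.1⟩, rfl⟩
    · refine volume_image_eq_zero_of_isLittleO one_ne_zero (finrank_ker_of_ne_zero hgx hdim) ?_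
      rintro z ⟨hz, hzC⟩
      have h1 : DifferentiableAt ℝ φ z :=
        (hφ.contDiffAt (hN.mem_nhds hz)).differentiableAt (by simp)
      have h2 : DifferentiableAt ℝ f (φ z) := (hfx _ hzC.1).differentiableAt (by simp)
      refine isLittleO_of_fderiv_eq_zero (h2.comp z h1) ?_
      rw [fderiv_comp z h2 h1, hzC.2, ContinuousLinearMap.zero_comp]

/-- **Sard's theorem** for functions of class `C³` in dimension three. -/
theorem sard_three [FiniteDimensional ℝ E] (hdim : Module.finrank ℝ E = 3) {f : E → ℝ} {V : Set E}
    (hV : IsOpen V) (hf : ContDiffOn ℝ 3 f V) :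
    volume (f '' {x ∈ V | fderiv ℝ f x = 0}) = 0 := by
  have hfx : ∀ x ∈ V, ContDiffAt ℝ 3 f x := fun x hx => hf.contDiffAt (hV.mem_nhds hx)
  set C := {x ∈ V | fderiv ℝ f x = 0} with hC
  have hsplit : C ⊆ {x ∈ C | fderiv ℝ (fderiv ℝ f) x = 0 ∧ fderiv ℝ (fderiv ℝ (fderiv ℝ f)) x = 0} ∪
      ({x ∈ C | fderiv ℝ (fderiv ℝ f) x = 0 ∧ fderiv ℝ (fderiv ℝ (fderiv ℝ f)) x ≠ 0} ∪
      {x ∈ C | fderiv ℝ (fderiv ℝ f) x ≠ 0}) := fun x hx => by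
    by_cases h : fderiv ℝ (fderiv ℝ f) x = 0
    · by_cases h' : fderiv ℝ (fderiv ℝ (fderiv ℝ f)) x = 0
      · exact Or.inl ⟨hx, h, h'⟩
      · exact Or.inr (Or.inl ⟨hx, h, h'⟩)
    · exact Or.inr (Or.inr ⟨hx, h⟩)
  refine measure_mono_null (image_mono hsplit) ?_
  rw [image_union, image_union]
  refine measure_union_null ?_ (measure_union_null ?_ ?_)
  · exact volume_image_eq_zero_of_isLittleO three_ne_zero hdim
      fun x hx => isLittleO_cube_of_fderiv_fderiv_fderiv_eq_zero (hfx x hx.1.1) hx.1.2 hx.2.1 hx.2.2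
  · refine volume_image_eq_zero_of_locally fun x hx => ?_
    -- This stratum lies in a surface that is only `C¹`, so `sard_two` does not apply. Instead `f`
    -- is flat to second order at its points, and composing with a differentiable parametrization
    -- preserves this.
    obtain ⟨v, w, hvw⟩ : ∃ v w, ∃ u, fderiv ℝ (fderiv ℝ (fderiv ℝ f)) x u v w ≠ 0 := by
      by_contra! h
      exact hx.2.2 (by ext u v w; exact h v w u)
    let g : E → ℝ := fun y => fderiv ℝ (fderiv ℝ f) y v w
    have hDf : ContDiffAt ℝ 1 (fderiv ℝ (fderiv ℝ f)) x :=
      ((hfx x hx.1.1).fderiv_right (m := 2) (by norm_num)).fderiv_right (by norm_num)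
    have hg : ContDiffAt ℝ (1 : ℕ) g x := (hDf.clm_apply contDiffAt_const).clm_apply contDiffAt_const
    have hgx : fderiv ℝ g x ≠ 0 := by
      obtain ⟨u, hu⟩ := hvw
      intro h0
      apply hu
      rw [← show fderiv ℝ g x u = fderiv ℝ (fderiv ℝ (fderiv ℝ f)) x u v w from ?_, h0]
      · rfl
      · have hd := hDf.differentiableAt (one_ne_zero)
        have h1 := ((hd.hasFDerivAt.clm_apply (hasFDerivAt_const v x)).clm_apply
          (hasFDerivAt_const w x)).fderiv
        simp only [g]
        rw [h1]
        simp
    obtain ⟨φ, N, O, hN, hφ, hO, hON⟩ := exists_parametrization_zeros one_ne_zero hg hgx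
    refine ⟨O, hO, ?_⟩
    refine measure_mono_null
      (t := (f ∘ φ) '' (N ∩ φ ⁻¹' {x ∈ C | fderiv ℝ (fderiv ℝ f) x = 0})) ?_ ?_
    · rintro _ ⟨y, ⟨hy, hyO⟩, rfl⟩
      have hgy : g y = 0 := by simp only [g]; rw [hy.2.1]; rfl
      obtain ⟨z, hz, rfl⟩ := hON y hyO hgy
      exact ⟨z, ⟨hz, hy.1, hy.2.1⟩, rfl⟩
    · refine volume_image_eq_zero_of_isLittleO two_ne_zero (finrank_ker_of_ne_zero hgx hdim) ?_
      rintro z ⟨hz, hzC, hz2⟩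
      have h1 : DifferentiableAt ℝ φ z :=
        (hφ.contDiffAt (hN.mem_nhds hz)).differentiableAt (by simp)
      have h2 := isLittleO_sq_of_fderiv_fderiv_eq_zero ((hfx _ hzC.1).of_le (by norm_num)) hzC.2 hz2
      have h3 := h2.comp_tendsto h1.continuousAt.tendsto
      refine h3.trans_isBigO ?_
      exact (h1.hasFDerivAt.isBigO_sub.norm_left.norm_right).pow 2
  · refine volume_image_eq_zero_of_locally fun x hx => ?_
    -- Here the surface is the zero set of a first derivative, hence `C²`. The restriction of `f` is
    -- `C²` and inherits the critical points, so `sard_two` applies.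
    obtain ⟨w, hw⟩ : ∃ w, (fderiv ℝ (fderiv ℝ f) x).flip w ≠ 0 := by
      by_contra! h
      exact hx.2 (by ext v w; exact DFunLike.congr_fun (h w) v)
    let g : E → ℝ := fun y => fderiv ℝ f y w
    have hDf : ContDiffAt ℝ 2 (fderiv ℝ f) x := (hfx x hx.1.1).fderiv_right (by norm_num)
    have hg : ContDiffAt ℝ (2 : ℕ) g x := hDf.clm_apply contDiffAt_const
    have hgx : fderiv ℝ g x ≠ 0 := by
      have : fderiv ℝ g x = (fderiv ℝ (fderiv ℝ f) x).flip w := by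
        ext v
        simp only [g]
        rw [fderiv_clm_apply (hDf.differentiableAt (by simp)) (by fun_prop)]
        simp
      rwa [this]
    obtain ⟨φ, N, O, hN, hφ, hO, hON⟩ := exists_parametrization_zeros two_ne_zero hg hgx
    refine ⟨O, hO, ?_⟩
    have hN' : IsOpen (N ∩ φ ⁻¹' V) := hφ.continuousOn.isOpen_inter_preimage hN hV
    have hcomp : ContDiffOn ℝ 2 (f ∘ φ) (N ∩ φ ⁻¹' V) :=
      (hf.of_le (by norm_num)).comp (hφ.mono inter_subset_left) fun z hz => hz.2
    refine measure_mono_null ?_ (sard_two (finrank_ker_of_ne_zero hgx hdim) hN' hcomp)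
    rintro _ ⟨y, ⟨hy, hyO⟩, rfl⟩
    have hgy : g y = 0 := by simp only [g]; rw [hy.1.2]; rfl
    obtain ⟨z, hz, rfl⟩ := hON y hyO hgy
    refine ⟨z, ⟨⟨hz, hy.1.1⟩, ?_⟩, rfl⟩
    have h1 : DifferentiableAt ℝ φ z :=
      (hφ.contDiffAt (hN.mem_nhds hz)).differentiableAt (by simp)
    have h2 : DifferentiableAt ℝ f (φ z) := (hfx _ hy.1.1).differentiableAt (by simp)
    rw [fderiv_comp z h2 h1, hy.1.2, ContinuousLinearMap.zero_comp]

end Sard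

end PreparedTriples

namespace PreparedTriples

open MeasureTheory

/-! ### Regular points and critical values on a 3-manifold -/

section ManifoldSard

variable {M : Type u} [TopologicalSpace M] [ChartedSpace E3 M]
  {V : Type*} [NormedAddCommGroup V] [NormedSpace ℝ V]
  {W : Type*} [NormedAddCommGroup W] [NormedSpace ℝ W]

theorem mfderiv_eq_fderiv_comp {e : OpenPartialHomeomorph M V}
    (he : e.MDifferentiable (𝓡 3) 𝓘(ℝ, V)) {f : M → W} {y : M} (hy : y ∈ e.source)
    (hf : MDifferentiableAt (𝓡 3) 𝓘(ℝ, W) f y) (v : TangentSpace (𝓡 3) y) :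
    mfderiv (𝓡 3) 𝓘(ℝ, W) f y v =
      fderiv ℝ (f ∘ e.symm) (e y) (mfderiv (𝓡 3) 𝓘(ℝ, V) e y v) := by
  have hs : MDifferentiableAt 𝓘(ℝ, V) (𝓡 3) e.symm (e y) :=
    he.mdifferentiableAt_symm (e.map_source hy)
  have hf' : MDifferentiableAt (𝓡 3) 𝓘(ℝ, W) f (e.symm (e y)) := by rwa [e.left_inv hy]
  have hg : MDifferentiableAt 𝓘(ℝ, V) 𝓘(ℝ, W) (f ∘ e.symm) (e y) := hf'.comp _ hs
  have hev : f =ᶠ[𝓝 y] (f ∘ e.symm) ∘ e := by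
    filter_upwards [e.open_source.mem_nhds hy] with z hz
    simp [e.left_inv hz]
  rw [hev.mfderiv_eq, mfderiv_comp y hg (he.mdifferentiableAt hy), ← mfderiv_eq_fderiv]
  rfl

theorem mfderiv_eq_zero_iff_fderiv {e : OpenPartialHomeomorph M V}
    (he : e.MDifferentiable (𝓡 3) 𝓘(ℝ, V)) {f : M → W} {y : M} (hy : y ∈ e.source)
    (hf : MDifferentiableAt (𝓡 3) 𝓘(ℝ, W) f y) :
    mfderiv (𝓡 3) 𝓘(ℝ, W) f y = 0 ↔ fderiv ℝ (f ∘ e.symm) (e y) = 0 := by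
  constructor
  · intro h
    ext w
    obtain ⟨v, hv⟩ := he.mfderiv_surjective hy w
    have := mfderiv_eq_fderiv_comp he hy hf v
    rw [h, hv] at this
    exact this.symm
  · intro h
    ext v
    rw [mfderiv_eq_fderiv_comp he hy hf v, h]
    rfl

/-- `e` is a chart of class `C³` with values in a normed space. -/
structure IsC3Chart (e : OpenPartialHomeomorph M V) : Prop where
  contMDiffOn : ContMDiffOn (𝓡 3) 𝓘(ℝ, V) 3 e e.source
  contMDiffOn_symm : ContMDiffOn 𝓘(ℝ, V) (𝓡 3) 3 e.symm e.target

theorem IsC3Chart.mdifferentiable {e : OpenPartialHomeomorph M V} (he : IsC3Chart e) :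
    e.MDifferentiable (𝓡 3) 𝓘(ℝ, V) :=
  ⟨he.contMDiffOn.mdifferentiableOn (by norm_num),
    he.contMDiffOn_symm.mdifferentiableOn (by norm_num)⟩

theorem IsC3Chart.contDiffOn_comp_symm {e : OpenPartialHomeomorph M V} (he : IsC3Chart e)
    {f : M → W} {U : Set M} (hf : ContMDiffOn (𝓡 3) 𝓘(ℝ, W) 3 f U) :
    ContDiffOn ℝ 3 (f ∘ e.symm) (e.target ∩ e.symm ⁻¹' U) := by
  rw [← contMDiffOn_iff_contDiffOn]
  exact hf.comp (he.contMDiffOn_symm.mono inter_subset_left) fun y hy => hy.2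

theorem isC3Chart_chartAt [IsManifold (𝓡 3) ∞ M] (x : M) : IsC3Chart (chartAt E3 x) := by
  have : IsManifold (𝓡 3) 3 M := IsManifold.of_le (n := ∞) ENat.LEInfty.out
  exact ⟨contMDiffOn_chart, contMDiffOn_chart_symm⟩

/-- The regular points of a function of class `C³` form an open set. -/
theorem isOpen_mfderiv_ne_zero [IsManifold (𝓡 3) ∞ M] {f : M → ℝ} {U : Set M} (hU : IsOpen U)
    (hf : ContMDiffOn (𝓡 3) 𝓘(ℝ, ℝ) 3 f U) :
    IsOpen {x ∈ U | mfderiv (𝓡 3) 𝓘(ℝ, ℝ) f x ≠ 0} := by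
  rw [isOpen_iff_mem_nhds]
  rintro x ⟨hx, hfx⟩
  set e := chartAt E3 x
  have he : IsC3Chart e := isC3Chart_chartAt x
  have hxs : x ∈ e.source := mem_chart_source E3 x
  have hmd : ∀ y ∈ U, MDifferentiableAt (𝓡 3) 𝓘(ℝ, ℝ) f y := fun y hy =>
    (hf.contMDiffAt (hU.mem_nhds hy)).mdifferentiableAt (by norm_num)
  have hcd := he.contDiffOn_comp_symm hf
  have hop : IsOpen (e.target ∩ e.symm ⁻¹' U) := e.isOpen_inter_preimage_symm hU
  have hmem : e x ∈ e.target ∩ e.symm ⁻¹' U :=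
    ⟨e.map_source hxs, by simpa [e.left_inv hxs] using hx⟩
  have hc : ContinuousAt (fderiv ℝ (f ∘ e.symm)) (e x) :=
    ((hcd.contDiffAt (hop.mem_nhds hmem)).fderiv_right (m := 0) (by norm_num)).continuousAt
  have hne : fderiv ℝ (f ∘ e.symm) (e x) ≠ 0 := fun h =>
    hfx ((mfderiv_eq_zero_iff_fderiv he.mdifferentiable hxs (hmd x hx)).2 h)
  have := (hc.comp (e.continuousAt hxs)).eventually_ne hne
  filter_upwards [this, hU.mem_nhds hx, e.open_source.mem_nhds hxs] with y h1 h2 h3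
  exact ⟨h2, fun h => h1 ((mfderiv_eq_zero_iff_fderiv he.mdifferentiable h3 (hmd y h2)).1 h)⟩

/-- **Sard's theorem** for functions of class `C³` on a `3`-manifold. -/
theorem volume_criticalValues_eq_zero [IsManifold (𝓡 3) ∞ M] [SecondCountableTopology M]
    {f : M → ℝ} {U : Set M} (hU : IsOpen U) (hf : ContMDiffOn (𝓡 3) 𝓘(ℝ, ℝ) 3 f U) :
    volume (f '' {x ∈ U | mfderiv (𝓡 3) 𝓘(ℝ, ℝ) f x = 0}) = 0 := by
  refine volume_image_eq_zero_of_locally fun x hx => ?_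
  set e := chartAt E3 x
  have he : IsC3Chart e := isC3Chart_chartAt x
  refine ⟨e.source, e.open_source.mem_nhds (mem_chart_source E3 x), ?_⟩
  have hop : IsOpen (e.target ∩ e.symm ⁻¹' U) := e.isOpen_inter_preimage_symm hU
  refine measure_mono_null ?_ (sard_three (E := E3) (by simp) hop (he.contDiffOn_comp_symm hf))
  rintro _ ⟨y, ⟨⟨hyU, hy0⟩, hys⟩, rfl⟩
  refine ⟨e y, ⟨⟨e.map_source hys, by simpa [e.left_inv hys] using hyU⟩, ?_⟩,
    by simp [e.left_inv hys]⟩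
  exact (mfderiv_eq_zero_iff_fderiv he.mdifferentiable hys
    ((hf.contMDiffAt (hU.mem_nhds hyU)).mdifferentiableAt (by norm_num))).1 hy0

end ManifoldSard

end PreparedTriples

namespace PreparedTriples

/-! ### Commuting vector fields in a normed space -/

section LocalCommutation

variable {E : Type*} [NormedAddCommGroup E] [NormedSpace ℝ E]

open Asymptotics in
/-- If a family `η h` of integral curves of `Y` is tangent to `X` at `h = 0` at the initial time, and
if `X` and `Y` commute, then it is tangent to `X` at `h = 0` at all later times. -/
theorem hasDerivAt_family_of_commute {X Y : E → E} {z : E} {R : ℝ} {K : NNReal} {C : ℝ} (hR : 0 < R)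
    (hY : LipschitzOnWith K Y (Metric.ball z R))
    (hY2 : ∀ y ∈ Metric.ball z R, ∀ y' ∈ Metric.ball z R,
      ‖Y y' - Y y - fderiv ℝ Y y (y' - y)‖ ≤ C * ‖y' - y‖ ^ 2)
    (hX : ∀ y ∈ Metric.ball z R, DifferentiableAt ℝ X y)
    (hXY : ∀ y ∈ Metric.ball z R, fderiv ℝ X y (Y y) = fderiv ℝ Y y (X y))
    (hXC : ∀ y ∈ Metric.ball z R, ‖X y‖ ≤ C)
    {a b : ℝ} {η : ℝ → ℝ → E}
    (h0 : ∀ s ∈ Icc a b, η 0 s ∈ Metric.ball z (R / 2))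
    (hη : ∀ᶠ h in 𝓝 (0 : ℝ), ∀ s ∈ Icc a b,
      η h s ∈ Metric.ball z R ∧ HasDerivAt (η h) (Y (η h s)) s)
    (ha : HasDerivAt (fun h => η h a) (X (η 0 a)) 0) :
    ∀ s ∈ Icc a b, HasDerivAt (fun h => η h s) (X (η 0 s)) 0 := by
  intro s hs
  have hη0 := hη.self_of_nhds
  have hC : 0 ≤ C := (norm_nonneg _).trans (hXC z (Metric.mem_ball_self hR))
  -- A positive Lipschitz constant puts Gronwall's bound in its exponential form.
  set K' : NNReal := K + 1 with hK'
  have hK'0 : (K' : ℝ) ≠ 0 := by positivity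
  have hYK : LipschitzOnWith K' Y (Metric.ball z R) := hY.weaken (by simp [hK'])
  have hsmall : ∀ᶠ h in 𝓝 (0 : ℝ), |h| * C < R / 2 := by
    have : Tendsto (fun h : ℝ => |h| * C) (𝓝 0) (𝓝 (|0| * C)) :=
      (continuous_abs.mul continuous_const).tendsto 0
    rw [abs_zero, zero_mul] at this
    exact this.eventually_lt_const (by linarith)
  have hball : Metric.ball z (R / 2) ⊆ Metric.ball z R := Metric.ball_subset_ball (by linarith)
  -- The curve `η 0 + h X(η 0)` is compared with the solution `η h`. Since `DX·Y = DY·X`, its defect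
  -- as a solution is the second order Taylor remainder of `Y`, at most `C · (hC)²`. Gronwall adds
  -- this to the initial error, which is `o(h)`.
  have key : ∀ᶠ h in 𝓝 (0 : ℝ), ‖η h s - η 0 s - h • X (η 0 s)‖ ≤
      ‖η h a - η 0 a - h • X (η 0 a)‖ * Real.exp (K' * (s - a)) +
        C * (C * C) / K' * (Real.exp (K' * (s - a)) - 1) * h ^ 2 := by
    filter_upwards [hη, hsmall] with h hh hsm
    have hmem : ∀ t ∈ Icc a b, η 0 t + h • X (η 0 t) ∈ Metric.ball z R := by
      intro t ht
      have h1 := h0 t ht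
      have h2 := hXC _ (hball h1)
      rw [Metric.mem_ball, dist_eq_norm] at h1 ⊢
      calc ‖η 0 t + h • X (η 0 t) - z‖ = ‖(η 0 t - z) + h • X (η 0 t)‖ := by congr 1; abel
        _ ≤ ‖η 0 t - z‖ + |h| * ‖X (η 0 t)‖ := by
            refine (norm_add_le _ _).trans ?_
            rw [norm_smul, Real.norm_eq_abs]
        _ ≤ ‖η 0 t - z‖ + |h| * C := by gcongr
        _ < R := by linarith
    have hder : ∀ t ∈ Icc a b, HasDerivAt (fun t => η 0 t + h • X (η 0 t))
        (Y (η 0 t) + h • fderiv ℝ X (η 0 t) (Y (η 0 t))) t := by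
      intro t ht
      have h1 := (hη0 t ht).2
      have h2 := ((hX _ (hη0 t ht).1).hasFDerivAt.comp_hasDerivAt t h1).const_smul h
      exact h1.add h2
    have := dist_le_of_approx_trajectories_ODE_of_mem (v := fun _ => Y) (K := K')
      (s := fun _ => Metric.ball z R) (a := a) (b := b) (f := η h)
      (g := fun t => η 0 t + h • X (η 0 t)) (f' := fun t => Y (η h t))
      (g' := fun t => Y (η 0 t) + h • fderiv ℝ X (η 0 t) (Y (η 0 t)))
      (εf := 0) (εg := C * (C * C) * h ^ 2) (δ := ‖η h a - η 0 a - h • X (η 0 a)‖)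
      (fun t ht => hYK)
      (fun t ht => (hh t ht).2.continuousAt.continuousWithinAt)
      (fun t ht => (hh t (Ico_subset_Icc_self ht)).2.hasDerivWithinAt)
      (fun t ht => by simp)
      (fun t ht => (hh t (Ico_subset_Icc_self ht)).1)
      (fun t ht => (hder t ht).continuousAt.continuousWithinAt)
      (fun t ht => (hder t (Ico_subset_Icc_self ht)).hasDerivWithinAt)
      (fun t ht => by
        have ht' := Ico_subset_Icc_self ht
        have h1 := hY2 _ (hη0 t ht').1 _ (hmem t ht')
        have h2 := hXC _ (hη0 t ht').1
        rw [hXY _ (hη0 t ht').1, dist_eq_norm, ← norm_neg]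
        rw [add_sub_cancel_left, map_smul] at h1
        have h3 : -(Y (η 0 t) + h • fderiv ℝ Y (η 0 t) (X (η 0 t)) - Y (η 0 t + h • X (η 0 t))) =
            Y (η 0 t + h • X (η 0 t)) - Y (η 0 t) - h • fderiv ℝ Y (η 0 t) (X (η 0 t)) := by abel
        rw [h3]
        refine h1.trans ?_
        rw [norm_smul, mul_pow, Real.norm_eq_abs, sq_abs]
        have h4 : ‖X (η 0 t)‖ ^ 2 ≤ C * C := by nlinarith [norm_nonneg (X (η 0 t))]
        calc C * (h ^ 2 * ‖X (η 0 t)‖ ^ 2) ≤ C * (h ^ 2 * (C * C)) := by gcongr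
          _ = _ := by ring)
      (fun t ht => hmem t (Ico_subset_Icc_self ht))
      (le_of_eq (by rw [dist_eq_norm]; congr 1; abel)) s hs
    rw [dist_eq_norm, gronwallBound_of_K_ne_0 hK'0, zero_add, ← sub_sub] at this
    refine this.trans (le_of_eq ?_)
    ring
  rw [hasDerivAt_iff_isLittleO_nhds_zero] at ha ⊢
  simp only [zero_add] at ha ⊢
  have h1 : (fun h : ℝ => ‖η h a - η 0 a - h • X (η 0 a)‖ * Real.exp (K' * (s - a)) +
        C * (C * C) / K' * (Real.exp (K' * (s - a)) - 1) * h ^ 2) =o[𝓝 0] fun h => h := by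
    refine IsLittleO.add ?_ ?_
    · simp_rw [mul_comm _ (Real.exp (K' * (s - a)))]
      exact ha.norm_left.const_mul_left _
    · refine IsLittleO.const_mul_left ?_ _
      have := isLittleO_pow_pow (𝕜 := ℝ) (m := 1) (n := 2) (by norm_num)
      simpa using this
  refine IsBigO.trans_isLittleO (IsBigO.of_bound 1 ?_) h1
  filter_upwards [key] with h hh
  rw [one_mul]
  exact hh.trans (le_abs_self _)

/-- A vector field of class `C²` satisfies uniform first and second order estimates near each
point. -/
theorem exists_lipschitzOnWith_and_taylor {Y : E → E} {z : E} (hY : ContDiffAt ℝ 2 Y z) :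
    ∃ R > 0, ∃ (K : NNReal) (C : ℝ), LipschitzOnWith K Y (Metric.ball z R) ∧
      ∀ y ∈ Metric.ball z R, ∀ y' ∈ Metric.ball z R,
        ‖Y y' - Y y - fderiv ℝ Y y (y' - y)‖ ≤ C * ‖y' - y‖ ^ 2 := by
  obtain ⟨K, t, ht, hK⟩ := (hY.of_le one_le_two).exists_lipschitzOnWith
  obtain ⟨K2, t2, ht2, hK2⟩ := (hY.fderiv_right (m := 1) (by norm_num)).exists_lipschitzOnWith
  have hev : ∀ᶠ y in 𝓝 z, DifferentiableAt ℝ Y y :=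
    (hY.eventually (by simp)).mono fun y hy => hy.differentiableAt (by simp)
  obtain ⟨R, hR, hball⟩ := Metric.mem_nhds_iff.1 (inter_mem (inter_mem ht ht2) hev)
  refine ⟨R, hR, K, K2, hK.mono fun y hy => (hball hy).1.1, fun y hy y' hy' => ?_⟩
  have hseg : segment ℝ y y' ⊆ Metric.ball z R := (convex_ball z R).segment_subset hy hy'
  have := Convex.norm_image_sub_le_of_norm_hasFDerivWithin_le' (f := Y) (f' := fderiv ℝ Y)
    (φ := fderiv ℝ Y y) (C := K2 * ‖y' - y‖) (s := segment ℝ y y') (x := y) (y := y')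
    (fun x hx => ((hball (hseg hx)).2).hasFDerivAt.hasFDerivWithinAt)
    (fun x hx => ?_) (convex_segment y y') (left_mem_segment ℝ y y') (right_mem_segment ℝ y y')
  · refine this.trans (le_of_eq (by ring))
  · have h1 := hK2.dist_le_mul x (hball (hseg hx)).1.2 y (hball hy).1.2
    rw [dist_eq_norm, dist_eq_norm] at h1
    refine h1.trans ?_
    gcongr
    have := norm_sub_le_of_mem_segment hx
    exact this

end LocalCommutation

end PreparedTriples

namespace PreparedTriples

/-! ### Vector fields read in charts -/

section ChartField

variable {M : Type u} [TopologicalSpace M] [ChartedSpace E3 M]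

/-- The vector field `X` read in the preferred chart at `x₀`. -/
def chartField (X : ∀ x : M, TangentSpace (𝓡 3) x) (x₀ : M) : E3 → E3 :=
  VectorField.mpullback 𝓘(ℝ, E3) (𝓡 3) (chartAt E3 x₀).symm X

variable [IsManifold (𝓡 3) ∞ M]

theorem isInvertible_mfderiv_chart_symm {x₀ : M} {z : E3} (hz : z ∈ (chartAt E3 x₀).target) :
    (mfderiv 𝓘(ℝ, E3) (𝓡 3) (chartAt E3 x₀).symm z).IsInvertible := by
  have h := (isC3Chart_chartAt (M := M) x₀).mdifferentiable
  exact ⟨h.symm.mfderiv hz, rfl⟩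

theorem chartField_apply (X : ∀ x : M, TangentSpace (𝓡 3) x) {x₀ y : M}
    (hy : y ∈ (chartAt E3 x₀).source) :
    chartField X x₀ (chartAt E3 x₀ y) =
      mfderiv (𝓡 3) 𝓘(ℝ, E3) (chartAt E3 x₀) y (X y) := by
  have h := (isC3Chart_chartAt (M := M) x₀).mdifferentiable
  have hz := (chartAt E3 x₀).map_source hy
  refine (isInvertible_mfderiv_chart_symm hz).inverse_apply_eq.2 ?_
  have h1 : (X ((chartAt E3 x₀).symm (chartAt E3 x₀ y)) : E3) = X y :=
    congrArg (fun w => (X w : E3)) ((chartAt E3 x₀).left_inv hy)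
  exact h1.trans (DFunLike.congr_fun (h.symm_comp_deriv hy) (X y)).symm

theorem contDiffOn_chartField {X : ∀ x : M, TangentSpace (𝓡 3) x} (hX : IsCrVectorField 3 X)
    (x₀ : M) : ContDiffOn ℝ 3 (chartField X x₀) (chartAt E3 x₀).target := by
  intro z hz
  have h1 : ContMDiffAt 𝓘(ℝ, E3) (𝓡 3) ∞ (chartAt E3 x₀).symm z :=
    (contMDiffOn_chart_symm (n := ∞) (x := x₀)).contMDiffAt
      ((chartAt E3 x₀).open_target.mem_nhds hz)
  -- Pulling back a field differentiates the chart once, so a `C³` expression needs a `C⁴`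
  -- structure.
  have h3 : IsManifold (𝓡 3) 4 M := IsManifold.of_le (n := ∞) ENat.LEInfty.out
  have := ContMDiffAt.mpullback_vectorField_preimage (m := 3) (n := 4)
    (hX ((chartAt E3 x₀).symm z)) (h1.of_le ENat.LEInfty.out)
    (isInvertible_mfderiv_chart_symm hz) (by norm_num)
  exact (contMDiffAt_vectorSpace_iff_contDiffAt.1 this).contDiffWithinAt

/-- The Lie bracket is natural under pullback, and in a vector space its vanishing is this identity
between derivatives. -/
theorem fderiv_chartField_commute {X Y : ∀ x : M, TangentSpace (𝓡 3) x}
    (hX : IsCrVectorField 3 X) (hY : IsCrVectorField 3 Y)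
    (hXY : ∀ x : M, VectorField.mlieBracket (𝓡 3) X Y x = 0) {x₀ : M} {z : E3}
    (hz : z ∈ (chartAt E3 x₀).target) :
    fderiv ℝ (chartField X x₀) z (chartField Y x₀ z) =
      fderiv ℝ (chartField Y x₀) z (chartField X x₀ z) := by
  have h1 : ContMDiffAt 𝓘(ℝ, E3) (𝓡 3) ∞ (chartAt E3 x₀).symm z :=
    (contMDiffOn_chart_symm (n := ∞) (x := x₀)).contMDiffAt
      ((chartAt E3 x₀).open_target.mem_nhds hz)
  have h3 : IsManifold (𝓡 3) (minSmoothness ℝ 2) M := by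
    rw [minSmoothness_of_isRCLikeNormedField]
    exact IsManifold.of_le (n := ∞) ENat.LEInfty.out
  have := VectorField.mpullback_mlieBracket (I := 𝓘(ℝ, E3)) (I' := 𝓡 3) (n := 2)
    ((hX ((chartAt E3 x₀).symm z)).mdifferentiableAt (by norm_num))
    ((hY ((chartAt E3 x₀).symm z)).mdifferentiableAt (by norm_num)) (h1.of_le ENat.LEInfty.out)
    (by simp)
  rw [VectorField.mpullback_apply, hXY, map_zero, ← VectorField.mlieBracketWithin_univ] at this
  have h4 := this.trans (congrFun (VectorField.mlieBracketWithin_eq_lieBracketWithin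
    (V := chartField X x₀) (W := chartField Y x₀) (s := univ)) z)
  rw [VectorField.lieBracketWithin_univ] at h4
  exact (sub_eq_zero.1 h4.symm).symm

/-- A curve has velocity `X` if and only if its expression in a chart does. -/
theorem hasMFDerivAt_iff_hasDerivAt_chart {X : ∀ x : M, TangentSpace (𝓡 3) x} {x₀ : M}
    {γ : ℝ → M} {t : ℝ} (hγ : ContinuousAt γ t) (ht : γ t ∈ (chartAt E3 x₀).source) :
    HasMFDerivAt 𝓘(ℝ, ℝ) (𝓡 3) γ t ((1 : ℝ →L[ℝ] ℝ).smulRight (X (γ t))) ↔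
      HasDerivAt (chartAt E3 x₀ ∘ γ) (chartField X x₀ (chartAt E3 x₀ (γ t))) t := by
  have h := (isC3Chart_chartAt (M := M) x₀).mdifferentiable
  rw [chartField_apply X ht]
  obtain ⟨w, hw⟩ : ∃ w : E3, w = mfderiv (𝓡 3) 𝓘(ℝ, E3) (chartAt E3 x₀) (γ t) (X (γ t)) := ⟨_, rfl⟩
  rw [← hw]
  have hiff : HasDerivAt (chartAt E3 x₀ ∘ γ) w t ↔ HasMFDerivAt 𝓘(ℝ, ℝ) 𝓘(ℝ, E3)
      (chartAt E3 x₀ ∘ γ) t ((1 : ℝ →L[ℝ] ℝ).smulRight w) :=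
    hasDerivAt_iff_hasFDerivAt.trans hasMFDerivAt_iff_hasFDerivAt.symm
  refine Iff.trans ?_ hiff.symm
  constructor
  · intro hd
    refine (HasMFDerivAt.comp t ((h.mdifferentiableAt ht).hasMFDerivAt) hd).congr_mfderiv ?_
    refine ContinuousLinearMap.ext fun a => ?_
    exact (map_smul (mfderiv (𝓡 3) 𝓘(ℝ, E3) (chartAt E3 x₀) (γ t)) (show ℝ from a) (X (γ t))).trans
      (congrArg (fun w : E3 => (show ℝ from a) • w) hw.symm)
  · intro hd
    have hev : γ =ᶠ[𝓝 t] (chartAt E3 x₀).symm ∘ (chartAt E3 x₀ ∘ γ) := by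
      filter_upwards [hγ.preimage_mem_nhds ((chartAt E3 x₀).open_source.mem_nhds ht)] with s hs
      exact ((chartAt E3 x₀).left_inv hs).symm
    have h1 := (HasMFDerivAt.comp t
      ((h.mdifferentiableAt_symm ((chartAt E3 x₀).map_source ht)).hasMFDerivAt)
      hd).congr_of_eventuallyEq hev
    refine h1.congr_mfderiv (ContinuousLinearMap.ext fun a => ?_)
    have h2 : (mfderiv 𝓘(ℝ, E3) (𝓡 3) (chartAt E3 x₀).symm (chartAt E3 x₀ (γ t)) w : E3) =
        X (γ t) := by
      rw [hw]; exact DFunLike.congr_fun (h.symm_comp_deriv ht) (X (γ t))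
    exact (map_smul (mfderiv 𝓘(ℝ, E3) (𝓡 3) (chartAt E3 x₀).symm (chartAt E3 x₀ (γ t)))
      (show ℝ from a) w).trans (congrArg (fun w : E3 => (show ℝ from a) • w) h2)

end ChartField

end PreparedTriples

namespace PreparedTriples

/-! ### Transport of tangent curves by the flow of a commuting field -/

section Flow

theorem IsCrVectorField.contMDiff_one {M : Type u} [TopologicalSpace M] [ChartedSpace E3 M]
    [IsManifold (𝓡 3) ∞ M] {Y : ∀ x : M, TangentSpace (𝓡 3) x} (hY : IsCrVectorField 3 Y) :
    ContMDiff (𝓡 3) (𝓡 3).tangent 1 (fun x => (⟨x, Y x⟩ : TangentBundle (𝓡 3) M)) :=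
  ContMDiff.of_le hY (by norm_num)

variable {M : Type u} [TopologicalSpace M] [ChartedSpace E3 M] [IsManifold (𝓡 3) ∞ M] [T2Space M]
  {X Y : ∀ x : M, TangentSpace (𝓡 3) x} {φ : M → ℝ → M}

theorem flow_add (hY : IsCrVectorField 3 Y) (hφ0 : ∀ x, φ x 0 = x)
    (hφ : ∀ x, IsMIntegralCurve (φ x) Y) (x : M) (s t : ℝ) : φ (φ x s) t = φ x (t + s) := by
  have : IsManifold (𝓡 3) 1 M := IsManifold.of_le (n := ∞) ENat.LEInfty.out
  have h1 := (hφ x).comp_add s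
  have := isMIntegralCurve_Ioo_eq_of_contMDiff_boundaryless (t₀ := 0) hY.contMDiff_one
    (hφ (φ x s)) h1 (by simp [hφ0])
  exact congrFun this t

/-- The only form of joint continuity of the flow that is needed, near time zero. Picard–Lindelöf in
a chart gives a continuous local flow, and uniqueness of integral curves identifies it with `φ`. -/
theorem exists_flow_mem (hY : IsCrVectorField 3 Y) (hφ0 : ∀ x, φ x 0 = x)
    (hφ : ∀ x, IsMIntegralCurve (φ x) Y) (y : M) {O : Set M} (hO : O ∈ 𝓝 y) :
    ∃ N ∈ 𝓝 y, ∃ ε > 0, ∀ y' ∈ N, ∀ t : ℝ, |t| < ε → φ y' t ∈ O := by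
  have : IsManifold (𝓡 3) 1 M := IsManifold.of_le (n := ∞) ENat.LEInfty.out
  set e := chartAt E3 y with he
  have hys : y ∈ e.source := mem_chart_source E3 y
  have hz : e y ∈ e.target := e.map_source hys
  have hf : ContDiffAt ℝ 1 (chartField Y y) (e y) :=
    ((contDiffOn_chartField hY y).contDiffAt (e.open_target.mem_nhds hz)).of_le (by norm_num)
  obtain ⟨ε, hε, a, r, L, K, hr, hpl⟩ := IsPicardLindelof.of_contDiffAt_one hf
  obtain ⟨α, hα, hαc⟩ := (hpl 0).exists_forall_mem_closedBall_eq_hasDerivWithinAt_continuousOn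
  have hr' : (0 : ℝ) < r := hr
  have hα0 : α (e y, 0) = e y := (hα (e y) (Metric.mem_closedBall_self hr'.le)).1
  have hnhds : Metric.closedBall (e y) r ×ˢ Icc (0 - ε) (0 + ε) ∈ 𝓝 (e y, (0 : ℝ)) :=
    prod_mem_nhds (Metric.closedBall_mem_nhds _ hr') (Icc_mem_nhds (by linarith) (by linarith))
  have hca : ContinuousAt α (e y, 0) := hαc.continuousAt hnhds
  have hW : e.target ∩ e.symm ⁻¹' O ∈ 𝓝 (α (e y, 0)) := by
    rw [hα0]
    refine inter_mem (e.open_target.mem_nhds hz) ((e.continuousAt_symm hz).preimage_mem_nhds ?_)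
    rwa [e.left_inv hys]
  obtain ⟨B, hB, T, hT, hBT⟩ := mem_nhds_prod_iff.1 (inter_mem (hca.preimage_mem_nhds hW) hnhds)
  obtain ⟨δ, hδ, hδT⟩ := Metric.mem_nhds_iff.1 hT
  refine ⟨e.source ∩ e ⁻¹' B, inter_mem (e.open_source.mem_nhds hys)
    ((e.continuousAt hys).preimage_mem_nhds hB), δ, hδ, ?_⟩
  rintro y' ⟨hy's, hy'B⟩ t ht
  have hmemT : ∀ t ∈ Ioo (-δ) δ, t ∈ T := fun t ht => hδT (by
    rw [Metric.mem_ball, dist_zero_right, Real.norm_eq_abs]; exact abs_lt.2 ht)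
  have h1 : ∀ t ∈ Ioo (-δ) δ, α (e y', t) ∈ e.target ∩ e.symm ⁻¹' O := fun t ht =>
    (hBT (mk_mem_prod hy'B (hmemT t ht))).1
  have h2 : ∀ t ∈ Ioo (-δ) δ, HasDerivAt (fun t => α (e y', t)) (chartField Y y (α (e y', t))) t := by
    intro t ht
    have hball := (hBT (mk_mem_prod hy'B (hmemT t ht))).2
    refine ((hα (e y') hball.1).2 t hball.2).hasDerivAt ?_
    refine mem_of_superset (Ioo_mem_nhds ht.1 ht.2) fun t' ht' => ?_
    exact (hBT (mk_mem_prod hy'B (hmemT t' ht'))).2.2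
  have h0 : (0 : ℝ) ∈ Ioo (-δ) δ := ⟨by linarith, hδ⟩
  have hα0' : α (e y', 0) = e y' := (hα (e y') (hBT (mk_mem_prod hy'B (hmemT 0 h0))).2.1).1
  have hβ : IsMIntegralCurveOn (fun t => e.symm (α (e y', t))) Y (Ioo (-δ) δ) := by
    intro t ht
    have hc : ContinuousAt (fun t => e.symm (α (e y', t))) t :=
      ContinuousAt.comp (e.continuousAt_symm (h1 t ht).1) (h2 t ht).continuousAt
    refine HasMFDerivAt.hasMFDerivWithinAt ?_
    refine (hasMFDerivAt_iff_hasDerivAt_chart (x₀ := y) hc (e.map_target (h1 t ht).1)).2 ?_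
    rw [← he, e.right_inv (h1 t ht).1]
    refine (h2 t ht).congr_of_eventuallyEq ?_
    filter_upwards [Ioo_mem_nhds ht.1 ht.2] with t' ht'
    exact e.right_inv (h1 t' ht').1
  have heq := isMIntegralCurveOn_Ioo_eqOn_of_contMDiff_boundaryless h0 hY.contMDiff_one
    ((hφ y').isMIntegralCurveOn _) hβ (by rw [hφ0, hα0', e.left_inv hy's])
  rw [heq (abs_lt.1 ht)]
  exact (h1 t (abs_lt.1 ht)).2

/-- The flow of `Y` maps a curve tangent to `X` at a point to a curve tangent to `X`. -/
theorem hasMFDerivAt_flow_of_commute (hX : IsCrVectorField 3 X) (hY : IsCrVectorField 3 Y)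
    (hXY : ∀ x : M, VectorField.mlieBracket (𝓡 3) X Y x = 0) (hφ0 : ∀ x, φ x 0 = x)
    (hφ : ∀ x, IsMIntegralCurve (φ x) Y) {θ : ℝ → M}
    (hθ : HasMFDerivAt 𝓘(ℝ, ℝ) (𝓡 3) θ 0 ((1 : ℝ →L[ℝ] ℝ).smulRight (X (θ 0)))) (s : ℝ) :
    HasMFDerivAt 𝓘(ℝ, ℝ) (𝓡 3) (fun h => φ (θ h) s) 0
      ((1 : ℝ →L[ℝ] ℝ).smulRight (X (φ (θ 0) s))) := by
  let D : Set ℝ := {s | HasMFDerivAt 𝓘(ℝ, ℝ) (𝓡 3) (fun h => φ (θ h) s) 0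
      ((1 : ℝ →L[ℝ] ℝ).smulRight (X (φ (θ 0) s)))}
  -- The set `D` of good times contains `0`. It is both open and closed once being good spreads
  -- between any two times close to a given `s₀`, and this is a question in one chart.
  have key : ∀ s₀ : ℝ, ∃ δ > 0, ∀ s₁, |s₁ - s₀| < δ → ∀ s₂, |s₂ - s₀| < δ → s₁ ∈ D → s₂ ∈ D := by
    intro s₀
    set y := φ (θ 0) s₀ with hy
    set e := chartAt E3 y with he
    have hys : y ∈ e.source := mem_chart_source E3 y
    have hz : e y ∈ e.target := e.map_source hys
    have htn : e.target ∈ 𝓝 (e y) := e.open_target.mem_nhds hz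
    have hXe : ContDiffAt ℝ 3 (chartField X y) (e y) := (contDiffOn_chartField hX y).contDiffAt htn
    have hYe : ContDiffAt ℝ 3 (chartField Y y) (e y) := (contDiffOn_chartField hY y).contDiffAt htn
    obtain ⟨R₁, hR₁, K, C₁, hK, hC₁⟩ :=
      exists_lipschitzOnWith_and_taylor (hYe.of_le (by norm_num))
    obtain ⟨R₂, hR₂, hb₂⟩ := Metric.mem_nhds_iff.1 (inter_mem htn
      (hXe.continuousAt.norm.eventually_lt_const (lt_add_one ‖chartField X y (e y)‖)))
    set R := min R₁ R₂
    have hR : 0 < R := lt_min hR₁ hR₂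
    set C := max C₁ (‖chartField X y (e y)‖ + 1)
    have hs₁ : Metric.ball (e y) R ⊆ Metric.ball (e y) R₁ :=
      Metric.ball_subset_ball (min_le_left _ _)
    have hs₂ : Metric.ball (e y) R ⊆ Metric.ball (e y) R₂ :=
      Metric.ball_subset_ball (min_le_right _ _)
    obtain ⟨N, hN, ε, hε, hflow⟩ := exists_flow_mem hY hφ0 hφ y
      (O := e.source ∩ e ⁻¹' Metric.ball (e y) (R / 2))
      (inter_mem (e.open_source.mem_nhds hys) ((e.continuousAt hys).preimage_mem_nhds
        (Metric.ball_mem_nhds _ (by linarith))))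
    have hφc : ContinuousAt (φ (θ 0)) s₀ := (hφ (θ 0)).continuous.continuousAt
    obtain ⟨δ₁, hδ₁, hδN⟩ := Metric.mem_nhds_iff.1 (hφc.preimage_mem_nhds
      (interior_mem_nhds.2 hN))
    refine ⟨min δ₁ (ε / 2), lt_min hδ₁ (by linarith), fun s₁ hs₁' s₂ hs₂' hD => ?_⟩
    have hs₁N : φ (θ 0) s₁ ∈ interior N := hδN (by
      rw [Metric.mem_ball, Real.dist_eq]; exact hs₁'.trans_le (min_le_left _ _))
    -- Goodness of `s₁` includes continuity in `h`; this keeps the neighbouring orbits in the chart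
    -- for all times between `s₁` and `s₂`.
    have hcont : ContinuousAt (fun h => φ (θ h) s₁) 0 := HasMFDerivAt.continuousAt hD
    -- all nearby orbits stay in the chart
    have hin : ∀ᶠ h in 𝓝 (0 : ℝ), ∀ s ∈ uIcc s₁ s₂,
        φ (θ h) s ∈ e.source ∩ e ⁻¹' Metric.ball (e y) (R / 2) := by
      filter_upwards [hcont.preimage_mem_nhds (isOpen_interior.mem_nhds hs₁N)] with h hh s hs
      have h1 := hflow _ (interior_subset hh) (s - s₁) (by
        have h2 : |s - s₁| ≤ |s₂ - s₁| := abs_sub_left_of_mem_uIcc hs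
        have h3 : |s₂ - s₁| ≤ |s₂ - s₀| + |s₁ - s₀| := by
          rw [show s₂ - s₁ = (s₂ - s₀) - (s₁ - s₀) by ring]; exact abs_sub _ _
        have h4 := hs₁'.trans_le (min_le_right _ _)
        have h5 := hs₂'.trans_le (min_le_right _ _)
        linarith)
      rwa [flow_add hY hφ0 hφ, sub_add_cancel] at h1
    have hsub : Metric.ball (e y) (R / 2) ⊆ Metric.ball (e y) R :=
      Metric.ball_subset_ball (by linarith)
    have hder : ∀ h s, φ (θ h) s ∈ e.source → HasDerivAt (fun s => e (φ (θ h) s))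
        (chartField Y y (e (φ (θ h) s))) s := fun h s hs =>
      (hasMFDerivAt_iff_hasDerivAt_chart (x₀ := y) (hφ (θ h)).continuous.continuousAt hs).1
        (hφ (θ h) s)
    have hstart : HasDerivAt (fun h => e (φ (θ h) s₁)) (chartField X y (e (φ (θ 0) s₁))) 0 :=
      (hasMFDerivAt_iff_hasDerivAt_chart (x₀ := y) hcont
        (hin.self_of_nhds s₁ left_mem_uIcc).1).1 hD
    have hYlip : LipschitzOnWith K (chartField Y y) (Metric.ball (e y) R) := hK.mono hs₁
    have hYt : ∀ w ∈ Metric.ball (e y) R, ∀ w' ∈ Metric.ball (e y) R,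
        ‖chartField Y y w' - chartField Y y w - fderiv ℝ (chartField Y y) w (w' - w)‖ ≤
          C * ‖w' - w‖ ^ 2 := fun w hw w' hw' => (hC₁ w (hs₁ hw) w' (hs₁ hw')).trans (by
        gcongr; exact le_max_left _ _)
    have hXd : ∀ w ∈ Metric.ball (e y) R, DifferentiableAt ℝ (chartField X y) w := fun w hw =>
      ((contDiffOn_chartField hX y).contDiffAt
        (e.open_target.mem_nhds (hb₂ (hs₂ hw)).1)).differentiableAt (by norm_num)
    have hXYe : ∀ w ∈ Metric.ball (e y) R, fderiv ℝ (chartField X y) w (chartField Y y w) =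
        fderiv ℝ (chartField Y y) w (chartField X y w) := fun w hw =>
      fderiv_chartField_commute hX hY hXY (hb₂ (hs₂ hw)).1
    have hXC : ∀ w ∈ Metric.ball (e y) R, ‖chartField X y w‖ ≤ C := fun w hw =>
      (le_of_lt (hb₂ (hs₂ hw)).2).trans (le_max_right _ _)
    have hend : HasDerivAt (fun h => e (φ (θ h) s₂)) (chartField X y (e (φ (θ 0) s₂))) 0 := by
      rcases le_total s₁ s₂ with hle | hle
      · rw [uIcc_of_le hle] at hin
        exact hasDerivAt_family_of_commute hR hYlip hYt hXd hXYe hXC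
          (η := fun h s => e (φ (θ h) s)) (a := s₁) (b := s₂)
          (fun s hs => (hin.self_of_nhds s hs).2)
          (hin.mono fun h hh s hs => ⟨hsub (hh s hs).2, hder h s (hh s hs).1⟩)
          hstart s₂ ⟨hle, le_rfl⟩
      -- Backwards in time, the reversed curves are integral curves of `-Y`, which satisfies the
      -- same estimates with the same constants and still commutes with `X`.
      · rw [uIcc_of_ge hle] at hin
        have hneg : ∀ s ∈ Icc (-s₁) (-s₂), -s ∈ Icc s₂ s₁ := fun s hs =>
          ⟨by linarith [hs.2], by linarith [hs.1]⟩
        have hfd : ∀ w, fderiv ℝ (fun w => -chartField Y y w) w = -fderiv ℝ (chartField Y y) w :=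
          fun w => fderiv_fun_neg
        have := hasDerivAt_family_of_commute (X := chartField X y) (Y := fun w => -chartField Y y w)
          (K := K) (C := C) hR hYlip.neg
          (fun w hw w' hw' => by
            rw [hfd, neg_apply, ← norm_neg]
            refine (le_of_eq (congrArg norm ?_)).trans (hYt w hw w' hw')
            abel)
          hXd (fun w hw => by
            rw [hfd, neg_apply, map_neg, hXYe w hw]) hXC
          (η := fun h s => e (φ (θ h) (-s))) (a := -s₁) (b := -s₂)
          (fun s hs => (hin.self_of_nhds (-s) (hneg s hs)).2)
          (hin.mono fun h hh s hs => ⟨hsub (hh _ (hneg s hs)).2, by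
            have := (hder h (-s) (hh _ (hneg s hs)).1).scomp s (hasDerivAt_neg s)
            simpa [Function.comp_def] using this⟩)
          (by simpa using hstart) (-s₂) ⟨by linarith, le_rfl⟩
        simpa using this
    -- back to the manifold
    have hc₂ : ContinuousAt (fun h => φ (θ h) s₂) 0 := by
      have h1 : (fun h => φ (θ h) s₂) =ᶠ[𝓝 0] fun h => e.symm (e (φ (θ h) s₂)) := by
        filter_upwards [hin] with h hh
        exact (e.left_inv (hh s₂ right_mem_uIcc).1).symm
      refine ContinuousAt.congr ?_ h1.symm
      exact ContinuousAt.comp (e.continuousAt_symm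
        (e.map_source (hin.self_of_nhds s₂ right_mem_uIcc).1)) hend.continuousAt
    exact (hasMFDerivAt_iff_hasDerivAt_chart (x₀ := y) hc₂
      (hin.self_of_nhds s₂ right_mem_uIcc).1).2 hend
  have hclopen : IsClopen D := by
    constructor
    · rw [← isOpen_compl_iff, Metric.isOpen_iff]
      intro s₀ hs₀
      obtain ⟨δ, hδ, h⟩ := key s₀
      exact ⟨δ, hδ, fun s₁ hs₁ hD => hs₀ (h s₁ (by simpa [Real.dist_eq] using hs₁) s₀ (by simpa) hD)⟩
    · rw [Metric.isOpen_iff]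
      intro s₀ hs₀
      obtain ⟨δ, hδ, h⟩ := key s₀
      exact ⟨δ, hδ, fun s₁ hs₁ => h s₀ (by simpa) s₁ (by simpa [Real.dist_eq] using hs₁) hs₀⟩
  have hne : D.Nonempty := ⟨0, by
    have h1 := hθ.congr_of_eventuallyEq
      (show (fun h => φ (θ h) 0) =ᶠ[𝓝 0] θ from Eventually.of_forall fun h => hφ0 _)
    exact h1.congr_mfderiv (congrArg
      (fun y => ((1 : ℝ →L[ℝ] ℝ).smulRight (X y : E3) : ℝ →L[ℝ] E3)) (hφ0 (θ 0)).symm)⟩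
  have : s ∈ D := by rw [hclopen.eq_univ hne]; trivial
  exact this

end Flow

end PreparedTriples

namespace PreparedTriples

/-! ### Completeness of `X - cY` and invariance of zero sets -/

section Completeness

variable {M : Type u} [TopologicalSpace M] [ChartedSpace E3 M] [IsManifold (𝓡 3) ∞ M] [T2Space M]
  {X Y : ∀ x : M, TangentSpace (𝓡 3) x}

open Asymptotics in
/-- A curve tangent to `X`, moved along the flow of `Y` with speed `k`, becomes tangent to
`X + k Y`. -/
theorem hasMFDerivAt_flow_diagonal {φ : M → ℝ → M} (hY : IsCrVectorField 3 Y)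
    (hφ0 : ∀ x, φ x 0 = x) (hφ : ∀ x, IsMIntegralCurve (φ x) Y) (k : ℝ) {θ : ℝ → M}
    (hθ : HasMFDerivAt 𝓘(ℝ, ℝ) (𝓡 3) θ 0 ((1 : ℝ →L[ℝ] ℝ).smulRight (X (θ 0)))) :
    HasMFDerivAt 𝓘(ℝ, ℝ) (𝓡 3) (fun h => φ (θ h) (k * h)) 0
      ((1 : ℝ →L[ℝ] ℝ).smulRight (X (θ 0) + k • Y (θ 0))) := by
  set y := θ 0 with hy
  set e := chartAt E3 y with he
  have hys : y ∈ e.source := mem_chart_source E3 y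
  have hz : e y ∈ e.target := e.map_source hys
  have hYc : ContinuousAt (chartField Y y) (e y) :=
    ((contDiffOn_chartField hY y).contDiffAt (e.open_target.mem_nhds hz)).continuousAt
  have hθc : ContinuousAt θ 0 := hθ.continuousAt
  have hk : Tendsto (fun h : ℝ => k * h) (𝓝 0) (𝓝 0) := by
    have : Tendsto (fun h : ℝ => k * h) (𝓝 0) (𝓝 (k * 0)) :=
      (continuous_const.mul continuous_id).tendsto 0
    rwa [mul_zero] at this
  have hin : ∀ O ∈ 𝓝 y, ∀ᶠ h in 𝓝 (0 : ℝ), ∀ t, |t| ≤ |k * h| → φ (θ h) t ∈ O := by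
    intro O hO
    obtain ⟨N, hN, ε, hε, hflow⟩ := exists_flow_mem hY hφ0 hφ y hO
    filter_upwards [hθc.preimage_mem_nhds hN, hk.abs.eventually_lt_const
      (show |(0 : ℝ)| < ε by simpa)] with h h1 h2 t ht
    exact hflow _ h1 t (ht.trans_lt h2)
  have hmain : HasDerivAt (fun h => e (φ (θ h) (k * h)))
      (chartField X y (e y) + k • chartField Y y (e y)) 0 := by
    have h1 : HasDerivAt (fun h => e (θ h)) (chartField X y (e y)) 0 :=
      (hasMFDerivAt_iff_hasDerivAt_chart (x₀ := y) hθc hys).1 hθ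
    -- The displacement along `Y` during time `k h` starts from the moving point `θ h`. The mean
    -- value inequality compares it with `k h Y(y)`, because `Y` is nearly constant around `y`; the
    -- denominator `|k| + 1` below also covers `k = 0`.
    have h2 : HasDerivAt (fun h => e (φ (θ h) (k * h)) - e (θ h)) (k • chartField Y y (e y)) 0 := by
      rw [hasDerivAt_iff_isLittleO_nhds_zero]
      simp only [zero_add, mul_zero, hφ0, sub_self, sub_zero]
      refine IsLittleO.of_bound fun c hc => ?_
      have hk1 : (0 : ℝ) < |k| + 1 := by positivity
      have hO : e.source ∩ e ⁻¹' (chartField Y y ⁻¹'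
          Metric.closedBall (chartField Y y (e y)) (c / (|k| + 1))) ∈ 𝓝 y :=
        inter_mem (e.open_source.mem_nhds hys) ((e.continuousAt hys).preimage_mem_nhds
          (hYc.preimage_mem_nhds (Metric.closedBall_mem_nhds _ (by positivity))))
      filter_upwards [hin _ hO] with h hh
      have hseg : ∀ t ∈ uIcc 0 (k * h), |t| ≤ |k * h| := fun t ht => by
        simpa using abs_sub_left_of_mem_uIcc ht
      have := Convex.norm_image_sub_le_of_norm_hasDerivWithin_le
        (f := fun t => e (φ (θ h) t) - t • chartField Y y (e y))
        (f' := fun t => chartField Y y (e (φ (θ h) t)) - chartField Y y (e y))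
        (C := c / (|k| + 1)) (s := uIcc 0 (k * h)) (x := 0) (y := k * h)
        (fun t ht => by
          have h3 := (hasMFDerivAt_iff_hasDerivAt_chart (x₀ := y)
            (hφ (θ h)).continuous.continuousAt (hh t (hseg t ht)).1).1 (hφ (θ h) t)
          have h4 := h3.sub ((hasDerivAt_id t).smul_const (chartField Y y (e y)))
          rw [one_smul] at h4
          exact h4.hasDerivWithinAt)
        (fun t ht => by
          have := (hh t (hseg t ht)).2
          rwa [mem_preimage, mem_preimage, Metric.mem_closedBall, dist_eq_norm] at this)
        (convex_uIcc 0 (k * h)) left_mem_uIcc right_mem_uIcc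
      rw [zero_smul, sub_zero, hφ0, sub_zero, sub_right_comm, mul_comm k h, mul_smul] at this
      rw [mul_comm k h]
      refine this.trans ?_
      rw [norm_mul, Real.norm_eq_abs k]
      calc c / (|k| + 1) * (‖h‖ * |k|) ≤ c / (|k| + 1) * (‖h‖ * (|k| + 1)) := by
            gcongr; linarith
        _ = c * ‖h‖ := by field_simp
    have h3 := h1.add h2
    refine h3.congr_of_eventuallyEq (Eventually.of_forall fun h => ?_)
    simp
  have hc : ContinuousAt (fun h => φ (θ h) (k * h)) 0 := by
    have h0 : φ (θ 0) (k * 0) = y := by rw [mul_zero, hφ0]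
    intro O hO
    rw [show (fun h => φ (θ h) (k * h)) 0 = y from h0] at hO
    exact (hin O hO).mono fun h hh => hh (k * h) le_rfl
  have h0 : φ (θ 0) (k * 0) = θ 0 := by rw [mul_zero, hφ0]
  have hs : φ (θ 0) (k * 0) ∈ (chartAt E3 y).source := by rw [h0]; exact hys
  have h5 := (hasMFDerivAt_iff_hasDerivAt_chart (X := fun x => X x + k • Y x) (x₀ := y) hc hs).2 (by
    rw [h0, chartField_apply _ hys, map_add, map_smul]
    rw [chartField_apply X hys, chartField_apply Y hys] at hmain
    exact hmain)
  exact h5.congr_mfderiv (congrArg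
      (fun x => ((1 : ℝ →L[ℝ] ℝ).smulRight (X x + k • Y x : E3) : ℝ →L[ℝ] E3)) h0)

/-- If `X` and `Y` are commuting complete vector fields, then `X - cY` is complete. -/
theorem IsCompleteVectorField.sub_smul (hX : IsCrVectorField 3 X) (hY : IsCrVectorField 3 Y)
    (hXY : ∀ x : M, VectorField.mlieBracket (𝓡 3) X Y x = 0) (hXc : IsCompleteVectorField X)
    (hYc : IsCompleteVectorField Y) (c : ℝ) : IsCompleteVectorField fun x => X x - c • Y x := by
  choose φ hφ0 hφ using hYc
  intro x
  obtain ⟨γ, hγ0, hγ⟩ := hXc x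
  -- Composing the flow of `X` with the time-rescaled flow of `Y` gives the flow of `X - cY`; it is
  -- defined for all times because both factors are.
  refine ⟨fun t => φ (γ t) (-c * t), by simp [hφ0, hγ0], fun t => ?_⟩
  -- the curve `h ↦ φ (γ (t + h)) (-c t)` is tangent to `X`
  have h1 : HasMFDerivAt 𝓘(ℝ, ℝ) (𝓡 3) (fun h => γ (h + t)) 0
      ((1 : ℝ →L[ℝ] ℝ).smulRight (X (γ (0 + t)))) := (hγ.comp_add t) 0
  have h2 := hasMFDerivAt_flow_of_commute hX hY hXY hφ0 hφ h1 (-c * t)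
  have h3 := hasMFDerivAt_flow_diagonal hY hφ0 hφ (-c) h2
  -- The time `-c(t + h)` is split by the group law, which reduces the derivative at `t` to the
  -- diagonal derivative at `0`.
  have h4 : (fun h => φ (φ (γ (h + t)) (-c * t)) (-c * h)) =
      (fun s => φ (γ s) (-c * s)) ∘ fun h => h + t := by
    funext h
    rw [flow_add hY hφ0 hφ]
    simp only [Function.comp]
    congr 1
    ring
  rw [h4] at h3
  have h5 : HasMFDerivAt 𝓘(ℝ, ℝ) 𝓘(ℝ, ℝ) (fun s : ℝ => s - t) t (ContinuousLinearMap.id ℝ ℝ) :=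
    hasMFDerivAt_iff_hasFDerivAt.2 ((hasFDerivAt_id t).sub_const t)
  rw [← sub_self t] at h3
  have h6 := HasMFDerivAt.comp (f := fun s : ℝ => s - t) t h3 h5
  have h7 : ((fun s => φ (γ s) (-c * s)) ∘ fun h => h + t) ∘ (fun s : ℝ => s - t) =
      fun s => φ (γ s) (-c * s) := by
    funext s
    simp
  rw [h7] at h6
  refine h6.congr_mfderiv ?_
  have h8 : φ (γ (t - t + t)) (-c * t) = φ (γ t) (-c * t) := by rw [sub_add_cancel]
  have h9 : (X (φ (γ (t - t + t)) (-c * t)) + -c • Y (φ (γ (t - t + t)) (-c * t)) : E3) =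
      X (φ (γ t) (-c * t)) - c • Y (φ (γ t) (-c * t)) :=
    (congrArg (fun y => (X y + -c • Y y : E3)) h8).trans (by rw [sub_eq_add_neg, ← neg_smul])
  exact ContinuousLinearMap.ext fun a => congrArg (fun v : E3 => (show ℝ from a) • v) h9

/-- The zero set of a vector field is invariant under the flow of any vector field commuting with
it. -/
theorem flow_mem_zeroSet_of_commute (hX : IsCrVectorField 3 X) (hY : IsCrVectorField 3 Y)
    (hXY : ∀ x : M, VectorField.mlieBracket (𝓡 3) X Y x = 0) {φ : M → ℝ → M}
    (hφ0 : ∀ x, φ x 0 = x) (hφ : ∀ x, IsMIntegralCurve (φ x) Y) {x : M} (hx : X x = 0) (s : ℝ) :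
    X (φ x s) = 0 := by
  -- A constant curve at a zero of `X` is tangent to `X`. The flow of `Y` carries it to a constant
  -- curve which is again tangent to `X`, so `X` vanishes at the image point.
  have h1 : HasMFDerivAt 𝓘(ℝ, ℝ) (𝓡 3) (fun _ : ℝ => x) 0 ((1 : ℝ →L[ℝ] ℝ).smulRight (X x)) := by
    refine (hasMFDerivAt_const x (0 : ℝ)).congr_mfderiv ?_
    refine ContinuousLinearMap.ext fun a => ?_
    exact ((congrArg (fun v : E3 => (show ℝ from a) • v) hx).trans (smul_zero (M := ℝ) (A := E3) a)).symm
  have h2 := hasMFDerivAt_flow_of_commute hX hY hXY hφ0 hφ (θ := fun _ => x) h1 s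
  have h3 := hasMFDerivAt_unique h2 (hasMFDerivAt_const (φ x s) (0 : ℝ))
  have h4 := DFunLike.congr_fun h3 (1 : ℝ)
  exact (one_smul ℝ (X (φ x s))).symm.trans h4

end Completeness

end PreparedTriples

namespace PreparedTriples

/-! ### The quotient function and its behaviour along `Y` -/

section Quotient

variable {M : Type u} [EMetricSpace M] [ChartedSpace E3 M] [IsManifold (𝓡 3) ∞ M]
  [RiemannianBundle (fun x : M => TangentSpace (𝓡 3) x)]
  [IsContMDiffRiemannianBundle (𝓡 3) ∞ E3 (fun x : M => TangentSpace (𝓡 3) x)]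
  {X Y : ∀ x : M, TangentSpace (𝓡 3) x}

theorem IsCrVectorField.continuous {M : Type u} [TopologicalSpace M] [ChartedSpace E3 M]
    [IsManifold (𝓡 3) ∞ M] {X : ∀ x : M, TangentSpace (𝓡 3) x} {r : ℕ∞ω}
    (hX : IsCrVectorField r X) :
    Continuous (fun x => (⟨x, X x⟩ : TangentBundle (𝓡 3) M)) :=
  ContMDiff.continuous hX

theorem contMDiff_inner (hX : IsCrVectorField 3 X) (hY : IsCrVectorField 3 Y) :
    ContMDiff (𝓡 3) 𝓘(ℝ, ℝ) 3 (fun x => inner ℝ (X x) (Y x)) := by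
  have : IsContMDiffRiemannianBundle (𝓡 3) 3 E3 (fun x : M => TangentSpace (𝓡 3) x) :=
    IsContMDiffRiemannianBundle.of_le (n := ∞) ENat.LEInfty.out
  exact ContMDiff.inner_bundle (b := fun x : M => x) hX hY

theorem continuous_inner_vectorField
    (hX : Continuous (fun x => (⟨x, X x⟩ : TangentBundle (𝓡 3) M)))
    (hY : Continuous (fun x => (⟨x, Y x⟩ : TangentBundle (𝓡 3) M))) :
    Continuous (fun x => inner ℝ (X x) (Y x)) := by
  have : IsContMDiffRiemannianBundle (𝓡 3) 0 E3 (fun x : M => TangentSpace (𝓡 3) x) :=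
    IsContMDiffRiemannianBundle.of_le (n := ∞) ENat.LEInfty.out
  have : ContMDiff (𝓡 3) 𝓘(ℝ, ℝ) 0 (fun x => inner ℝ (X x) (Y x)) :=
    ContMDiff.inner_bundle (b := fun x : M => x)
      ((contMDiff_zero_iff (I := 𝓡 3) (I' := (𝓡 3).tangent)).2 hX)
      ((contMDiff_zero_iff (I := 𝓡 3) (I' := (𝓡 3).tangent)).2 hY)
  exact this.continuous

theorem continuous_norm_vectorField
    (hX : Continuous (fun x => (⟨x, X x⟩ : TangentBundle (𝓡 3) M))) :
    Continuous (fun x => ‖X x‖) := by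
  have h := (continuous_inner_vectorField hX hX).sqrt
  refine h.congr fun x => ?_
  rw [real_inner_self_eq_norm_sq, Real.sqrt_sq (norm_nonneg _)]

theorem contMDiffOn_quotientFunction (hX : IsCrVectorField 3 X) (hY : IsCrVectorField 3 Y) :
    ContMDiffOn (𝓡 3) 𝓘(ℝ, ℝ) 3 (quotientFunction X Y) {x | Y x ≠ 0} := by
  refine ContMDiffOn.div₀ (contMDiff_inner hX hY).contMDiffOn (contMDiff_inner hY hY).contMDiffOn ?_
  intro x hx h
  exact hx (inner_self_eq_zero.1 h)

theorem quotientFunction_sub (c : ℝ) {x : M} (hx : Y x ≠ 0) :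
    quotientFunction (fun x => X x - c • Y x) Y x = quotientFunction X Y x - c := by
  have : inner ℝ (Y x) (Y x) ≠ 0 := fun h => hx (inner_self_eq_zero.1 h)
  simp only [quotientFunction]
  rw [inner_sub_left, real_inner_smul_left, sub_div, mul_div_cancel_right₀ c this]

theorem quotientFunction_eq {c : ℝ} {x : M} (hx : Y x ≠ 0) (h : X x = c • Y x) :
    quotientFunction X Y x = c := by
  have : inner ℝ (Y x) (Y x) ≠ 0 := fun h => hx (inner_self_eq_zero.1 h)
  rw [quotientFunction, h, real_inner_smul_left, mul_div_cancel_right₀ c this]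

theorem isOpen_ne_zero (hY : IsCrVectorField 3 Y) : IsOpen {x | Y x ≠ 0} := by
  have : {x | Y x ≠ 0} = {x | ‖Y x‖ ≠ 0} := by ext x; simp
  rw [this]
  exact isOpen_ne_fun (continuous_norm_vectorField hY.continuous) continuous_const

theorem IsCrVectorField.sub_smul (hX : IsCrVectorField 3 X) (hY : IsCrVectorField 3 Y) (c : ℝ) :
    IsCrVectorField 3 (fun x => X x - c • Y x) := by
  have : IsManifold (𝓡 3) (3 + 1) M := IsManifold.of_le (n := ∞) (by
    have h4 : (3 + 1 : ℕ∞ω) = 4 := by norm_num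
    rw [h4]; exact ENat.LEInfty.out)
  have : IsManifold (𝓡 3) 1 M := IsManifold.of_le (n := ∞) ENat.LEInfty.out
  exact ContMDiff.sub_section hX (ContMDiff.const_smul_section hY)

theorem mlieBracket_sub_smul (hX : IsCrVectorField 3 X) (hY : IsCrVectorField 3 Y)
    (hXY : ∀ x : M, VectorField.mlieBracket (𝓡 3) X Y x = 0) (c : ℝ) (x : M) :
    VectorField.mlieBracket (𝓡 3) (fun x => X x - c • Y x) Y x = 0 := by
  have : IsManifold (𝓡 3) 2 M := IsManifold.of_le (n := ∞) ENat.LEInfty.out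
  have : IsManifold (𝓡 3) 1 M := IsManifold.of_le (n := ∞) ENat.LEInfty.out
  have hXd := (hX x).mdifferentiableAt (by norm_num)
  have hYd := (hY x).mdifferentiableAt (by norm_num)
  have h1 : (fun x => X x - c • Y x) = X + (-c) • Y := by
    funext y
    simp [sub_eq_add_neg]
  rw [h1, VectorField.mlieBracket_add_left hXd, VectorField.mlieBracket_const_smul_left hYd, hXY,
    VectorField.mlieBracket_self]
  · simp
  · exact (ContMDiffAt.const_smul_section (a := -c) (hY x)).mdifferentiableAt (by norm_num)

/-- At the points where `X = cY`, the quotient function is stationary in the direction of `Y`. -/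
theorem mfderiv_quotientFunction_apply (hX : IsCrVectorField 3 X) (hY : IsCrVectorField 3 Y)
    (hXY : ∀ x : M, VectorField.mlieBracket (𝓡 3) X Y x = 0) (hYc : IsCompleteVectorField Y)
    {c : ℝ} {x : M} (hx : Y x ≠ 0) (h : X x = c • Y x) :
    mfderiv (𝓡 3) 𝓘(ℝ, ℝ) (quotientFunction X Y) x (Y x) = 0 := by
  choose φ hφ0 hφ using hYc
  -- `X - cY` also commutes with `Y`, so the whole `Y`-orbit of `x` consists of its zeros and `μ`
  -- equals `c` along it near `x`.
  have hZ : ∀ s, X (φ x s) - c • Y (φ x s) = 0 := fun s =>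
    flow_mem_zeroSet_of_commute (hX.sub_smul hY c) hY (mlieBracket_sub_smul hX hY hXY c) hφ0 hφ
      (x := x) (sub_eq_zero.2 h) s
  have hne : ∀ᶠ s in 𝓝 (0 : ℝ), Y (φ x s) ≠ 0 := by
    refine (hφ x).continuous.continuousAt.eventually_mem ((isOpen_ne_zero hY).mem_nhds ?_)
    simpa [hφ0] using hx
  have hconst : quotientFunction X Y ∘ φ x =ᶠ[𝓝 0] fun _ => c := by
    filter_upwards [hne] with s hs
    exact quotientFunction_eq hs (sub_eq_zero.1 (hZ s))
  have hd : MDifferentiableAt (𝓡 3) 𝓘(ℝ, ℝ) (quotientFunction X Y) (φ x 0) := by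
    refine ((contMDiffOn_quotientFunction hX hY).contMDiffAt
      ((isOpen_ne_zero hY).mem_nhds ?_)).mdifferentiableAt (by norm_num)
    simpa [hφ0] using hx
  have h1 := HasMFDerivAt.comp (0 : ℝ) hd.hasMFDerivAt (hφ x 0)
  have h2 : HasMFDerivAt 𝓘(ℝ, ℝ) 𝓘(ℝ, ℝ) (quotientFunction X Y ∘ φ x) 0 0 :=
    (hasMFDerivAt_const c (0 : ℝ)).congr_of_eventuallyEq hconst
  have h3 := DFunLike.congr_fun (hasMFDerivAt_unique h1 h2) (1 : ℝ)
  have h4 : mfderiv (𝓡 3) 𝓘(ℝ, ℝ) (quotientFunction X Y) (φ x 0) (Y (φ x 0)) = 0 := by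
    refine Eq.trans ?_ h3
    refine congrArg (mfderiv (𝓡 3) 𝓘(ℝ, ℝ) (quotientFunction X Y) (φ x 0)) ?_
    exact (one_smul ℝ (Y (φ x 0))).symm
  have h5 := congrArg
    (fun y => (mfderiv (𝓡 3) 𝓘(ℝ, ℝ) (quotientFunction X Y) y (Y y) : ℝ)) (hφ0 x)
  exact h5.symm.trans h4

/-- Near a regular point of `f` at which `Y` is tangent to the level set of `f`, the vector field
`Y` is not orthogonal to the level sets. -/
theorem eventually_exists_inner_ne_zero (hY : IsCrVectorField 3 Y) {f : M → ℝ} {x : M}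
    (hf : ContMDiffAt (𝓡 3) 𝓘(ℝ, ℝ) 3 f x) (hfx : mfderiv (𝓡 3) 𝓘(ℝ, ℝ) f x ≠ 0) (hx : Y x ≠ 0)
    (hfY : mfderiv (𝓡 3) 𝓘(ℝ, ℝ) f x (Y x) = 0) :
    ∀ᶠ y in 𝓝 x, ∃ v : TangentSpace (𝓡 3) y,
      mfderiv (𝓡 3) 𝓘(ℝ, ℝ) f y v = 0 ∧ inner ℝ (Y y) v ≠ 0 := by
  set e := chartAt E3 x with he
  have hC : IsC3Chart e := isC3Chart_chartAt x
  have hxs : x ∈ e.source := mem_chart_source E3 x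
  obtain ⟨v₀, hv₀⟩ : ∃ v₀ : TangentSpace (𝓡 3) x, mfderiv (𝓡 3) 𝓘(ℝ, ℝ) f x v₀ ≠ 0 := by
    by_contra! h
    exact hfx (ContinuousLinearMap.ext h)
  set w : E3 := mfderiv (𝓡 3) 𝓘(ℝ, E3) e x v₀ with hw
  -- the vector field which is constant in the chart
  let ν : ∀ y : M, TangentSpace (𝓡 3) y :=
    VectorField.mpullback (𝓡 3) 𝓘(ℝ, E3) e (fun _ => w)
  have hinv : ∀ y ∈ e.source, (mfderiv (𝓡 3) 𝓘(ℝ, E3) e y).IsInvertible := fun y hy =>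
    ⟨hC.mdifferentiable.mfderiv hy, rfl⟩
  have hνw : ∀ y ∈ e.source, mfderiv (𝓡 3) 𝓘(ℝ, E3) e y (ν y) = w := fun y hy =>
    ((hinv y hy).inverse_apply_eq.1 (rfl : (mfderiv (𝓡 3) 𝓘(ℝ, E3) e y).inverse w = ν y)).symm
  have hνx : ν x = v₀ := (hinv x hxs).inverse_apply_eq.2 hw
  have hM2 : IsManifold (𝓡 3) 2 M := IsManifold.of_le (n := ∞) ENat.LEInfty.out
  have hM1 : IsManifold (𝓡 3) 1 M := IsManifold.of_le (n := ∞) ENat.LEInfty.out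
  have hR : IsContMDiffRiemannianBundle (𝓡 3) 1 E3 (fun x : M => TangentSpace (𝓡 3) x) :=
    IsContMDiffRiemannianBundle.of_le (n := ∞) ENat.LEInfty.out
  have hνc : ContMDiffAt (𝓡 3) (𝓡 3).tangent 1
      (fun y => (⟨y, ν y⟩ : TangentBundle (𝓡 3) M)) x := by
    refine ContMDiffAt.mpullback_vectorField_preimage (m := 1) (n := 2) ?_
      ((hC.contMDiffOn.contMDiffAt (e.open_source.mem_nhds hxs)).of_le (by norm_num))
      (hinv x hxs) (by norm_num)
    have hc : ContMDiff 𝓘(ℝ, E3) 𝓘(ℝ, E3).tangent 1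
        (fun y : E3 => (⟨y, w⟩ : TangentBundle 𝓘(ℝ, E3) E3)) :=
      contMDiff_vectorSpace_iff_contDiff.2 contDiff_const
    exact hc (e x)
  have hYν : ContinuousAt (fun y => inner ℝ (Y y) (ν y)) x :=
    (ContMDiffAt.inner_bundle (b := fun x : M => x) (IM := 𝓡 3) (n := 1)
      ((hY x).of_le (by norm_num)) hνc).continuousAt
  set G : E3 → E3 →L[ℝ] ℝ := fderiv ℝ (f ∘ e.symm) with hG
  have hfd : ContDiffAt ℝ 3 (f ∘ e.symm) (e x) := by
    have h1 : ContMDiffAt 𝓘(ℝ, E3) (𝓡 3) 3 e.symm (e x) :=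
      hC.contMDiffOn_symm.contMDiffAt (e.open_target.mem_nhds (e.map_source hxs))
    have h2 : ContMDiffAt (𝓡 3) 𝓘(ℝ, ℝ) 3 f (e.symm (e x)) := by rwa [e.left_inv hxs]
    exact (h2.comp (e x) h1).contDiffAt
  have hec : ContinuousAt e x := e.continuousAt hxs
  have hGc : ContinuousAt (fun y => G (e y)) x :=
    ContinuousAt.comp (f := e) (g := G)
      ((hfd.fderiv_right (m := 2) (by norm_num)).continuousAt) hec
  have hYe : ContinuousAt (fun y => chartField Y x (e y)) x :=
    ContinuousAt.comp (f := e) (g := chartField Y x)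
      ((contDiffOn_chartField hY x).continuousOn.continuousAt
        (e.open_target.mem_nhds (e.map_source hxs))) hec
  have hev : ∀ᶠ y in 𝓝 x, y ∈ e.source ∧ MDifferentiableAt (𝓡 3) 𝓘(ℝ, ℝ) f y := by
    refine (e.open_source.eventually_mem hxs).and ?_
    filter_upwards [(contMDiffAt_iff_contMDiffAt_nhds (by simp)).1 hf] with y hy
    exact hy.mdifferentiableAt (by norm_num)
  have hY' : ∀ y ∈ e.source, MDifferentiableAt (𝓡 3) 𝓘(ℝ, ℝ) f y →
      mfderiv (𝓡 3) 𝓘(ℝ, ℝ) f y (Y y) = G (e y) (chartField Y x (e y)) := by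
    intro y hy hfy
    rw [chartField_apply Y hy]
    exact mfderiv_eq_fderiv_comp hC.mdifferentiable hy hfy (Y y)
  have hν' : ∀ y ∈ e.source, MDifferentiableAt (𝓡 3) 𝓘(ℝ, ℝ) f y →
      mfderiv (𝓡 3) 𝓘(ℝ, ℝ) f y (ν y) = G (e y) w := by
    intro y hy hfy
    exact (mfderiv_eq_fderiv_comp hC.mdifferentiable hy hfy (ν y)).trans
      (congrArg (fun u : E3 => G (e y) u) (hνw y hy))
  have hYY : ContinuousAt (fun y => inner ℝ (Y y) (Y y)) x :=
    (continuous_inner_vectorField hY.continuous hY.continuous).continuousAt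
  -- The vector `df(ν) Y - df(Y) ν` lies in the kernel of `df`, and this function is its inner
  -- product with `Y`. At `x` it equals `df(ν)‖Y‖²`, which is nonzero, so continuity settles the
  -- nearby points.
  have hlim : ContinuousAt (fun y => G (e y) w * inner ℝ (Y y) (Y y) -
      G (e y) (chartField Y x (e y)) * inner ℝ (Y y) (ν y)) x :=
    ((hGc.clm_apply continuousAt_const).mul hYY).sub ((hGc.clm_apply hYe).mul hYν)
  have hfx' := hev.self_of_nhds.2
  have hne : G (e x) w * inner ℝ (Y x) (Y x) -
      G (e x) (chartField Y x (e x)) * inner ℝ (Y x) (ν x) ≠ 0 := by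
    have h1 : G (e x) (chartField Y x (e x)) = 0 := (hY' x hxs hfx').symm.trans hfY
    have h2 : G (e x) w ≠ 0 := fun h => hv₀ (by rw [← hνx]; exact (hν' x hxs hfx').trans h)
    rw [h1, zero_mul, sub_zero]
    exact mul_ne_zero h2 fun h => hx (inner_self_eq_zero.1 h)
  filter_upwards [hev, hlim.eventually_ne hne] with y hy hy'
  refine ⟨G (e y) w • Y y - G (e y) (chartField Y x (e y)) • ν y, ?_, ?_⟩
  · rw [map_sub, map_smul, map_smul]
    refine sub_eq_zero.2 ?_
    have h1 := hY' y hy.1 hy.2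
    have h2 := hν' y hy.1 hy.2
    refine (congrArg (fun t : ℝ => G (e y) w * t) h1).trans (Eq.trans ?_
      (congrArg (fun t : ℝ => G (e y) (chartField Y x (e y)) * t) h2).symm)
    exact mul_comm _ _
  · rw [inner_sub_right, real_inner_smul_right, real_inner_smul_right]
    exact hy'

end Quotient

end PreparedTriples

/-! ### Choice of a generic value -/

namespace PreparedTriples

/-- A generic value `c₀` of a continuous function `μ` on a compact set `A` lies outside a given
null set of values, and its fibre is a lower semicontinuity point of `c ↦ A ∩ μ ⁻¹ {c}`. -/
theorem exists_generic_value {M : Type u} [TopologicalSpace M] [T2Space M] [RegularSpace M]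
    [SecondCountableTopology M] {A C : Set M} {μ : M → ℝ} (hA : IsCompact A)
    (hμ : ContinuousOn μ A) (hC : IsCompact C) (hCA : C ⊆ A)
    (hvol : MeasureTheory.volume (μ '' C) = 0) {η : ℝ} (hη : 0 < η) :
    ∃ c₀ ∈ Ioo (-η) η, c₀ ∉ μ '' C ∧ ∀ x ∈ A, μ x = c₀ → ∀ V ∈ 𝓝 x,
      ∀ᶠ c in 𝓝 c₀, ∃ y ∈ A ∩ V, μ y = c := by
  set b := TopologicalSpace.countableBasis M
  have hb := TopologicalSpace.isBasis_countableBasis M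
  have hcl : ∀ V : Set M, IsClosed (μ '' (A ∩ closure V)) := fun V =>
    ((hA.inter_right isClosed_closure).image_of_continuousOn (hμ.mono inter_subset_left)).isClosed
  have hCc : IsClosed (μ '' C) := (hC.image_of_continuousOn (hμ.mono hCA)).isClosed
  -- A value outside the nowhere dense frontiers of all the compact images `μ(A ∩ closure V)` is
  -- interior to each such image that contains it; applied to a small `V` around `x`, this is lower
  -- semicontinuity.
  have h1 : Dense (⋂ V ∈ b, (frontier (μ '' (A ∩ closure V)))ᶜ ∩ (μ '' C)ᶜ) := by
    refine dense_biInter_of_isOpen (fun V _ => isClosed_frontier.isOpen_compl.inter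
      hCc.isOpen_compl) (TopologicalSpace.countable_countableBasis M) fun V _ => ?_
    refine Dense.inter_of_isOpen_left ?_ ?_ isClosed_frontier.isOpen_compl
    · exact interior_eq_empty_iff_dense_compl.1 (interior_frontier (hcl V))
    · exact interior_eq_empty_iff_dense_compl.1
        (MeasureTheory.Measure.interior_eq_empty_of_null hvol)
  have h2 : Dense ((μ '' C)ᶜ) := interior_eq_empty_iff_dense_compl.1
    (MeasureTheory.Measure.interior_eq_empty_of_null hvol)
  -- Over an empty basis the intersection would lose the condition on `μ '' C`, which is then
  -- imposed separately; semicontinuity is void.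
  rcases b.eq_empty_or_nonempty with hbe | ⟨V₀, hV₀⟩
  · obtain ⟨c₀, hc₀, hc₀'⟩ := h2.exists_mem_open isOpen_Ioo (nonempty_Ioo.2 (neg_lt_self hη))
    refine ⟨c₀, hc₀', hc₀, fun x _ _ V hV => ?_⟩
    obtain ⟨B, hB, -⟩ := hb.mem_nhds_iff.1 hV
    exact (hbe.subset hB : B ∈ (∅ : Set (Set M))).elim
  obtain ⟨c₀, hc₀, hc₀'⟩ := h1.exists_mem_open isOpen_Ioo (nonempty_Ioo.2 (neg_lt_self hη))
  simp only [mem_iInter] at hc₀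
  refine ⟨c₀, hc₀', (hc₀ V₀ hV₀).2, fun x hx hxc V hV => ?_⟩
  obtain ⟨B, hB, hxB, hBV⟩ := hb.exists_closure_subset hV
  have h3 : c₀ ∈ μ '' (A ∩ closure B) := ⟨x, ⟨hx, subset_closure hxB⟩, hxc⟩
  have h4 : c₀ ∈ interior (μ '' (A ∩ closure B)) := by
    by_contra h
    exact (hc₀ B hB).1 ⟨subset_closure h3, h⟩
  filter_upwards [mem_interior_iff_mem_nhds.1 h4] with c ⟨y, hy, hyc⟩
  exact ⟨y, ⟨hy.1, hBV hy.2⟩, hyc⟩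

/-! ### Subtracting a small multiple of `Y` -/

section Perturbation

variable {M : Type u} [EMetricSpace M] [ChartedSpace E3 M] [IsManifold (𝓡 3) ∞ M]
  [RiemannianBundle (fun x : M => TangentSpace (𝓡 3) x)]
  [IsContMDiffRiemannianBundle (𝓡 3) ∞ E3 (fun x : M => TangentSpace (𝓡 3) x)]
  {X Y : ∀ x : M, TangentSpace (𝓡 3) x} {U : Set M}

theorem exists_norm_le_of_isCompact {K : Set M} (hK : IsCompact K)
    (hY : Continuous (fun x => (⟨x, Y x⟩ : TangentBundle (𝓡 3) M))) :
    ∃ B : ℝ, 0 < B ∧ ∀ x ∈ K, ‖Y x‖ ≤ B := by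
  obtain ⟨B, hB⟩ := hK.bddAbove_image (continuous_norm_vectorField hY).continuousOn
  exact ⟨max B 1, by positivity, fun x hx => (hB ⟨x, hx, rfl⟩).trans (le_max_left _ _)⟩

theorem exists_le_norm_of_isCompact {K : Set M} (hK : IsCompact K)
    (hX : Continuous (fun x => (⟨x, X x⟩ : TangentBundle (𝓡 3) M))) (h0 : ∀ x ∈ K, X x ≠ 0) :
    ∃ m : ℝ, 0 < m ∧ ∀ x ∈ K, m ≤ ‖X x‖ := by
  rcases K.eq_empty_or_nonempty with rfl | hne
  · exact ⟨1, one_pos, fun x hx => hx.elim⟩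
  obtain ⟨x, hx, hmin⟩ := hK.exists_isMinOn hne (continuous_norm_vectorField hX).continuousOn
  exact ⟨‖X x‖, norm_pos_iff.2 (h0 x hx), fun y hy => hmin hy⟩

/-- The set of pairs `(c, x)` with `X x = c Y x` is closed. -/
theorem isClosed_setOf_sub_smul_eq_zero
    (hX : Continuous (fun x => (⟨x, X x⟩ : TangentBundle (𝓡 3) M)))
    (hY : Continuous (fun x => (⟨x, Y x⟩ : TangentBundle (𝓡 3) M))) :
    IsClosed {q : ℝ × M | X q.2 - q.1 • Y q.2 = 0} := by
  -- The condition `‖X - cY‖² = 0` is expanded into inner products, which are continuous functions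
  -- on `M`.
  have h : {q : ℝ × M | X q.2 - q.1 • Y q.2 = 0} = {q : ℝ × M |
      inner ℝ (X q.2) (X q.2) - 2 * q.1 * inner ℝ (X q.2) (Y q.2) +
        q.1 ^ 2 * inner ℝ (Y q.2) (Y q.2) = 0} := by
    ext q
    simp only [mem_ofPred_eq]
    rw [← inner_self_eq_zero (𝕜 := ℝ), inner_sub_left, inner_sub_right, inner_sub_right,
      real_inner_smul_left, real_inner_smul_right, real_inner_smul_left, real_inner_smul_right,
      real_inner_comm (X q.2) (Y q.2)]
    constructor <;> intro h <;> linarith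
  rw [h]
  have hXX := (continuous_inner_vectorField hX hX).comp (continuous_snd (X := ℝ))
  have hXY := (continuous_inner_vectorField hX hY).comp (continuous_snd (X := ℝ))
  have hYY := (continuous_inner_vectorField hY hY).comp (continuous_snd (X := ℝ))
  refine isClosed_eq ?_ continuous_const
  exact ((hXX.sub ((continuous_const.mul continuous_fst).mul hXY)).add
    ((continuous_fst.pow 2).mul hYY))

theorem isClosed_zeroSet (hX : Continuous (fun x => (⟨x, X x⟩ : TangentBundle (𝓡 3) M))) :
    IsClosed (zeroSet X) := by
  have h : zeroSet X = {x | ‖X x‖ = 0} := by ext x; simp [zeroSet]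
  rw [h]
  exact isClosed_eq (continuous_norm_vectorField hX) continuous_const

/-- A field within `δ/2` of `X - cY` is within `δ` of `X` as soon as `cY` is smaller than `δ/2` on
the compact closure. -/
theorem HasIndex.eventually_sub_smul {n : ℤ} (h : HasIndex X U n) (hU : IsCompact (closure U))
    (hY : Continuous (fun x => (⟨x, Y x⟩ : TangentBundle (𝓡 3) M))) :
    ∀ᶠ c in 𝓝 (0 : ℝ), HasIndex (fun x => X x - c • Y x) U n := by
  obtain ⟨δ, hδ, H⟩ := h
  obtain ⟨B, hB, hYB⟩ := exists_norm_le_of_isCompact hU hY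
  have hlim : Tendsto (fun c : ℝ => |c| * B) (𝓝 0) (𝓝 0) := by
    have : Continuous fun c : ℝ => |c| * B := by fun_prop
    simpa using this.tendsto 0
  filter_upwards [hlim.eventually_lt_const (half_pos hδ)] with c hc
  refine ⟨δ / 2, half_pos hδ, fun X' hX' hd hfin => H X' hX' (fun x hx => ?_) hfin⟩
  have h1 : X' x - X x = (X' x - (X x - c • Y x)) - c • Y x := by abel
  rw [h1]
  have h2 : ‖c • Y x‖ ≤ |c| * B := by
    rw [norm_smul, Real.norm_eq_abs]
    exact mul_le_mul_of_nonneg_left (hYB x hx) (abs_nonneg _)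
  linarith [norm_sub_le (X' x - (X x - c • Y x)) (c • Y x), hd x hx]

/-- A lower bound for `‖X‖` on the compact set beats an upper bound for `‖cY‖`. This one estimate
keeps zeros off the frontier, gives upper semicontinuity of `K_c`, and later confines `K_c` to a
neighbourhood of `K_0`. -/
theorem eventually_sub_smul_ne_zero {K : Set M} (hK : IsCompact K)
    (hX : Continuous (fun x => (⟨x, X x⟩ : TangentBundle (𝓡 3) M)))
    (hY : Continuous (fun x => (⟨x, Y x⟩ : TangentBundle (𝓡 3) M))) (h0 : ∀ x ∈ K, X x ≠ 0) :
    ∀ᶠ c in 𝓝 (0 : ℝ), ∀ x ∈ K, X x - c • Y x ≠ 0 := by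
  obtain ⟨m, hm, hXm⟩ := exists_le_norm_of_isCompact hK hX h0
  obtain ⟨B, hB, hYB⟩ := exists_norm_le_of_isCompact hK hY
  have hlim : Tendsto (fun c : ℝ => |c| * B) (𝓝 0) (𝓝 0) := by
    have : Continuous fun c : ℝ => |c| * B := by fun_prop
    simpa using this.tendsto 0
  filter_upwards [hlim.eventually_lt_const hm] with c hc x hx h
  have h2 : ‖c • Y x‖ ≤ |c| * B := by
    rw [norm_smul, Real.norm_eq_abs]
    exact mul_le_mul_of_nonneg_left (hYB x hx) (abs_nonneg _)
  rw [← sub_eq_zero.1 h] at h2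
  linarith [hXm x hx]

theorem IsTriple.ne_zero {r : ℕ∞ω} (h : IsTriple r U X Y) {x : M} (hx : x ∈ U) : Y x ≠ 0 :=
  fun h0 => (h.zeroSet_right.subset ⟨h0, hx⟩ : x ∈ (∅ : Set M))

theorem IsTriple.sub_smul (h : IsTriple 3 U X Y) {c : ℝ}
    (hc : ∀ x ∈ frontier U, X x - c • Y x ≠ 0) :
    IsTriple 3 U (fun x => X x - c • Y x) Y where
  isOpen := h.isOpen
  isCompact_closure := h.isCompact_closure
  contMDiff_left := h.contMDiff_left.sub_smul h.contMDiff_right c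
  contMDiff_right := h.contMDiff_right
  complete_left := IsCompleteVectorField.sub_smul h.contMDiff_left h.contMDiff_right h.commute
    h.complete_left h.complete_right c
  complete_right := h.complete_right
  commute := mlieBracket_sub_smul h.contMDiff_left h.contMDiff_right h.commute c
  zeroSet_right := h.zeroSet_right
  zeroSet_left := by
    ext x
    simp only [mem_inter_iff, mem_empty_iff_false, iff_false, not_and]
    exact fun h0 hx => hc x hx h0

theorem sub_smul_sub_smul (X Y : ∀ x : M, TangentSpace (𝓡 3) x) (c d : ℝ) (x : M) :
    X x - c • Y x - d • Y x = X x - (c + d) • Y x := by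
  rw [add_smul, sub_sub]

/-- After subtracting from `X` a suitable small multiple of `Y`, the quotient function has no
critical point among the zeros of `X`, and every zero persists in the zero sets of `X - cY`. -/
theorem IsCounterexample.exists_generic [SigmaCompactSpace M] (h : IsCounterexample 3 U X Y) :
    ∃ c₀ : ℝ, IsCounterexample 3 U (fun x => X x - c₀ • Y x) Y ∧
      (∀ x ∈ U, X x - c₀ • Y x = 0 →
        mfderiv (𝓡 3) 𝓘(ℝ, ℝ) (quotientFunction (fun x => X x - c₀ • Y x) Y) x ≠ 0) ∧
      ∀ x ∈ U, X x - c₀ • Y x = 0 → ∀ V ∈ 𝓝 x, ∀ᶠ c in 𝓝 (0 : ℝ),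
        ∃ y ∈ V, X y - c₀ • Y y - c • Y y = 0 := by
  obtain ⟨hT, n, hn, hind⟩ := h
  have hXc := hT.contMDiff_left.continuous
  have hYc := hT.contMDiff_right.continuous
  have hsc : SecondCountableTopology M := ChartedSpace.secondCountable_of_sigmaCompact E3 M
  have hfr : IsCompact (frontier U) :=
    hT.isCompact_closure.of_isClosed_subset isClosed_frontier frontier_subset_closure
  have hev := (hind.eventually_sub_smul hT.isCompact_closure hYc).and
    (eventually_sub_smul_ne_zero hfr hXc hYc fun x hx h0 =>
      (hT.zeroSet_left.subset ⟨h0, hx⟩ : x ∈ (∅ : Set M)))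
  obtain ⟨η₀, hη₀, hball⟩ := Metric.eventually_nhds_iff.1 hev
  set η := η₀ / 2 with hηdef
  have hη : 0 < η := half_pos hη₀
  have hIcc : ∀ c ∈ Icc (-η) η, HasIndex (fun x => X x - c • Y x) U n ∧
      ∀ x ∈ frontier U, X x - c • Y x ≠ 0 := fun c hc => hball (by
    rw [Real.dist_0_eq_abs]
    exact (abs_le.2 hc).trans_lt (by linarith))
  -- The union of the `K_c` with `|c| ≤ η`: compact as a projection of a compact set, and inside `U`
  -- because none of these `K_c` meets the frontier.
  set A : Set M := Prod.snd '' ({q : ℝ × M | X q.2 - q.1 • Y q.2 = 0} ∩ Icc (-η) η ×ˢ closure U)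
    with hAdef
  have hA : IsCompact A := ((isCompact_Icc.prod hT.isCompact_closure).inter_left
    (isClosed_setOf_sub_smul_eq_zero hXc hYc)).image continuous_snd
  have hAU : A ⊆ U := by
    rintro _ ⟨⟨c, x⟩, ⟨h0, hc, hx⟩, rfl⟩
    by_contra hxU
    exact (hIcc c hc).2 x ⟨hx, fun h' => hxU (interior_subset h')⟩ h0
  have hμU : ContMDiffOn (𝓡 3) 𝓘(ℝ, ℝ) 3 (quotientFunction X Y) U :=
    (contMDiffOn_quotientFunction hT.contMDiff_left hT.contMDiff_right).mono
      fun x hx => hT.ne_zero hx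
  have hμA : ContinuousOn (quotientFunction X Y) A := hμU.continuousOn.mono hAU
  have hAmem : ∀ x ∈ U, ∀ c ∈ Icc (-η) η, X x - c • Y x = 0 →
      x ∈ A ∧ quotientFunction X Y x = c := fun x hx c hc h0 =>
    ⟨⟨(c, x), ⟨h0, hc, subset_closure hx⟩, rfl⟩, quotientFunction_eq (hT.ne_zero hx)
      (sub_eq_zero.1 h0)⟩
  -- On `A` the value of `μ` is the coefficient of collinearity, so the fibres of `μ` on `A` are the
  -- sets `K_c` and semicontinuity of the fibres concerns the zero sets.
  have hAzero : ∀ x ∈ A, X x - quotientFunction X Y x • Y x = 0 := by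
    intro x hx
    have hxU := hAU hx
    obtain ⟨⟨c, y⟩, ⟨h0, hc, hy⟩, rfl⟩ := hx
    rw [quotientFunction_eq (hT.ne_zero hxU) (sub_eq_zero.1 h0)]
    exact h0
  -- The critical points of `μ` in `A`. They form a compact set because regular points are open, and
  -- their values form a null set by Sard.
  set C : Set M := A ∩ {x ∈ U | mfderiv (𝓡 3) 𝓘(ℝ, ℝ) (quotientFunction X Y) x ≠ 0}ᶜ with hC
  have hCc : IsCompact C :=
    hA.inter_right (isOpen_mfderiv_ne_zero hT.isOpen hμU).isClosed_compl
  have hvol : MeasureTheory.volume (quotientFunction X Y '' C) = 0 := by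
    refine MeasureTheory.measure_mono_null (image_mono ?_)
      (volume_criticalValues_eq_zero hT.isOpen hμU)
    intro x hx
    refine ⟨hAU hx.1, ?_⟩
    by_contra h'
    exact hx.2 ⟨hAU hx.1, h'⟩
  obtain ⟨c₀, hc₀, hc₀C, hlsc⟩ := exists_generic_value hA hμA hCc inter_subset_left hvol hη
  have hc₀' := Ioo_subset_Icc_self hc₀
  refine ⟨c₀, ⟨hT.sub_smul (hIcc c₀ hc₀').2, n, hn, (hIcc c₀ hc₀').1⟩, ?_, ?_⟩
  · intro x hx h0 hd
    obtain ⟨hxA, hxμ⟩ := hAmem x hx c₀ hc₀' h0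
    refine hc₀C ⟨x, ⟨hxA, fun h' => h'.2 ?_⟩, hxμ⟩
    have hμx : MDifferentiableAt (𝓡 3) 𝓘(ℝ, ℝ) (quotientFunction X Y) x :=
      (hμU.contMDiffAt (hT.isOpen.mem_nhds hx)).mdifferentiableAt (by norm_num)
    have heq : quotientFunction (fun x => X x - c₀ • Y x) Y =ᶠ[𝓝 x]
        fun y => quotientFunction X Y y - c₀ := by
      filter_upwards [hT.isOpen.mem_nhds hx] with y hy
      exact quotientFunction_sub c₀ (hT.ne_zero hy)
    have h1 := (hμx.hasMFDerivAt.sub (hasMFDerivAt_const c₀ x)).congr_of_eventuallyEq heq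
    have h2 := h1.mfderiv.symm.trans hd
    exact (sub_zero (mfderiv (𝓡 3) 𝓘(ℝ, ℝ) (quotientFunction X Y) x)).symm.trans h2
  · intro x hx h0 V hV
    obtain ⟨hxA, hxμ⟩ := hAmem x hx c₀ hc₀' h0
    have hlim : Tendsto (fun c : ℝ => c₀ + c) (𝓝 0) (𝓝 c₀) := by
      have : Continuous fun c : ℝ => c₀ + c := by fun_prop
      simpa using this.tendsto 0
    filter_upwards [hlim.eventually (hlsc x hxA hxμ V hV)] with c ⟨y, hy, hyc⟩
    refine ⟨y, hy.2, ?_⟩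
    rw [sub_smul_sub_smul, ← hyc]
    exact hAzero y hy.1

end Perturbation

end PreparedTriples

/-! ### Charts with prescribed coordinate functions -/

namespace PreparedTriples

/-- The vector `w` witnesses that `α` and `β` are independent, so their common kernel is a line. The
inner product with a spanning vector of this line supplies the missing coordinate. -/
theorem exists_continuousLinearEquiv_of_ker {α β : E3 →L[ℝ] ℝ} {w : E3} (hβw : β w = 0)
    (hαw : α w ≠ 0) (hβ : β ≠ 0) :
    ∃ (ℓ : E3 →L[ℝ] ℝ) (L : E3 ≃L[ℝ] ℝ × ℝ × ℝ),
      (L : E3 →L[ℝ] ℝ × ℝ × ℝ) = α.prod (ℓ.prod β) := by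
  obtain ⟨v, hv⟩ : ∃ v, β v ≠ 0 := by
    by_contra! h
    exact hβ (ContinuousLinearMap.ext h)
  have hsurj : LinearMap.range (α.prod β : E3 →ₗ[ℝ] ℝ × ℝ) = ⊤ := by
    refine LinearMap.range_eq_top.2 fun ⟨a, b⟩ => ⟨(b / β v) • v + ((a - b / β v * α v) / α w) • w, ?_⟩
    simp [hβw]
    constructor <;> field_simp
    ring
  have hker := LinearMap.finrank_range_add_finrank_ker (α.prod β : E3 →ₗ[ℝ] ℝ × ℝ)
  rw [hsurj, finrank_top] at hker
  simp only [Module.finrank_prod, Module.finrank_self, finrank_euclideanSpace_fin] at hker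
  have hker1 : Module.finrank ℝ (LinearMap.ker (α.prod β : E3 →ₗ[ℝ] ℝ × ℝ)) = 1 := by omega
  obtain ⟨k, hk0, hk⟩ := finrank_eq_one_iff'.1 hker1
  have hinj : Function.Injective
      ((α.prod ((innerSL ℝ (k : E3)).prod β) : E3 →L[ℝ] ℝ × ℝ × ℝ) : E3 →ₗ[ℝ] ℝ × ℝ × ℝ) := by
    refine (injective_iff_map_eq_zero _).2 fun y hy => ?_
    simp only [ContinuousLinearMap.coe_coe, ContinuousLinearMap.prod_apply, Prod.mk_eq_zero,
      innerSL_apply_apply] at hy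
    obtain ⟨c, hc⟩ := hk ⟨y, by simp [hy.1, hy.2.2]⟩
    have hc' : c • (k : E3) = y := congrArg Subtype.val hc
    have h1 := hy.2.1
    rw [← hc', real_inner_smul_right] at h1
    rcases mul_eq_zero.1 h1 with h | h
    · rw [← hc', h, zero_smul]
    · exact absurd (Subtype.ext (inner_self_eq_zero.1 h)) hk0
  refine ⟨innerSL ℝ (k : E3), (LinearMap.linearEquivOfInjective _ hinj
    (by simp)).toContinuousLinearEquiv, ?_⟩
  ext y <;> rfl

section Charts

variable {M : Type u} [TopologicalSpace M] [ChartedSpace E3 M]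
  {V : Type*} [NormedAddCommGroup V] [NormedSpace ℝ V]
  {W : Type*} [NormedAddCommGroup W] [NormedSpace ℝ W]

theorem IsC3Chart.trans {e : OpenPartialHomeomorph M V} (he : IsC3Chart e)
    {g : OpenPartialHomeomorph V W} (hg : ContDiffOn ℝ 3 g g.source)
    (hg' : ContDiffOn ℝ 3 g.symm g.target) : IsC3Chart (e.trans g) where
  contMDiffOn := by
    refine (contMDiffOn_iff_contDiffOn.2 hg).comp (he.contMDiffOn.mono ?_) ?_
    · exact fun y hy => ((e.trans_source g).subset hy).1
    · exact fun y hy => ((e.trans_source g).subset hy).2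
  contMDiffOn_symm := by
    refine he.contMDiffOn_symm.comp ((contMDiffOn_iff_contDiffOn.2 hg').mono ?_) ?_
    · exact fun y hy => ((e.trans_target g).subset hy).1
    · exact fun y hy => ((e.trans_target g).subset hy).2

/-- A chart can be shrunk so that its image is a small ball. -/
theorem IsC3Chart.exists_target_eq_ball {e : OpenPartialHomeomorph M V} (he : IsC3Chart e) {x : M}
    (hx : x ∈ e.source) {G : Set M} (hG : G ∈ 𝓝 x) :
    ∃ r : ℝ, 0 < r ∧ ∃ e' : OpenPartialHomeomorph M V, IsC3Chart e' ∧ x ∈ e'.source ∧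
      e'.source ⊆ e.source ∩ G ∧ e'.target = Metric.ball (e x) r ∧ e'.target ⊆ e.target ∧
      (∀ y, e' y = e y) ∧ ∀ y, e'.symm y = e.symm y := by
  have h1 : e.target ∩ e.symm ⁻¹' G ∈ 𝓝 (e x) := by
    refine inter_mem (e.open_target.mem_nhds (e.map_source hx)) ?_
    refine (e.continuousAt_symm (e.map_source hx)).preimage_mem_nhds ?_
    rwa [e.left_inv hx]
  obtain ⟨r, hr, hball⟩ := Metric.mem_nhds_iff.1 h1
  have hs : IsOpen (e.source ∩ e ⁻¹' Metric.ball (e x) r) :=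
    e.isOpen_inter_preimage Metric.isOpen_ball
  set e' := e.restrOpen _ hs with he'
  have hsrc : e'.source = e.source ∩ (e.source ∩ e ⁻¹' Metric.ball (e x) r) :=
    e.restrOpen_source _ hs
  have htgt : e'.target = e.target ∩ e.symm ⁻¹' (e.source ∩ e ⁻¹' Metric.ball (e x) r) := rfl
  have htgt' : e'.target = Metric.ball (e x) r := by
    rw [htgt]
    ext y
    constructor
    · rintro ⟨h1, h2, h3⟩
      rwa [mem_preimage, e.right_inv h1] at h3
    · intro hy
      have := hball hy
      refine ⟨this.1, e.map_target this.1, ?_⟩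
      rwa [mem_preimage, e.right_inv this.1]
  refine ⟨r, hr, e', ⟨?_, ?_⟩, ?_, ?_, htgt', ?_, fun _ => rfl, fun _ => rfl⟩
  · exact he.contMDiffOn.mono fun y hy => (hsrc.subset hy).1
  · exact he.contMDiffOn_symm.mono fun y hy => (htgt.subset hy).1
  · rw [hsrc]
    exact ⟨hx, hx, Metric.mem_ball_self hr⟩
  · intro y hy
    obtain ⟨h2, -, h3⟩ := hsrc.subset hy
    refine ⟨h2, ?_⟩
    have := (hball h3).2
    rwa [mem_preimage, e.left_inv h2] at this
  · exact fun y hy => (htgt.subset hy).1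

/-- The inverse function theorem, for a map read in a chart. -/
theorem IsC3Chart.exists_of_hasFDerivAt [CompleteSpace V] {e : OpenPartialHomeomorph M V}
    (he : IsC3Chart e) {x : M} (hx : x ∈ e.source) {g : V → W} {g' : V ≃L[ℝ] W}
    (hg : ContDiffAt ℝ 3 g (e x)) (hg' : HasFDerivAt g (g' : V →L[ℝ] W) (e x)) {G : Set M}
    (hG : G ∈ 𝓝 x) :
    ∃ r : ℝ, 0 < r ∧ ∃ e' : OpenPartialHomeomorph M W, IsC3Chart e' ∧ x ∈ e'.source ∧
      e'.source ⊆ e.source ∩ G ∧ e'.target = Metric.ball (g (e x)) r ∧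
      ∀ y, e' y = g (e y) := by
  obtain ⟨h, hxh, -, hhg, hh, hh'⟩ :=
    exists_openPartialHomeomorph_contDiffOn (k := 3) (by norm_num) hg hg' univ_mem
  have hC := he.trans hh hh'
  obtain ⟨r, hr, e', he', hxe', hsub, htgt, -, heq, -⟩ := hC.exists_target_eq_ball (x := x)
    ((e.trans_source h).symm.subset ⟨hx, hxh⟩) hG
  have heq' : ∀ y, (e.trans h) y = g (e y) := fun y => hhg (e y)
  refine ⟨r, hr, e', he', hxe', fun y hy => ⟨((e.trans_source h).subset (hsub hy).1).1,
    (hsub hy).2⟩, ?_, fun y => (heq y).trans (heq' y)⟩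
  rw [htgt, heq']

/-- There is a chart near `s` whose first and last components are given functions with linearly
independent differentials. -/
theorem exists_adaptedChart [IsManifold (𝓡 3) ∞ M] {f φ : M → ℝ} {s : M}
    (hf : ContMDiffAt (𝓡 3) 𝓘(ℝ, ℝ) 3 f s) (hφ : ContMDiffAt (𝓡 3) 𝓘(ℝ, ℝ) 3 φ s)
    {w : TangentSpace (𝓡 3) s} (hfw : mfderiv (𝓡 3) 𝓘(ℝ, ℝ) f s w = 0)
    (hφw : mfderiv (𝓡 3) 𝓘(ℝ, ℝ) φ s w ≠ 0) (hf' : mfderiv (𝓡 3) 𝓘(ℝ, ℝ) f s ≠ 0)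
    {G : Set M} (hG : G ∈ 𝓝 s) :
    ∃ r : ℝ, 0 < r ∧ ∃ ψ : OpenPartialHomeomorph M (ℝ × ℝ × ℝ), IsC3Chart ψ ∧ s ∈ ψ.source ∧
      ψ.source ⊆ G ∧ ψ.target = Metric.ball (ψ s) r ∧
      ∀ y ∈ ψ.source, (ψ y).1 = φ y ∧ (ψ y).2.2 = f y := by
  set e := chartAt E3 s
  have he : IsC3Chart e := isC3Chart_chartAt s
  have hs : s ∈ e.source := mem_chart_source E3 s
  have hsm : ∀ h : M → ℝ, ContMDiffAt (𝓡 3) 𝓘(ℝ, ℝ) 3 h s → ContDiffAt ℝ 3 (h ∘ e.symm) (e s) := by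
    intro h hh
    have h1 : ContMDiffAt 𝓘(ℝ, E3) (𝓡 3) 3 e.symm (e s) :=
      he.contMDiffOn_symm.contMDiffAt (e.open_target.mem_nhds (e.map_source hs))
    have h2 : ContMDiffAt (𝓡 3) 𝓘(ℝ, ℝ) 3 h (e.symm (e s)) := by rwa [e.left_inv hs]
    exact (h2.comp (e s) h1).contDiffAt
  have hfd := hsm f hf
  have hφd := hsm φ hφ
  have hfm := hf.mdifferentiableAt (by norm_num)
  have hφm := hφ.mdifferentiableAt (by norm_num)
  set w' : E3 := mfderiv (𝓡 3) 𝓘(ℝ, E3) e s w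
  obtain ⟨ℓ, L, hL⟩ := exists_continuousLinearEquiv_of_ker
    (α := fderiv ℝ (φ ∘ e.symm) (e s)) (β := fderiv ℝ (f ∘ e.symm) (e s)) (w := w')
    ((mfderiv_eq_fderiv_comp he.mdifferentiable hs hfm w).symm.trans hfw)
    (fun h => hφw ((mfderiv_eq_fderiv_comp he.mdifferentiable hs hφm w).trans h))
    (fun h => hf' ((mfderiv_eq_zero_iff_fderiv he.mdifferentiable hs hfm).2 h))
  have hg : ContDiffAt ℝ 3 (fun z => ((φ ∘ e.symm) z, ℓ z, (f ∘ e.symm) z)) (e s) :=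
    hφd.prodMk (ℓ.contDiff.contDiffAt.prodMk hfd)
  have hg' : HasFDerivAt (fun z => ((φ ∘ e.symm) z, ℓ z, (f ∘ e.symm) z))
      (L : E3 →L[ℝ] ℝ × ℝ × ℝ) (e s) := by
    rw [hL]
    exact (hφd.differentiableAt (by norm_num)).hasFDerivAt.prodMk
      (ℓ.hasFDerivAt.prodMk (hfd.differentiableAt (by norm_num)).hasFDerivAt)
  obtain ⟨r, hr, ψ, hψ, hsψ, hsub, htgt, heq⟩ := he.exists_of_hasFDerivAt hs hg hg' hG
  refine ⟨r, hr, ψ, hψ, hsψ, fun y hy => (hsub hy).2, ?_, fun y hy => ?_⟩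
  · rw [htgt, heq]
  · rw [heq]
    simp [e.left_inv (hsub hy).1]

/-- Near every point there is a function whose differential does not vanish on the kernel of
`df`. -/
theorem exists_independent_function [IsManifold (𝓡 3) ∞ M] {f : M → ℝ} {s : M} :
    ∃ φ : M → ℝ, ContMDiffAt (𝓡 3) 𝓘(ℝ, ℝ) 3 φ s ∧ ∃ w : TangentSpace (𝓡 3) s,
      mfderiv (𝓡 3) 𝓘(ℝ, ℝ) f s w = 0 ∧ mfderiv (𝓡 3) 𝓘(ℝ, ℝ) φ s w ≠ 0 := by
  set e := chartAt E3 s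
  have he : IsC3Chart e := isC3Chart_chartAt s
  have hs : s ∈ e.source := mem_chart_source E3 s
  set D : E3 →L[ℝ] ℝ := mfderiv (𝓡 3) 𝓘(ℝ, ℝ) f s with hD
  obtain ⟨w, hw, hw0⟩ : ∃ w : E3, D w = 0 ∧ w ≠ 0 := by
    have h1 := LinearMap.finrank_range_add_finrank_ker (D : E3 →ₗ[ℝ] ℝ)
    have h2 := Submodule.finrank_le (LinearMap.range (D : E3 →ₗ[ℝ] ℝ))
    simp only [Module.finrank_self, finrank_euclideanSpace_fin] at h1 h2
    have h3 : LinearMap.ker (D : E3 →ₗ[ℝ] ℝ) ≠ ⊥ := by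
      intro h
      rw [h, finrank_bot] at h1
      omega
    obtain ⟨w, hw, hw0⟩ := Submodule.exists_mem_ne_zero_of_ne_bot h3
    exact ⟨w, hw, hw0⟩
  set w' : E3 := mfderiv (𝓡 3) 𝓘(ℝ, E3) e s w with hw'
  have hw'0 : w' ≠ 0 := fun h => hw0 ((he.mdifferentiable.mfderiv_injective hs)
    (h.trans (map_zero (mfderiv (𝓡 3) 𝓘(ℝ, E3) e s)).symm))
  have hed : MDifferentiableAt (𝓡 3) 𝓘(ℝ, E3) e s := he.mdifferentiable.mdifferentiableAt hs
  -- The inner product in the chart with the image `w'` of a kernel vector `w` has derivative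
  -- `‖w'‖²` along `w`.
  have hc : ContMDiffAt (𝓡 3) 𝓘(ℝ, ℝ) 3 (fun y => innerSL ℝ w' (e y)) s :=
    ((innerSL ℝ w').contDiff.contMDiff.contMDiffAt).comp s
      (he.contMDiffOn.contMDiffAt (e.open_source.mem_nhds hs))
  refine ⟨fun y => innerSL ℝ w' (e y), hc, w, hw, fun h => hw'0 ?_⟩
  have h1 : HasMFDerivAt (𝓡 3) 𝓘(ℝ, ℝ) (fun y => innerSL ℝ w' (e y)) s
      ((innerSL ℝ w').comp (mfderiv (𝓡 3) 𝓘(ℝ, E3) e s)) :=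
    HasMFDerivAt.comp s (innerSL ℝ w').hasFDerivAt.hasMFDerivAt hed.hasMFDerivAt
  have h2 : inner ℝ w' w' = 0 := (DFunLike.congr_fun h1.mfderiv w).symm.trans h
  exact inner_self_eq_zero.1 h2

end Charts

end PreparedTriples

namespace PreparedTriples

/-! ### Pushing a neighbourhood into the level set -/

section Retraction

variable {M : Type u} [TopologicalSpace M] [ChartedSpace E3 M] [IsManifold (𝓡 3) ∞ M]

/-- A ball for the sup norm is a cube. Centred at height zero, it is stable under shrinking the
height, in particular under vertical projection. -/
theorem abs_le_of_mem_ball {q : ℝ × ℝ × ℝ} {r a b z : ℝ} (hq : q.2.2 = 0)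
    (h : (a, b, z) ∈ Metric.ball q r) {t : ℝ} (ht : |t| ≤ |z|) : (a, b, t) ∈ Metric.ball q r := by
  obtain ⟨q₁, q₂, q₃⟩ := q
  simp only at hq
  subst hq
  simp only [Metric.mem_ball, Prod.dist_eq, Real.dist_eq, sup_lt_iff, sub_zero] at h ⊢
  exact ⟨h.1, h.2.1, ht.trans_lt h.2.2⟩

/-- A neighbourhood of a regular point of the level set `f = 0` can be pushed into the level set by
a global map fixing the level set. -/
theorem exists_local_retraction [T2Space M] [SigmaCompactSpace M] {f : M → ℝ} {O : Set M}
    (hO : IsOpen O) (hf : ContMDiffOn (𝓡 3) 𝓘(ℝ, ℝ) 3 f O)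
    (hf' : ∀ x ∈ O, mfderiv (𝓡 3) 𝓘(ℝ, ℝ) f x ≠ 0) {s : M} (hs : s ∈ O) (hs0 : f s = 0) :
    ∃ R : M → M, ContMDiff (𝓡 3) (𝓡 3) 3 R ∧ (∀ x ∈ O, f x = 0 → R x = x) ∧
      ∃ N : Set M, IsOpen N ∧ s ∈ N ∧ ∀ x ∈ N, R x ∈ O ∧ f (R x) = 0 := by
  have hfs := hf.contMDiffAt (hO.mem_nhds hs)
  obtain ⟨φ, hφ, w, hfw, hφw⟩ := exists_independent_function (f := f) (s := s)
  obtain ⟨r, hr, ψ, hψ, hsψ, hψO, htgt, hψf⟩ :=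
    exists_adaptedChart hfs hφ hfw hφw (hf' s hs) (hO.mem_nhds hs)
  have hloc : LocallyCompactSpace M := ChartedSpace.locallyCompactSpace E3 M
  obtain ⟨L, hLc, hsL, hLψ⟩ := exists_compact_subset ψ.open_source hsψ
  obtain ⟨χ, hχ1, hχ0, hχ⟩ := exists_contMDiffMap_one_nhds_of_subset_interior (𝓡 3) (n := 3)
    (isClosed_singleton (x := s)) (singleton_subset_iff.2 hsL)
  classical
  -- In a chart with last coordinate `f`, the height is multiplied by `1 - χ`: near `s` it becomes
  -- zero, and where `χ` vanishes nothing moves, so the map extends by the identity.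
  let J : M → ℝ × ℝ × ℝ := fun x => ((ψ x).1, (ψ x).2.1, (1 - χ x) * (ψ x).2.2)
  let R : M → M := fun x => if x ∈ ψ.source then ψ.symm (J x) else x
  have hq : (ψ s).2.2 = 0 := (hψf s hsψ).2.trans hs0
  have hJ : ∀ x ∈ ψ.source, J x ∈ ψ.target := by
    intro x hx
    have h1 : ψ x ∈ Metric.ball (ψ s) r := htgt.subset (ψ.map_source hx)
    rw [htgt]
    refine abs_le_of_mem_ball hq (a := (ψ x).1) (b := (ψ x).2.1) (z := (ψ x).2.2) h1 ?_
    rw [abs_mul]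
    refine mul_le_of_le_one_left (abs_nonneg _) (abs_le.2 ⟨?_, ?_⟩) <;> linarith [(hχ x).1, (hχ x).2]
  have hRs : ∀ x ∈ ψ.source, R x = ψ.symm (J x) := fun x hx => if_pos hx
  have hR0 : ∀ x, χ x = 0 → R x = x := by
    intro x hx
    by_cases hxs : x ∈ ψ.source
    · rw [hRs x hxs]
      have : J x = ψ x := by simp [J, hx]
      rw [this, ψ.left_inv hxs]
    · exact if_neg hxs
  have hRJ : ∀ x ∈ ψ.source, R x ∈ ψ.source ∧ ψ (R x) = J x := by
    intro x hx
    rw [hRs x hx]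
    exact ⟨ψ.map_target (hJ x hx), ψ.right_inv (hJ x hx)⟩
  refine ⟨R, ?_, ?_, ?_⟩
  · intro x
    by_cases hx : x ∈ ψ.source
    · have h1 : ContMDiffAt (𝓡 3) 𝓘(ℝ, ℝ × ℝ × ℝ) 3 ψ x :=
        hψ.contMDiffOn.contMDiffAt (ψ.open_source.mem_nhds hx)
      have h2 : ContMDiffAt (𝓡 3) 𝓘(ℝ, ℝ × ℝ × ℝ) 3 J x := by
        have hc : ContMDiffAt (𝓡 3) 𝓘(ℝ, ℝ) 3 χ x := χ.contMDiff x
        have hA : ContMDiffAt (𝓡 3) 𝓘(ℝ, (ℝ × ℝ × ℝ) × ℝ) 3 (fun x => (ψ x, χ x)) x :=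
          h1.prodMk_space hc
        have hB : ContDiff ℝ 3 (fun q : (ℝ × ℝ × ℝ) × ℝ =>
            (q.1.1, q.1.2.1, (1 - q.2) * q.1.2.2)) := by fun_prop
        exact (hB.contMDiff.contMDiffAt).comp x hA
      have h3 : ContMDiffAt 𝓘(ℝ, ℝ × ℝ × ℝ) (𝓡 3) 3 ψ.symm (J x) :=
        hψ.contMDiffOn_symm.contMDiffAt (ψ.open_target.mem_nhds (hJ x hx))
      refine (h3.comp x h2).congr_of_eventuallyEq ?_
      filter_upwards [ψ.open_source.mem_nhds hx] with y hy
      exact hRs y hy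
    · have hxL : x ∉ L := fun h => hx (hLψ h)
      refine contMDiffAt_id.congr_of_eventuallyEq ?_
      filter_upwards [hLc.isClosed.isOpen_compl.mem_nhds hxL] with y hy
      exact hR0 y (hχ0 y hy)
  · intro x hx hfx
    by_cases hxs : x ∈ ψ.source
    · rw [hRs x hxs]
      have : J x = ψ x := by
        have h0 : (ψ x).2.2 = 0 := (hψf x hxs).2.trans hfx
        refine Prod.ext rfl (Prod.ext rfl ?_)
        simp [J, h0]
      rw [this, ψ.left_inv hxs]
    · exact if_neg hxs
  · rw [nhdsSet_singleton] at hχ1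
    obtain ⟨N, hN, hNo, hsN⟩ := mem_nhds_iff.1 (hχ1.and (ψ.open_source.mem_nhds hsψ))
    refine ⟨N, hNo, hsN, fun x hx => ?_⟩
    obtain ⟨h1, h2⟩ := hN hx
    obtain ⟨h3, h4⟩ := hRJ x h2
    refine ⟨hψO h3, ?_⟩
    rw [← (hψf _ h3).2, h4]
    simp [J, h1]

/-- A neighbourhood of a compact part of the regular level set `f = 0` can be pushed into the level
set by a global map fixing the level set. -/
theorem exists_retraction [T2Space M] [SigmaCompactSpace M] {f : M → ℝ} {O K : Set M}
    (hO : IsOpen O) (hf : ContMDiffOn (𝓡 3) 𝓘(ℝ, ℝ) 3 f O)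
    (hf' : ∀ x ∈ O, mfderiv (𝓡 3) 𝓘(ℝ, ℝ) f x ≠ 0) (hK : IsCompact K) (hKO : K ⊆ O)
    (hK0 : ∀ x ∈ K, f x = 0) :
    ∃ R : M → M, ContMDiff (𝓡 3) (𝓡 3) 3 R ∧ (∀ x ∈ O, f x = 0 → R x = x) ∧
      ∃ N : Set M, IsOpen N ∧ K ⊆ N ∧ ∀ x ∈ N, R x ∈ O ∧ f (R x) = 0 := by
  suffices h : ∃ R : M → M, ContMDiff (𝓡 3) (𝓡 3) 3 R ∧ (∀ x ∈ O, f x = 0 → R x = x) ∧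
      ∃ N : Set M, IsOpen N ∧ K ∩ K ⊆ N ∧ ∀ x ∈ N, R x ∈ O ∧ f (R x) = 0 by
    rwa [inter_self] at h
  -- The induction statement concerns `T ∩ K`, since only points of `K` are known to be fixed by the
  -- maps.
  refine hK.induction_on (p := fun T => ∃ R : M → M, ContMDiff (𝓡 3) (𝓡 3) 3 R ∧
    (∀ x ∈ O, f x = 0 → R x = x) ∧
      ∃ N : Set M, IsOpen N ∧ T ∩ K ⊆ N ∧ ∀ x ∈ N, R x ∈ O ∧ f (R x) = 0) ?_ ?_ ?_ ?_
  · exact ⟨id, contMDiff_id, fun _ _ _ => rfl, ∅, isOpen_empty, by simp, fun x hx => hx.elim⟩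
  · rintro T T' hTT' ⟨R, h1, h2, N, h3, h4, h5⟩
    exact ⟨R, h1, h2, N, h3, (inter_subset_inter_left K hTT').trans h4, h5⟩
  · rintro T₁ T₂ ⟨R₁, hR₁, hR₁', N₁, hN₁, hTN₁, hRN₁⟩ ⟨R₂, hR₂, hR₂', N₂, hN₂, hTN₂, hRN₂⟩
    -- Points of `N₁` are sent by `R₁` into the level set, which `R₂` fixes; points of `R₁ ⁻¹' N₂`
    -- are sent into the level set by `R₂`. Hence the composite works on the union.
    refine ⟨R₂ ∘ R₁, hR₂.comp hR₁, fun x hx h0 => ?_, N₁ ∪ R₁ ⁻¹' N₂,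
      hN₁.union (hN₂.preimage hR₁.continuous), ?_, ?_⟩
    · rw [Function.comp_apply, hR₁' x hx h0, hR₂' x hx h0]
    · rintro x ⟨hx | hx, hxK⟩
      · exact Or.inl (hTN₁ ⟨hx, hxK⟩)
      · refine Or.inr ?_
        rw [mem_preimage, hR₁' x (hKO hxK) (hK0 x hxK)]
        exact hTN₂ ⟨hx, hxK⟩
    · rintro x (hx | hx)
      · obtain ⟨h1, h2⟩ := hRN₁ x hx
        rw [Function.comp_apply, hR₂' _ h1 h2]
        exact ⟨h1, h2⟩
      · exact hRN₂ _ hx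
  · intro x hx
    obtain ⟨R, hR, hR', N, hN, hxN, hRN⟩ :=
      exists_local_retraction hO hf hf' (hKO hx) (hK0 x hx)
    exact ⟨N, mem_nhdsWithin_of_mem_nhds (hN.mem_nhds hxN), R, hR, hR', N, hN,
      inter_subset_left, hRN⟩

/-- Charts at the points of the level set `f = 0` in which a retraction `p` onto this level set is
the projection along the last coordinate `f`. -/
structure IsSliceChart (f : M → ℝ) (p : M → M) (s : M) (r : ℝ)
    (e : OpenPartialHomeomorph M (ℝ × ℝ × ℝ)) : Prop where
  isC3Chart : IsC3Chart e
  mem_source : s ∈ e.source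
  target_eq : e.target = Metric.ball (e s) r
  snd_snd : ∀ x ∈ e.source, (e x).2.2 = f x
  mapsTo : ∀ x ∈ e.source, p x ∈ e.source
  apply_proj : ∀ x ∈ e.source, e (p x) = ((e x).1, (e x).2.1, 0)

/-- The horizontal coordinates of an adapted chart are evaluated at `p x` instead of `x`, while the
height `f x` is kept. On the level set nothing changes, so the differential at `s` is still
invertible. The function `φ` is left free because it will define the boundary of a surface. -/
theorem exists_isSliceChart {f φ : M → ℝ} {p : M → M} {O N : Set M} (hO : IsOpen O)
    (hN : IsOpen N) (hf : ContMDiffOn (𝓡 3) 𝓘(ℝ, ℝ) 3 f O)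
    (hf' : ∀ x ∈ O, mfderiv (𝓡 3) 𝓘(ℝ, ℝ) f x ≠ 0) (hp : ContMDiff (𝓡 3) (𝓡 3) 3 p)
    (hpO : ∀ x ∈ O, f x = 0 → p x = x) (hpN : ∀ x ∈ N, p x ∈ O ∧ f (p x) = 0) {s : M}
    (hsO : s ∈ O) (hsN : s ∈ N) (hs0 : f s = 0) (hφ : ContMDiffAt (𝓡 3) 𝓘(ℝ, ℝ) 3 φ s)
    {w : TangentSpace (𝓡 3) s} (hfw : mfderiv (𝓡 3) 𝓘(ℝ, ℝ) f s w = 0)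
    (hφw : mfderiv (𝓡 3) 𝓘(ℝ, ℝ) φ s w ≠ 0) {G : Set M} (hG : G ∈ 𝓝 s) :
    ∃ r : ℝ, 0 < r ∧ ∃ e : OpenPartialHomeomorph M (ℝ × ℝ × ℝ), IsSliceChart f p s r e ∧
      e.source ⊆ G ∧ ∀ x ∈ e.source, (e x).1 = φ (p x) := by
  have hfs := hf.contMDiffAt (hO.mem_nhds hsO)
  obtain ⟨r₀, hr₀, ψ, hψ, hsψ, hψON, htgt, hψf⟩ :=
    exists_adaptedChart hfs hφ hfw hφw (hf' s hsO) (inter_mem (hO.mem_nhds hsO) (hN.mem_nhds hsN))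
  have hps : p s = s := hpO s hsO hs0
  have hψs : (ψ s).2.2 = 0 := (hψf s hsψ).2.trans hs0
  -- the new chart, read in the chart `ψ`
  let q : ℝ × ℝ × ℝ → ℝ × ℝ × ℝ := fun y => ψ (p (ψ.symm y))
  let g : ℝ × ℝ × ℝ → ℝ × ℝ × ℝ := fun y => ((q y).1, (q y).2.1, y.2.2)
  have hqd : ContDiffAt ℝ 3 q (ψ s) := by
    have h1 : ContMDiffAt 𝓘(ℝ, ℝ × ℝ × ℝ) (𝓡 3) 3 ψ.symm (ψ s) :=
      hψ.contMDiffOn_symm.contMDiffAt (ψ.open_target.mem_nhds (ψ.map_source hsψ))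
    have h2 : ContMDiffAt 𝓘(ℝ, ℝ × ℝ × ℝ) (𝓡 3) 3 (p ∘ ψ.symm) (ψ s) :=
      (hp.contMDiffAt).comp _ h1
    have h3 : (p ∘ ψ.symm) (ψ s) = s := by simp [ψ.left_inv hsψ, hps]
    have h4 : ContMDiffAt (𝓡 3) 𝓘(ℝ, ℝ × ℝ × ℝ) 3 ψ ((p ∘ ψ.symm) (ψ s)) := by
      rw [h3]
      exact hψ.contMDiffOn.contMDiffAt (ψ.open_source.mem_nhds hsψ)
    exact (h4.comp _ h2).contDiffAt
  have hgd : ContDiffAt ℝ 3 g (ψ s) := by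
    have h1 : ContDiff ℝ 3 (fun z : (ℝ × ℝ × ℝ) × (ℝ × ℝ × ℝ) => (z.1.1, z.1.2.1, z.2.2.2)) := by
      fun_prop
    exact h1.contDiffAt.comp (ψ s) (hqd.prodMk contDiffAt_id)
  have hgid : ∀ y ∈ ψ.target, y.2.2 = 0 → g y = y := by
    intro y hy hy0
    have h1 := ψ.map_target hy
    have h2 : f (ψ.symm y) = 0 := by rw [← (hψf _ h1).2, ψ.right_inv hy, hy0]
    have h3 : q y = y := by
      simp only [q]
      rw [hpO _ (hψON h1).1 h2, ψ.right_inv hy]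
    refine Prod.ext ?_ (Prod.ext ?_ rfl) <;> simp [g, h3]
  have hgs : g (ψ s) = ψ s := hgid _ (ψ.map_source hsψ) hψs
  set D := fderiv ℝ g (ψ s) with hD
  have hgD : HasFDerivAt g D (ψ s) := (hgd.differentiableAt (by norm_num)).hasFDerivAt
  -- The differential preserves heights and is the identity on horizontal vectors, so it is
  -- unipotent and injective.
  have hD1 : ∀ v : ℝ × ℝ × ℝ, (D v).2.2 = v.2.2 := by
    intro v
    have h1 : HasFDerivAt (fun y => (g y).2.2)
        ((ContinuousLinearMap.snd ℝ ℝ ℝ).comp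
          ((ContinuousLinearMap.snd ℝ ℝ (ℝ × ℝ)).comp D)) (ψ s) :=
      hgD.snd.snd
    have h2 : HasFDerivAt (fun y : ℝ × ℝ × ℝ => y.2.2)
        ((ContinuousLinearMap.snd ℝ ℝ ℝ).comp (ContinuousLinearMap.snd ℝ ℝ (ℝ × ℝ))) (ψ s) :=
      ((ContinuousLinearMap.snd ℝ ℝ ℝ).comp (ContinuousLinearMap.snd ℝ ℝ (ℝ × ℝ))).hasFDerivAt
    exact DFunLike.congr_fun (h1.unique h2) v
  have hD2 : ∀ a b : ℝ, D (a, b, 0) = (a, b, 0) := by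
    intro a b
    have hl : HasDerivAt (fun t : ℝ => ψ s + t • ((a, b, 0) : ℝ × ℝ × ℝ)) (a, b, 0) 0 := by
      simpa using ((hasDerivAt_id (0 : ℝ)).smul_const ((a, b, 0) : ℝ × ℝ × ℝ)).const_add (ψ s)
    have h1 : HasDerivAt (fun t : ℝ => g (ψ s + t • ((a, b, 0) : ℝ × ℝ × ℝ))) (D (a, b, 0)) 0 := by
      refine HasFDerivAt.comp_hasDerivAt (x := (0 : ℝ)) (l := g) (l' := D) ?_ hl
      simpa using hgD
    refine (h1.unique (hl.congr_of_eventuallyEq ?_))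
    have hev : ∀ᶠ t in 𝓝 (0 : ℝ), ψ s + t • ((a, b, 0) : ℝ × ℝ × ℝ) ∈ ψ.target := by
      refine hl.continuousAt.eventually_mem (ψ.open_target.mem_nhds ?_)
      simpa using ψ.map_source hsψ
    filter_upwards [hev] with t ht
    refine hgid _ ht ?_
    simp [hψs]
  have hinj : Function.Injective (D : ℝ × ℝ × ℝ →ₗ[ℝ] ℝ × ℝ × ℝ) := by
    refine (injective_iff_map_eq_zero _).2 fun ⟨a, b, c⟩ h => ?_
    have h0 : D (a, b, c) = 0 := h
    have hc : c = 0 := by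
      have := hD1 (a, b, c)
      rw [h0] at this
      exact this.symm
    subst hc
    rw [← hD2 a b, h0]
  set D' : (ℝ × ℝ × ℝ) ≃L[ℝ] ℝ × ℝ × ℝ :=
    (LinearEquiv.ofInjectiveEndo _ hinj).toContinuousLinearEquiv
  have hD' : (D' : ℝ × ℝ × ℝ →L[ℝ] ℝ × ℝ × ℝ) = D := by
    ext <;> rfl
  obtain ⟨r₁, hr₁, e₁, he₁, hse₁, hsub₁, -, heq₁⟩ :=
    hψ.exists_of_hasFDerivAt hsψ hgd (hD' ▸ hgD) hG
  have hV : e₁.source ∩ p ⁻¹' e₁.source ∈ 𝓝 s := by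
    refine inter_mem (e₁.open_source.mem_nhds hse₁) (hp.continuous.continuousAt.preimage_mem_nhds ?_)
    rw [hps]
    exact e₁.open_source.mem_nhds hse₁
  obtain ⟨r, hr, e, he, hse, hsub, htgt, htsub, heq, heqs⟩ := he₁.exists_target_eq_ball hse₁ hV
  have hval : ∀ x ∈ ψ.source, p x ∈ ψ.source →
      (e x).1 = φ (p x) ∧ (e x).2.1 = (ψ (p x)).2.1 ∧ (e x).2.2 = f x := by
    intro x hx hpx
    rw [heq, heq₁]
    simp only [g, q, ψ.left_inv hx]
    exact ⟨(hψf _ hpx).1, trivial, (hψf _ hx).2⟩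
  have hsrc : ∀ x ∈ e.source, x ∈ ψ.source ∧ p x ∈ ψ.source ∧ p x ∈ e₁.source ∧ x ∈ N := by
    intro x hx
    obtain ⟨h1, h2, h3⟩ := hsub hx
    exact ⟨(hsub₁ h1).1, (hsub₁ h3).1, h3, (hψON (hsub₁ h1).1).2⟩
  have hep : ∀ x ∈ e.source, e (p x) = ((e x).1, (e x).2.1, 0) := by
    intro x hx
    obtain ⟨h1, h2, h3, h4⟩ := hsrc x hx
    obtain ⟨h5, h6⟩ := hpN x h4
    have hpp : p (p x) = p x := hpO _ h5 h6
    obtain ⟨a1, a2, a3⟩ := hval x h1 h2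
    obtain ⟨b1, b2, b3⟩ := hval (p x) h2 (by rwa [hpp])
    refine Prod.ext ?_ (Prod.ext ?_ ?_)
    · rw [b1, a1, hpp]
    · rw [b2, a2, hpp]
    · rw [b3, h6]
  have hes : (e s).2.2 = 0 := by
    rw [(hval s hsψ (by rwa [hps])).2.2, hs0]
  refine ⟨r, hr, e, ⟨he, hse, ?_, fun x hx => (hval x (hsrc x hx).1 (hsrc x hx).2.1).2.2, ?_, hep⟩,
    fun x hx => (hsub₁ (hsub hx).1).2, fun x hx => (hval x (hsrc x hx).1 (hsrc x hx).2.1).1⟩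
  · rw [htgt, heq]
  · intro x hx
    -- Since the target is a ball centred at height zero, it contains the projection of each of its
    -- points; hence `p` maps the source into itself.
    have h1 : ((e x).1, (e x).2.1, (0 : ℝ)) ∈ e.target := by
      have h2 : e x ∈ Metric.ball (e s) r := by
        rw [heq s, ← htgt]
        exact e.map_source hx
      rw [htgt, ← heq s]
      refine abs_le_of_mem_ball hes (a := (e x).1) (b := (e x).2.1) (z := (e x).2.2) h2 ?_
      simp
    have h2 : p x = e.symm (e (p x)) := by
      rw [heqs, heq, e₁.left_inv (hsrc x hx).2.2.1]
    rw [h2, hep x hx]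
    exact e.map_target h1

end Retraction

end PreparedTriples

/-! ### Surfaces with boundary inside the level set -/

namespace PreparedTriples

/-- Euclidean two-space. -/
abbrev E2 : Type := EuclideanSpace ℝ (Fin 2)

/-- The embedding of the plane in three-space as the horizontal plane. -/
def planeIncl (y : E2) : ℝ × ℝ × ℝ := (y 0, y 1, 0)

/-- The projection of three-space onto the plane. -/
def planeProj (q : ℝ × ℝ × ℝ) : E2 := !₂[q.1, q.2.1]

theorem contDiff_planeIncl {n : ℕ∞ω} : ContDiff ℝ n planeIncl := by
  unfold planeIncl
  fun_prop

theorem contDiff_planeProj {n : ℕ∞ω} : ContDiff ℝ n planeProj := by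
  unfold planeProj
  rw [contDiff_euclidean]
  intro i
  fin_cases i
  · exact contDiff_fst
  · exact contDiff_fst.comp contDiff_snd

@[simp] theorem planeProj_planeIncl (y : E2) : planeProj (planeIncl y) = y := by
  ext i
  fin_cases i <;> rfl

section SurfaceCharts

variable {M : Type u} [TopologicalSpace M] [ChartedSpace E3 M] [IsManifold (𝓡 3) ∞ M]

/-- `e` is a slice chart in which the subset `T` of the level set `f = 0` is the half-plane where
the first coordinate is nonnegative. -/
structure IsSurfaceChart (f : M → ℝ) (p : M → M) (T : Set M) (s : M) (r : ℝ)
    (e : OpenPartialHomeomorph M (ℝ × ℝ × ℝ)) : Prop extends IsSliceChart f p s r e where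
  mem_iff : ∀ x ∈ e.source, f x = 0 → (x ∈ T ↔ 0 ≤ (e x).1)

variable {f : M → ℝ} {p : M → M} {T : Set M}

theorem IsSurfaceChart.symm_planeIncl_mem {s : M} {r : ℝ}
    {e : OpenPartialHomeomorph M (ℝ × ℝ × ℝ)} (h : IsSurfaceChart f p T s r e) {y : E2}
    (hy : planeIncl y ∈ e.target) (hy0 : 0 ≤ y 0) : e.symm (planeIncl y) ∈ T := by
  have h1 := e.map_target hy
  refine (h.mem_iff _ h1 ?_).2 ?_
  · rw [← h.snd_snd _ h1, e.right_inv hy]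
    rfl
  · rw [e.right_inv hy]
    exact hy0

theorem IsSurfaceChart.planeIncl_planeProj {s : M} {r : ℝ}
    {e : OpenPartialHomeomorph M (ℝ × ℝ × ℝ)} (h : IsSurfaceChart f p T s r e) {x : M}
    (hx : x ∈ e.source) (hfx : f x = 0) : planeIncl (planeProj (e x)) = e x :=
  Prod.ext rfl (Prod.ext rfl ((h.snd_snd x hx).trans hfx).symm)

open Classical in
/-- The chart of the surface `T` defined by a surface chart of the ambient manifold. -/
def surfaceChart (hT : ∀ x ∈ T, f x = 0) (s : T) {r : ℝ}
    {e : OpenPartialHomeomorph M (ℝ × ℝ × ℝ)} (h : IsSurfaceChart f p T s r e) :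
    OpenPartialHomeomorph T (EuclideanHalfSpace 2) where
  toFun x := (𝓡∂ 2).symm (planeProj (e x))
  -- The value `s` is a dummy: on the target the point always belongs to `T`.
  invFun y := if hy : e.symm (planeIncl y.1) ∈ T then ⟨_, hy⟩ else s
  source := Subtype.val ⁻¹' e.source
  target := (fun y : EuclideanHalfSpace 2 => planeIncl y.1) ⁻¹' e.target
  map_source' := fun x hx => by
    have h1 : ((𝓡∂ 2).symm (planeProj (e x))).1 = planeProj (e x) := by
      refine (𝓡∂ 2).right_inv ?_
      rw [range_modelWithCornersEuclideanHalfSpace]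
      exact (h.mem_iff x hx (hT x x.2)).1 x.2
    rw [mem_preimage, h1, h.planeIncl_planeProj hx (hT x x.2)]
    exact e.map_source hx
  map_target' := fun y hy => by
    have h1 : e.symm (planeIncl y.1) ∈ T := h.symm_planeIncl_mem hy y.2
    rw [mem_preimage, dif_pos h1]
    exact e.map_target hy
  left_inv' := fun x hx => by
    have h1 : ((𝓡∂ 2).symm (planeProj (e x))).1 = planeProj (e x) := by
      refine (𝓡∂ 2).right_inv ?_
      rw [range_modelWithCornersEuclideanHalfSpace]
      exact (h.mem_iff x hx (hT x x.2)).1 x.2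
    have h2 : e.symm (planeIncl ((𝓡∂ 2).symm (planeProj (e x))).1) = x := by
      rw [h1, h.planeIncl_planeProj hx (hT x x.2), e.left_inv hx]
    have h3 : e.symm (planeIncl ((𝓡∂ 2).symm (planeProj (e x))).1) ∈ T := by rw [h2]; exact x.2
    rw [dif_pos h3]
    exact Subtype.ext h2
  right_inv' := fun y hy => by
    have h1 : e.symm (planeIncl y.1) ∈ T := h.symm_planeIncl_mem hy y.2
    rw [dif_pos h1]
    simp only
    rw [e.right_inv hy, planeProj_planeIncl]
    exact (𝓡∂ 2).left_inv y
  open_source := e.open_source.preimage continuous_subtype_val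
  open_target := e.open_target.preimage
    (contDiff_planeIncl (n := 0).continuous.comp continuous_subtype_val)
  continuousOn_toFun := by
    refine (𝓡∂ 2).continuous_symm.comp_continuousOn ?_
    refine (contDiff_planeProj (n := 0)).continuous.comp_continuousOn ?_
    exact e.continuousOn.comp continuous_subtype_val.continuousOn fun x hx => hx
  continuousOn_invFun := by
    refine (IsInducing.subtypeVal.continuousOn_iff).2 ?_
    have h1 : ContinuousOn (fun y : EuclideanHalfSpace 2 => e.symm (planeIncl y.1))
        ((fun y : EuclideanHalfSpace 2 => planeIncl y.1) ⁻¹' e.target) :=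
      e.continuousOn_symm.comp ((contDiff_planeIncl (n := 0)).continuous.comp
        continuous_subtype_val).continuousOn fun y hy => hy
    refine h1.congr fun y hy => ?_
    have h2 : e.symm (planeIncl y.1) ∈ T := h.symm_planeIncl_mem hy y.2
    simp only [Function.comp_apply, dif_pos h2]

theorem surfaceChart_apply (hT : ∀ x ∈ T, f x = 0) {s : T} {r : ℝ}
    {e : OpenPartialHomeomorph M (ℝ × ℝ × ℝ)} (h : IsSurfaceChart f p T s r e) {x : T}
    (hx : (x : M) ∈ e.source) : (𝓡∂ 2) (surfaceChart hT s h x) = planeProj (e x) := by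
  refine (𝓡∂ 2).right_inv ?_
  rw [range_modelWithCornersEuclideanHalfSpace]
  exact (h.mem_iff x hx (hT x x.2)).1 x.2

theorem surfaceChart_symm_apply (hT : ∀ x ∈ T, f x = 0) {s : T} {r : ℝ}
    {e : OpenPartialHomeomorph M (ℝ × ℝ × ℝ)} (h : IsSurfaceChart f p T s r e)
    {y : EuclideanHalfSpace 2} (hy : planeIncl y.1 ∈ e.target) :
    ((surfaceChart hT s h).symm y : M) = e.symm (planeIncl y.1) := by
  have h2 : e.symm (planeIncl y.1) ∈ T := h.symm_planeIncl_mem hy y.2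
  exact congrArg Subtype.val (dif_pos h2)

/-- A transition map is the ambient one, restricted to the horizontal plane and then projected back
to it; hence it is `C³`. -/
theorem contDiffOn_surfaceChart_transition (hT : ∀ x ∈ T, f x = 0) {s s' : T} {r r' : ℝ}
    {e e' : OpenPartialHomeomorph M (ℝ × ℝ × ℝ)} (h : IsSurfaceChart f p T s r e)
    (h' : IsSurfaceChart f p T s' r' e') :
    ContDiffOn ℝ 3
      ((𝓡∂ 2) ∘ (surfaceChart hT s h).symm ≫ₕ surfaceChart hT s' h' ∘ (𝓡∂ 2).symm)
      ((𝓡∂ 2).symm ⁻¹' ((surfaceChart hT s h).symm ≫ₕ surfaceChart hT s' h').source ∩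
        range (𝓡∂ 2)) := by
  have h1 := h.isC3Chart.contDiffOn_comp_symm h'.isC3Chart.contMDiffOn
  have h2 : ContDiffOn ℝ 3 (planeProj ∘ (e' ∘ e.symm) ∘ planeIncl)
      (planeIncl ⁻¹' (e.target ∩ e.symm ⁻¹' e'.source)) :=
    contDiff_planeProj.comp_contDiffOn
      (h1.comp contDiff_planeIncl.contDiffOn fun y hy => hy)
  have key : ∀ z : EuclideanHalfSpace 2,
      z ∈ ((surfaceChart hT s h).symm ≫ₕ surfaceChart hT s' h').source →
      planeIncl z.1 ∈ e.target ∧ e.symm (planeIncl z.1) ∈ e'.source := by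
    intro z hz
    rw [OpenPartialHomeomorph.trans_source] at hz
    obtain ⟨hz1, hz2⟩ := hz
    have hz1' : planeIncl z.1 ∈ e.target := hz1
    refine ⟨hz1', ?_⟩
    rw [← surfaceChart_symm_apply hT h hz1']
    exact hz2
  have hr : ∀ y ∈ range (𝓡∂ 2), ((𝓡∂ 2).symm y).1 = y := fun y hy => (𝓡∂ 2).right_inv hy
  refine (h2.mono fun y hy => ?_).congr fun y hy => ?_
  · have := key _ hy.1
    rwa [hr y hy.2] at this
  · have h3 := key _ hy.1
    have h4 := surfaceChart_symm_apply hT h h3.1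
    have h5 : ((surfaceChart hT s h).symm ((𝓡∂ 2).symm y) : M) ∈ e'.source := by
      rw [h4]
      exact h3.2
    have h6 := surfaceChart_apply hT h' h5
    rw [h4, hr y hy.2] at h6
    exact h6

theorem extChartAt_eq_of_chartAt {S : Type u} [TopologicalSpace S]
    [ChartedSpace (EuclideanHalfSpace 2) S] {s : S}
    {c : OpenPartialHomeomorph S (EuclideanHalfSpace 2)}
    (h : chartAt (EuclideanHalfSpace 2) s = c) (x : S) : extChartAt (𝓡∂ 2) s x = (𝓡∂ 2) (c x) := by
  rw [← h]
  rfl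

/-- A subset of the level set `f = 0` with a surface chart at each of its points is a surface with
boundary. -/
theorem exists_chartedSpace_surface (hT : ∀ x ∈ T, f x = 0)
    (hchart : ∀ s ∈ T, ∃ r e, IsSurfaceChart f p T s r e) :
    ∃ _ : ChartedSpace (EuclideanHalfSpace 2) T, IsManifold (𝓡∂ 2) 3 T ∧
      ContMDiff (𝓡∂ 2) (𝓡 3) 3 (Subtype.val : T → M) ∧
      (∀ s ∈ (𝓡∂ 2).boundary T, p ⁻¹' T ∉ 𝓝 (s : M)) ∧
      ∀ (g : M → T) (A : Set M) (x : M),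
        ContMDiffWithinAt (𝓡 3) (𝓡 3) 3 (fun y => (g y : M)) A x →
          ContMDiffWithinAt (𝓡 3) (𝓡∂ 2) 3 g A x := by
  have hchart' : ∀ s : T, ∃ r e, IsSurfaceChart f p T s r e := fun s => hchart s s.2
  choose r e he using hchart'
  let C : ChartedSpace (EuclideanHalfSpace 2) T :=
    { atlas := range fun s : T => surfaceChart hT s (he s)
      chartAt := fun s => surfaceChart hT s (he s)
      mem_chart_source := fun s => (he s).mem_source
      chart_mem_atlas := fun s => ⟨s, rfl⟩ }
  have hman : IsManifold (𝓡∂ 2) 3 T := by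
    refine isManifold_of_contDiffOn (𝓡∂ 2) 3 T ?_
    rintro _ _ ⟨s, rfl⟩ ⟨s', rfl⟩
    exact contDiffOn_surfaceChart_transition hT (he s) (he s')
  have hext : ∀ s x : T, (x : M) ∈ (e s).source → extChartAt (𝓡∂ 2) s x = planeProj (e s x) := by
    intro s x hx
    exact (extChartAt_eq_of_chartAt rfl x).trans (surfaceChart_apply hT (he s) hx)
  refine ⟨C, hman, ?_, ?_, ?_⟩
  · intro s
    have h1 : ContMDiffAt (𝓡∂ 2) 𝓘(ℝ, E2) 3 (extChartAt (𝓡∂ 2) s) s := contMDiffAt_extChartAt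
    have hval : planeIncl (extChartAt (𝓡∂ 2) s s) = e s s := by
      rw [hext s s (he s).mem_source]
      exact (he s).planeIncl_planeProj (he s).mem_source (hT s s.2)
    have h2 : ContMDiffAt (𝓡∂ 2) 𝓘(ℝ, ℝ × ℝ × ℝ) 3 (fun x => planeIncl (extChartAt (𝓡∂ 2) s x)) s :=
      (contDiff_planeIncl.contMDiff.contMDiffAt).comp s h1
    have h3 : ContMDiffAt 𝓘(ℝ, ℝ × ℝ × ℝ) (𝓡 3) 3 (e s).symm (planeIncl (extChartAt (𝓡∂ 2) s s)) := by
      rw [hval]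
      exact (he s).isC3Chart.contMDiffOn_symm.contMDiffAt
        ((e s).open_target.mem_nhds ((e s).map_source (he s).mem_source))
    refine (h3.comp s h2).congr_of_eventuallyEq ?_
    have hev : ∀ᶠ x : T in 𝓝 s, (x : M) ∈ (e s).source :=
      continuous_subtype_val.continuousAt.eventually_mem
        ((e s).open_source.mem_nhds (he s).mem_source)
    filter_upwards [hev] with x hx
    rw [Function.comp_apply, hext s x hx, (he s).planeIncl_planeProj hx (hT x x.2),
      (e s).left_inv hx]
  · intro s hs hp
    have hs1 : extChartAt (𝓡∂ 2) s s ∈ frontier (range (𝓡∂ 2)) := hs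
    rw [frontier_range_modelWithCornersEuclideanHalfSpace, hext s s (he s).mem_source] at hs1
    have hs0 : (e s s).1 = 0 := Eq.symm hs1
    have hes := (he s).mem_source
    have hfs : (e s s).2.2 = 0 := ((he s).snd_snd _ hes).trans (hT s s.2)
    -- A boundary point has first coordinate zero. Moving it to first coordinate `-t` gives nearby
    -- points whose projection by `p` leaves the half-plane, that is, leaves `T`.
    let l : ℝ → ℝ × ℝ × ℝ := fun t => (-t, (e s s).2.1, 0)
    have hl0 : l 0 = e s s := by
      refine Prod.ext ?_ (Prod.ext rfl ?_) <;> simp [l, hs0, hfs]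
    have hl : Continuous l := by fun_prop
    have h1 : ContinuousAt (fun t => (e s).symm (l t)) 0 := by
      refine ContinuousAt.comp (g := (e s).symm) ?_ hl.continuousAt
      rw [hl0]
      exact (e s).continuousAt_symm ((e s).map_source hes)
    have h2 : ∀ᶠ t in 𝓝 (0 : ℝ), l t ∈ (e s).target ∧ p ((e s).symm (l t)) ∈ T := by
      refine (hl.continuousAt.eventually_mem ?_).and (h1.eventually_mem (s := p ⁻¹' T) ?_)
      · rw [hl0]
        exact (e s).open_target.mem_nhds ((e s).map_source hes)
      · simpa [hl0, (e s).left_inv hes] using hp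
    have h3 : ∀ᶠ t in 𝓝[>] (0 : ℝ), 0 < t ∧ l t ∈ (e s).target ∧ p ((e s).symm (l t)) ∈ T :=
      eventually_mem_nhdsWithin.and (h2.filter_mono nhdsWithin_le_nhds)
    obtain ⟨t, ht, ht1, ht2⟩ := h3.exists
    have h4 := (e s).map_target ht1
    have h5 := (he s).mapsTo _ h4
    have h6 := ((he s).mem_iff _ h5 (hT _ ht2)).1 ht2
    rw [(he s).apply_proj _ h4, (e s).right_inv ht1] at h6
    simp only [l] at h6
    linarith
  · intro g A x hg
    -- In a chart of `T`, the map `g` is the ambient slice chart applied to its `M`-valued version,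
    -- so smoothness is detected in `M`.
    rw [contMDiffWithinAt_iff_target]
    have hcont : ContinuousWithinAt g A x :=
      IsInducing.subtypeVal.continuousWithinAt_iff.2 hg.continuousWithinAt
    refine ⟨hcont, ?_⟩
    set s := g x with hs
    have hes := (he s).mem_source
    have h1 : ContMDiffAt (𝓡 3) 𝓘(ℝ, ℝ × ℝ × ℝ) 3 (e s) s :=
      (he s).isC3Chart.contMDiffOn.contMDiffAt ((e s).open_source.mem_nhds hes)
    have h2 : ContMDiffAt (𝓡 3) 𝓘(ℝ, E2) 3 (fun y => planeProj (e s y)) s :=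
      (contDiff_planeProj.contMDiff.contMDiffAt).comp _ h1
    have h3 : ContMDiffWithinAt (𝓡 3) 𝓘(ℝ, E2) 3 (fun y => planeProj (e s (g y))) A x :=
      ContMDiffAt.comp_contMDiffWithinAt (g := fun y => planeProj (e s y))
        (f := fun y => (g y : M)) x h2 hg
    refine h3.congr_of_eventuallyEq ?_ ?_
    · have : ∀ᶠ y in 𝓝[A] x, (g y : M) ∈ (e s).source :=
        hg.continuousWithinAt.eventually_mem ((e s).open_source.mem_nhds hes)
      filter_upwards [this] with y hy
      exact hext s (g y) hy
    · exact hext s (g x) hes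

end SurfaceCharts

end PreparedTriples

namespace PreparedTriples

/-! ### Thickening a surface to a foliated box -/

section Foliation

variable {M : Type u} [EMetricSpace M] [ChartedSpace E3 M] [IsManifold (𝓡 3) ∞ M]
  [RiemannianBundle (fun x : M => TangentSpace (𝓡 3) x)]
  {f : M → ℝ} {p : M → M} {T : Set M}

/-- In a slice chart `p` determines the two horizontal coordinates and `f` is the third. -/
theorem IsSliceChart.eq_of_eq {s : M} {r : ℝ} {e : OpenPartialHomeomorph M (ℝ × ℝ × ℝ)}
    (h : IsSliceChart f p s r e) {x y : M} (hx : x ∈ e.source) (hy : y ∈ e.source)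
    (hp : p x = p y) (hf : f x = f y) : x = y := by
  refine e.injOn hx hy ?_
  have h1 := h.apply_proj x hx
  rw [hp, h.apply_proj y hy, Prod.mk.injEq, Prod.mk.injEq] at h1
  refine Prod.ext h1.1.symm (Prod.ext h1.2.1.symm ?_)
  rw [h.snd_snd x hx, h.snd_snd y hy, hf]

theorem IsSliceChart.contMDiffAt {s : M} {r : ℝ} {e : OpenPartialHomeomorph M (ℝ × ℝ × ℝ)}
    (h : IsSliceChart f p s r e) {x : M} (hx : x ∈ e.source) :
    ContMDiffAt (𝓡 3) 𝓘(ℝ, ℝ) 3 f x := by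
  have h1 : ContMDiffAt (𝓡 3) 𝓘(ℝ, ℝ × ℝ × ℝ) 3 e x :=
    h.isC3Chart.contMDiffOn.contMDiffAt (e.open_source.mem_nhds hx)
  have h2 : ContDiff ℝ 3 (fun q : ℝ × ℝ × ℝ => q.2.2) := by fun_prop
  refine ((h2.contMDiff.contMDiffAt).comp x h1).congr_of_eventuallyEq ?_
  filter_upwards [e.open_source.mem_nhds hx] with y hy
  exact (h.snd_snd y hy).symm

/-- In a slice chart, the fibre of the retraction over a point `x` of the level set is a vertical
segment. -/
theorem IsSliceChart.exists_mem_fiber {s : M} {r : ℝ} {e : OpenPartialHomeomorph M (ℝ × ℝ × ℝ)}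
    (h : IsSliceChart f p s r e) (hs : f s = 0) {x : M} (hx : x ∈ e.source) (hfx : f x = 0) {c : ℝ}
    (hc : |c| < r) : ((e x).1, (e x).2.1, c) ∈ e.target ∧
      e.symm ((e x).1, (e x).2.1, c) ∈ e.source ∧ p (e.symm ((e x).1, (e x).2.1, c)) = x ∧
        f (e.symm ((e x).1, (e x).2.1, c)) = c := by
  have h1 : ((e x).1, (e x).2.1, c) ∈ e.target := by
    have h2 := e.map_source hx
    have hs0 : (e s).2.2 = 0 := (h.snd_snd s h.mem_source).trans hs
    rw [h.target_eq] at h2 ⊢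
    simp only [Metric.mem_ball, Prod.dist_eq, Real.dist_eq, sup_lt_iff] at h2 ⊢
    rw [hs0, sub_zero]
    exact ⟨h2.1, h2.2.1, hc⟩
  have h2 := e.map_target h1
  refine ⟨h1, h2, ?_, ?_⟩
  · refine e.injOn (h.mapsTo _ h2) hx ?_
    rw [h.apply_proj _ h2, e.right_inv h1]
    exact Prod.ext rfl (Prod.ext rfl ((h.snd_snd x hx).trans hfx).symm)
  · rw [← h.snd_snd _ h2, e.right_inv h1]

/-- A compact connected part `T` of the level set `f = 0` with surface charts has a compact
neighbourhood in its saturation which is trivially foliated by the level sets of `f`. -/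
theorem exists_isTrivialFoliation (hp : ContMDiff (𝓡 3) (𝓡 3) 3 p) (hTc : IsCompact T)
    (hTconn : IsConnected T) (hT : ∀ x ∈ T, f x = 0) (hpT : ∀ x ∈ T, p x = x)
    (hchart : ∀ s ∈ T, ∀ G ∈ 𝓝 s, ∃ r : ℝ, 0 < r ∧ ∃ e, IsSurfaceChart f p T s r e ∧ e.source ⊆ G)
    {G : Set M} (hG : G ∈ 𝓝ˢ T) :
    ∀ᶠ ε in 𝓝[>] (0 : ℝ), ∃ A : Set M, IsCompact A ∧ A ⊆ G ∧ (∀ x ∈ A, p x ∈ T ∧ |f x| ≤ ε) ∧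
      closure (interior A) = A ∧ (∀ s ∈ T, p ⁻¹' T ∈ 𝓝 s → s ∈ interior A) ∧
      ∃ (_ : ChartedSpace (EuclideanHalfSpace 2) T) (Φ : T × ℝ → M) (ϖ : M → T),
        IsManifold (𝓡∂ 2) 3 T ∧ (∀ s ∈ (𝓡∂ 2).boundary T, p ⁻¹' T ∉ 𝓝 (s : M)) ∧
        (∀ x ∈ A, (ϖ x : M) = p x) ∧ IsTrivialFoliation 3 (interior A) f ε Φ ϖ := by
  -- the maps `p` and `f` separate the points near `T`
  obtain ⟨W, hW, hWinj⟩ : ∃ W ∈ 𝓝ˢ T, InjOn (fun x => (p x, f x)) W := by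
    refine Set.InjOn.exists_mem_nhdsSet (fun x hx y hy hxy => ?_) hTc (fun x hx => ?_)
      fun x hx => ?_
    · rw [← hpT x hx, ← hpT y hy]
      exact congrArg Prod.fst hxy
    · obtain ⟨r, -, e, he, -⟩ := hchart x hx univ univ_mem
      exact hp.continuous.continuousAt.prodMk (he.contMDiffAt he.mem_source).continuousAt
    · obtain ⟨r, -, e, he, -⟩ := hchart x hx univ univ_mem
      refine ⟨e.source, e.open_source.mem_nhds he.mem_source, fun y hy z hz hyz => ?_⟩
      exact he.eq_of_eq hy hz (congrArg Prod.fst hyz) (congrArg Prod.snd hyz)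
  have hchart' : ∀ s : T, ∃ r : ℝ, 0 < r ∧ ∃ e, IsSurfaceChart f p T s r e ∧ e.source ⊆ W ∩ G :=
    fun s => hchart s s.2 _ (inter_mem (mem_nhdsSet_iff_forall.1 hW s s.2)
      (mem_nhdsSet_iff_forall.1 hG s s.2))
  choose r hr e he hsub using hchart'
  obtain ⟨t, ht⟩ := hTc.elim_finite_subcover (fun s : T => (e s).source)
    (fun s => (e s).open_source) fun x hx => mem_iUnion.2 ⟨⟨x, hx⟩, (he ⟨x, hx⟩).mem_source⟩
  -- With `ε` below the radii of the finitely many cubes, every fibre of `p` over `T` runs through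
  -- the full range of heights inside a single chart.
  have hev : ∀ᶠ ε in 𝓝[>] (0 : ℝ), 0 < ε ∧ ∀ s ∈ t, ε < r s :=
    eventually_mem_nhdsWithin.and ((Finset.eventually_all t).2 fun s _ =>
      (eventually_lt_nhds (hr s)).filter_mono nhdsWithin_le_nhds)
  filter_upwards [hev] with ε ⟨hε, hεr⟩
  have hcover : ∀ x ∈ T, ∃ s ∈ t, x ∈ (e s).source := fun x hx => by
    simpa using ht hx
  set A : Set M := {x | (∃ s ∈ t, x ∈ (e s).source) ∧ p x ∈ T ∧ |f x| ≤ ε} with hA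
  have hAW : A ⊆ W ∩ G := fun x ⟨⟨s, hs, hx⟩, _⟩ => hsub s hx
  have hfiber : ∀ s ∈ t, ∀ x ∈ T, x ∈ (e s).source → ∀ c : ℝ, |c| ≤ ε →
      ((e s x).1, (e s x).2.1, c) ∈ (e s).target ∧ (e s).symm ((e s x).1, (e s x).2.1, c) ∈ A ∧
        p ((e s).symm ((e s x).1, (e s x).2.1, c)) = x ∧
          f ((e s).symm ((e s x).1, (e s x).2.1, c)) = c := by
    intro s hs x hx hxs c hc
    obtain ⟨h1, h2, h3, h4⟩ := (he s).exists_mem_fiber (hT s s.2) hxs (hT x hx)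
      (hc.trans_lt (hεr s hs))
    refine ⟨h1, ⟨⟨s, hs, h2⟩, ?_, ?_⟩, h3, h4⟩
    · rwa [h3]
    · rwa [h4]
  -- For heights beyond `ε` the value of `Φ` is an unused default.
  have hΦex : ∀ q : T × ℝ, ∃ x : M, |q.2| ≤ ε → x ∈ A ∧ p x = q.1 ∧ f x = q.2 := by
    rintro ⟨x, c⟩
    by_cases hc : |c| ≤ ε
    · obtain ⟨s, hs, hxs⟩ := hcover x x.2
      obtain ⟨-, h2, h3, h4⟩ := hfiber s hs x x.2 hxs c hc
      exact ⟨_, fun _ => ⟨h2, h3, h4⟩⟩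
    · exact ⟨x, fun h => absurd h hc⟩
  choose Φ hΦ using hΦex
  -- Although `Φ` is chosen pointwise, injectivity of `(p, f)` on `W` forces it to agree with the
  -- vertical segment of every chart of the cover; this gives its smoothness.
  have hΦeq : ∀ s ∈ t, ∀ q : T × ℝ, (q.1 : M) ∈ (e s).source → |q.2| ≤ ε →
      Φ q = (e s).symm ((e s q.1).1, (e s q.1).2.1, q.2) := by
    intro s hs q hq hc
    obtain ⟨h1, h2, h3⟩ := hΦ q hc
    obtain ⟨-, h4, h5, h6⟩ := hfiber s hs q.1 q.1.2 hq q.2 hc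
    exact hWinj (hAW h1).1 (hAW h4).1 (Prod.ext (h2.trans h5.symm) (h3.trans h6.symm))
  obtain ⟨C, hman, hincl, hbd, hsm⟩ := exists_chartedSpace_surface (p := p) hT fun s hs => by
    obtain ⟨r, -, e, he, -⟩ := hchart s hs univ univ_mem
    exact ⟨r, e, he⟩
  -- smoothness of the parametrization
  have hΦsm : ContMDiffOn ((𝓡∂ 2).prod 𝓘(ℝ, ℝ)) (𝓡 3) 3 Φ (univ ×ˢ Icc (-ε) ε) := by
    rintro ⟨x, c⟩ ⟨-, hc⟩
    have hc' : |c| ≤ ε := abs_le.2 hc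
    obtain ⟨s, hs, hxs⟩ := hcover x x.2
    have h1 : ContMDiffAt ((𝓡∂ 2).prod 𝓘(ℝ, ℝ)) (𝓡 3) 3 (fun q : T × ℝ => (q.1 : M)) (x, c) :=
      ContMDiffAt.comp (g := (Subtype.val : T → M)) (x, c) (hincl x) contMDiffAt_fst
    have h2 : ContMDiffAt (𝓡 3) 𝓘(ℝ, ℝ × ℝ × ℝ) 3 (e s) x :=
      (he s).isC3Chart.contMDiffOn.contMDiffAt ((e s).open_source.mem_nhds hxs)
    have h3 : ContMDiffAt ((𝓡∂ 2).prod 𝓘(ℝ, ℝ)) 𝓘(ℝ, ℝ × ℝ × ℝ) 3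
        (fun q : T × ℝ => e s q.1) (x, c) :=
      ContMDiffAt.comp (g := e s) (f := fun q : T × ℝ => (q.1 : M)) (x, c) h2 h1
    have h4 : ContMDiffAt ((𝓡∂ 2).prod 𝓘(ℝ, ℝ)) 𝓘(ℝ, (ℝ × ℝ × ℝ) × ℝ) 3
        (fun q : T × ℝ => (e s q.1, q.2)) (x, c) := h3.prodMk_space contMDiffAt_snd
    have h5 : ContDiff ℝ 3 (fun z : (ℝ × ℝ × ℝ) × ℝ => (z.1.1, z.1.2.1, z.2)) := by fun_prop
    have h6 : ContMDiffAt ((𝓡∂ 2).prod 𝓘(ℝ, ℝ)) 𝓘(ℝ, ℝ × ℝ × ℝ) 3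
        (fun q : T × ℝ => ((e s q.1).1, (e s q.1).2.1, q.2)) (x, c) :=
      ContMDiffAt.comp (g := fun z : (ℝ × ℝ × ℝ) × ℝ => (z.1.1, z.1.2.1, z.2))
        (f := fun q : T × ℝ => (e s q.1, q.2)) (x, c) (h5.contMDiff.contMDiffAt) h4
    have h7 : ContMDiffAt 𝓘(ℝ, ℝ × ℝ × ℝ) (𝓡 3) 3 (e s).symm ((e s x).1, (e s x).2.1, c) :=
      (he s).isC3Chart.contMDiffOn_symm.contMDiffAt
        ((e s).open_target.mem_nhds (hfiber s hs x x.2 hxs c hc').1)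
    have h8 : ContMDiffAt ((𝓡∂ 2).prod 𝓘(ℝ, ℝ)) (𝓡 3) 3
        (fun q : T × ℝ => (e s).symm ((e s q.1).1, (e s q.1).2.1, q.2)) (x, c) :=
      ContMDiffAt.comp (g := (e s).symm)
        (f := fun q : T × ℝ => ((e s q.1).1, (e s q.1).2.1, q.2)) (x, c) h7 h6
    refine h8.contMDiffWithinAt.congr_of_eventuallyEq ?_ (hΦeq s hs (x, c) hxs hc')
    have h9 : ∀ᶠ q : T × ℝ in 𝓝[univ ×ˢ Icc (-ε) ε] (x, c), (q.1 : M) ∈ (e s).source :=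
      (h1.continuousAt.eventually_mem ((e s).open_source.mem_nhds hxs)).filter_mono
        nhdsWithin_le_nhds
    filter_upwards [h9, eventually_mem_nhdsWithin] with q hq hq'
    exact hΦeq s hs q hq (abs_le.2 hq'.2)
  have hΦp : ∀ x ∈ A, ∀ h : p x ∈ T, Φ (⟨p x, h⟩, f x) = x := by
    intro x hx h
    obtain ⟨h1, h2, h3⟩ := hΦ (⟨p x, h⟩, f x) hx.2.2
    exact hWinj (hAW h1).1 (hAW hx).1 (Prod.ext h2 h3)
  have hTcs : CompactSpace T := isCompact_iff_compactSpace.1 hTc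
  have hAc : IsCompact A := by
    have : A = Φ '' (univ ×ˢ Icc (-ε) ε) := by
      ext x
      constructor
      · intro hx
        exact ⟨(⟨p x, hx.2.1⟩, f x), ⟨mem_univ _, abs_le.1 hx.2.2⟩, hΦp x hx hx.2.1⟩
      · rintro ⟨q, hq, rfl⟩
        exact (hΦ q (abs_le.2 hq.2)).1
    rw [this]
    exact (isCompact_univ.prod isCompact_Icc).image_of_continuousOn hΦsm.continuousOn
  -- In a chart, `A` is a half-space cut to heights at most `ε` in absolute value. It is therefore
  -- the closure of the open set `D` below, which also covers the corners.
  have hloc : ∀ s ∈ t, ∀ x ∈ (e s).source, (x ∈ A ↔ 0 ≤ (e s x).1 ∧ |f x| ≤ ε) := by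
    intro s hs x hx
    have h0 : f (p x) = 0 := by
      rw [← (he s).snd_snd _ ((he s).mapsTo x hx), (he s).apply_proj x hx]
    have h1 := (he s).mem_iff (p x) ((he s).mapsTo x hx) h0
    rw [(he s).apply_proj x hx] at h1
    exact ⟨fun h => ⟨h1.1 h.2.1, h.2.2⟩, fun h => ⟨⟨s, hs, hx⟩, h1.2 h.1, h.2⟩⟩
  have hcl : closure (interior A) = A := by
    refine (closure_minimal interior_subset hAc.isClosed).antisymm fun x hx => ?_
    obtain ⟨s, hs, hxs⟩ := hx.1
    set D : Set (ℝ × ℝ × ℝ) := Ioi 0 ×ˢ univ ×ˢ Ioo (-ε) ε with hD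
    have hDo : IsOpen D := isOpen_Ioi.prod (isOpen_univ.prod isOpen_Ioo)
    have h1 : e s x ∈ closure D := by
      rw [hD, closure_prod_eq, closure_prod_eq, closure_Ioi, closure_univ,
        closure_Ioo (by linarith)]
      have h2 := (hloc s hs x hxs).1 hx
      refine ⟨h2.1, mem_univ _, ?_⟩
      rw [(he s).snd_snd x hxs]
      exact abs_le.1 h2.2
    have h2 : e s x ∈ closure ((e s).target ∩ D) :=
      (e s).open_target.inter_closure ⟨(e s).map_source hxs, h1⟩
    have h3 : x ∈ closure ((e s).symm '' ((e s).target ∩ D)) := by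
      have h4 := ((e s).continuousAt_symm ((e s).map_source hxs)).continuousWithinAt
        (s := (e s).target ∩ D)
      have h5 := h4.mem_closure_image h2
      rwa [(e s).left_inv hxs] at h5
    refine closure_mono (interior_maximal ?_ ?_) h3
    · rintro _ ⟨q, ⟨hq, hqD⟩, rfl⟩
      refine (hloc s hs _ ((e s).map_target hq)).2 ⟨?_, ?_⟩
      · rw [(e s).right_inv hq]
        exact le_of_lt hqD.1
      · rw [← (he s).snd_snd _ ((e s).map_target hq), (e s).right_inv hq]
        exact abs_le.2 (Ioo_subset_Icc_self hqD.2.2)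
    · exact (e s).isOpen_image_symm_of_subset_target ((e s).open_target.inter hDo)
        inter_subset_left
  refine ⟨A, hAc, fun x hx => (hAW hx).2, fun x hx => hx.2, hcl, ?_, ?_⟩
  · intro x hx hxp
    obtain ⟨s, hs, hxs⟩ := hcover x hx
    rw [mem_interior_iff_mem_nhds]
    have h1 : ∀ᶠ y in 𝓝 x, |f y| < ε := by
      refine ((he s).contMDiffAt hxs).continuousAt.abs.eventually_lt continuousAt_const ?_
      rw [hT x hx, abs_zero]
      exact hε
    filter_upwards [h1, hxp, (e s).open_source.mem_nhds hxs] with y hy1 hy2 hy3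
    exact ⟨⟨s, hs, hy3⟩, hy2, hy1.le⟩
  · classical
    obtain ⟨x₀, hx₀⟩ := hTconn.nonempty
    -- The base point `x₀` is a value off the saturation of `T`, never reached on `A`.
    let ϖ : M → T := fun x => if h : p x ∈ T then ⟨p x, h⟩ else ⟨x₀, hx₀⟩
    have hϖ : ∀ x (h : p x ∈ T), ϖ x = ⟨p x, h⟩ := fun x h => dif_pos h
    refine ⟨C, Φ, ϖ, hman, hbd, fun x hx => by rw [hϖ x hx.2.1], ?_⟩
    refine ⟨?_, ?_, ?_, ?_, ?_, hΦsm, ?_, ?_⟩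
    · intro s c hc
      rw [hcl]
      exact (hΦ (s, c) (abs_le.2 hc)).1
    · intro x hx
      rw [hcl] at hx
      exact abs_le.1 hx.2.2
    · intro x hx
      rw [hcl] at hx
      rw [hϖ x hx.2.1]
      exact hΦp x hx hx.2.1
    · intro s c hc
      obtain ⟨h1, h2, h3⟩ := hΦ (s, c) (abs_le.2 hc)
      rw [hϖ _ h1.2.1]
      exact Subtype.ext h2
    · intro s c hc
      exact (hΦ (s, c) (abs_le.2 hc)).2.2
    · rw [hcl]
      intro x hx
      refine hsm ϖ A x (((hp x).contMDiffWithinAt).congr ?_ ?_)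
      · intro y hy
        rw [hϖ y hy.2.1]
      · rw [hϖ x hx.2.1]
    · rw [hcl]
      intro x hx
      obtain ⟨s, hs, hxs⟩ := hx.1
      exact ((he s).contMDiffAt hxs).contMDiffWithinAt

end Foliation

end PreparedTriples

/-! ### Compact surfaces in a regular level and their components -/

namespace PreparedTriples

/-- A compact locally connected subset has finitely many components, which are relatively open. -/
theorem exists_finite_components {M : Type u} [TopologicalSpace M] {S : Set M} (hS : IsCompact S)
    [LocallyConnectedSpace S] :
    ∃ (ι : Type u) (_ : Finite ι) (T : ι → Set M), (∀ i, IsCompact (T i)) ∧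
      (∀ i, IsConnected (T i)) ∧ Pairwise (Function.onFun Disjoint T) ∧ (⋃ i, T i) = S ∧
      ∀ i, ∃ G : Set M, IsOpen G ∧ T i = G ∩ S := by
  have hc : CompactSpace S := isCompact_iff_compactSpace.1 hS
  refine ⟨ConnectedComponents S, inferInstance,
    fun i => Subtype.val '' ((ConnectedComponents.mk : S → ConnectedComponents S) ⁻¹' {i}),
    ?_, ?_, ?_, ?_, ?_⟩
  · intro i
    obtain ⟨x, rfl⟩ := ConnectedComponents.surjective_coe i
    simp only [connectedComponents_preimage_singleton]
    exact isClosed_connectedComponent.isCompact.image continuous_subtype_val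
  · intro i
    obtain ⟨x, rfl⟩ := ConnectedComponents.surjective_coe i
    simp only [connectedComponents_preimage_singleton]
    exact isConnected_connectedComponent.image _ continuous_subtype_val.continuousOn
  · intro i j hij
    refine disjoint_left.2 ?_
    rintro _ ⟨x, hx, rfl⟩ ⟨y, hy, hxy⟩
    have : y = x := Subtype.ext hxy
    subst this
    exact hij (hx.symm.trans hy)
  · ext x
    simp only [mem_iUnion]
    constructor
    · rintro ⟨i, y, -, rfl⟩
      exact y.2
    · intro hx
      exact ⟨_, ⟨x, hx⟩, rfl, rfl⟩
  · intro i
    obtain ⟨x, rfl⟩ := ConnectedComponents.surjective_coe i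
    simp only [connectedComponents_preimage_singleton]
    obtain ⟨G, hG, hGx⟩ := isOpen_induced_iff.1 (isOpen_connectedComponent (x := x))
    refine ⟨G, hG, ?_⟩
    rw [← hGx, Subtype.image_preimage_coe, inter_comm]

section RegularSurface

variable {M : Type u} [EMetricSpace M] [ChartedSpace E3 M] [IsManifold (𝓡 3) ∞ M]
  [SigmaCompactSpace M]

theorem mfderiv_sub_const_apply {φ : M → ℝ} {s : M} (hφ : MDifferentiableAt (𝓡 3) 𝓘(ℝ, ℝ) φ s)
    (c : ℝ) (w : TangentSpace (𝓡 3) s) :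
    (mfderiv (𝓡 3) 𝓘(ℝ, ℝ) (fun y => φ y - c) s w : ℝ) = mfderiv (𝓡 3) 𝓘(ℝ, ℝ) φ s w := by
  have h := hφ.hasMFDerivAt.sub (hasMFDerivAt_const c s)
  have h' := DFunLike.congr_fun h.mfderiv w
  exact h'.trans (sub_zero (mfderiv (𝓡 3) 𝓘(ℝ, ℝ) φ s w : ℝ))

/-- A compact part `K` of the regular level set `f = 0` is contained in the interior of a compact
surface with boundary in this level set. -/
theorem exists_regular_surface {f : M → ℝ} {O K : Set M} (hO : IsOpen O)
    (hf : ContMDiffOn (𝓡 3) 𝓘(ℝ, ℝ) 3 f O)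
    (hf' : ∀ x ∈ O, mfderiv (𝓡 3) 𝓘(ℝ, ℝ) f x ≠ 0) (hK : IsCompact K) (hKO : K ⊆ O)
    (hK0 : ∀ x ∈ K, f x = 0) :
    ∃ (p : M → M) (S V : Set M), ContMDiff (𝓡 3) (𝓡 3) 3 p ∧ IsCompact S ∧
      (∀ x ∈ S, x ∈ O ∧ f x = 0 ∧ p x = x) ∧
      (∀ s ∈ S, ∀ G ∈ 𝓝 s, ∃ r : ℝ, 0 < r ∧ ∃ e, IsSurfaceChart f p S s r e ∧ e.source ⊆ G) ∧
      IsOpen V ∧ K ⊆ V ∧ K ⊆ S ∧ ∀ x ∈ V, p x ∈ S → p ⁻¹' S ∈ 𝓝 (p x) := by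
  have hsc : SecondCountableTopology M := ChartedSpace.secondCountable_of_sigmaCompact E3 M
  have hloc : LocallyCompactSpace M := ChartedSpace.locallyCompactSpace E3 M
  obtain ⟨p, hp, hpO, N, hN, hKN, hpN⟩ := exists_retraction hO hf hf' hK hKO hK0
  obtain ⟨t, ht, hKt, htW⟩ := exists_compact_between hK (hO.inter hN) (subset_inter hKO hKN)
  obtain ⟨F₀, hF1, hF0, -⟩ := exists_contMDiffMap_one_nhds_of_subset_interior (𝓡 3) (n := 3)
    hK.isClosed hKt
  have hF₀ : ContMDiff (𝓡 3) 𝓘(ℝ, ℝ) 3 F₀ := F₀.contMDiff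
  have hFK : ∀ x ∈ K, F₀ x = 1 := fun x hx => hF1.self_of_nhdsSet x hx
  have hFp : ContMDiff (𝓡 3) 𝓘(ℝ, ℝ) 3 (F₀ ∘ p) := hF₀.comp hp
  -- The value is taken regular for `F₀ ∘ p`, a function on all of `M`, so Sard in dimension three
  -- serves for the surface too. Positivity of `a` confines the superlevel set to the compact `t`,
  -- and `a < 1` leaves room around `K`.
  obtain ⟨a, ha, ⟨ha0, ha1⟩⟩ := (interior_eq_empty_iff_dense_compl.1
    (MeasureTheory.Measure.interior_eq_empty_of_null (volume_criticalValues_eq_zero isOpen_univ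
      (hFp.contMDiffOn (s := univ))))).exists_mem_open isOpen_Ioo
        (nonempty_Ioo.2 (zero_lt_one (α := ℝ)))
  have hreg : ∀ x, F₀ (p x) = a → mfderiv (𝓡 3) 𝓘(ℝ, ℝ) (F₀ ∘ p) x ≠ 0 := fun x hx h =>
    ha ⟨x, ⟨mem_univ _, h⟩, hx⟩
  have hmemt : ∀ x, a ≤ F₀ x → x ∈ t := by
    intro x hx
    by_contra h
    rw [hF0 x h] at hx
    linarith
  set S : Set M := {x | x ∈ t ∧ f x = 0 ∧ a ≤ F₀ x} with hS
  have hSprop : ∀ x ∈ S, x ∈ O ∧ f x = 0 ∧ p x = x := fun x hx =>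
    ⟨(htW hx.1).1, hx.2.1, hpO x (htW hx.1).1 hx.2.1⟩
  have hSc : IsCompact S := by
    have h1 : IsCompact (t ∩ f ⁻¹' {0}) := ht.of_isClosed_subset
      ((hf.continuousOn.mono fun x hx => (htW hx).1).preimage_isClosed_of_isClosed ht.isClosed
        isClosed_singleton) inter_subset_left
    have h2 : IsClosed {x | a ≤ F₀ x} := isClosed_le continuous_const hF₀.continuous
    have : S = t ∩ f ⁻¹' {0} ∩ {x | a ≤ F₀ x} := by
      exact Set.ext fun x => ⟨fun h => ⟨⟨h.1, h.2.1⟩, h.2.2⟩, fun h => ⟨h.1.1, h.1.2, h.2⟩⟩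
    rw [this]
    exact h1.inter_right h2
  refine ⟨p, S, {x | a < F₀ (p x)}, hp, hSc, hSprop, ?_,
    isOpen_lt continuous_const hFp.continuous, ?_, ?_, ?_⟩
  · intro s hs G hG
    obtain ⟨hsO, hs0, hps⟩ := hSprop s hs
    have hsN : s ∈ N := (htW hs.1).2
    have hpd : MDifferentiableAt (𝓡 3) (𝓡 3) p s := (hp s).mdifferentiableAt (by norm_num)
    rcases hs.2.2.eq_or_lt with has | has
    -- At a boundary point, `w = dp(v)` is tangent to the level set, as `f ∘ p` vanishes near `s`,
    -- and `F₀` varies along it. So `F₀ - a` can serve as first coordinate of a slice chart, and its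
    -- sign describes the surface.
    · obtain ⟨v, hv⟩ : ∃ v : TangentSpace (𝓡 3) s,
          mfderiv (𝓡 3) 𝓘(ℝ, ℝ) (F₀ ∘ p) s v ≠ 0 := by
        by_contra! h
        exact hreg s (by rw [hps, ← has]) (ContinuousLinearMap.ext h)
      set w : E3 := mfderiv (𝓡 3) (𝓡 3) p s v with hw
      have hfps : MDifferentiableAt (𝓡 3) 𝓘(ℝ, ℝ) f (p s) := by
        rw [hps]
        exact (hf.contMDiffAt (hO.mem_nhds hsO)).mdifferentiableAt (by norm_num)
      have hFps : MDifferentiableAt (𝓡 3) 𝓘(ℝ, ℝ) F₀ (p s) :=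
        (hF₀ (p s)).mdifferentiableAt (by norm_num)
      have h1 : mfderiv (𝓡 3) 𝓘(ℝ, ℝ) f (p s) w = 0 := by
        have h2 : HasMFDerivAt (𝓡 3) 𝓘(ℝ, ℝ) (f ∘ p) s 0 := by
          refine (hasMFDerivAt_const (0 : ℝ) s).congr_of_eventuallyEq ?_
          filter_upwards [hN.mem_nhds hsN] with y hy
          exact (hpN y hy).2
        exact DFunLike.congr_fun
          (hasMFDerivAt_unique (HasMFDerivAt.comp s hfps.hasMFDerivAt hpd.hasMFDerivAt) h2) v
      have h2 : mfderiv (𝓡 3) 𝓘(ℝ, ℝ) F₀ (p s) w ≠ 0 := by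
        intro h
        exact hv ((DFunLike.congr_fun (mfderiv_comp s hFps hpd) v).trans h)
      have h1' : (mfderiv (𝓡 3) 𝓘(ℝ, ℝ) f s (show TangentSpace (𝓡 3) s from w) : ℝ) = 0 :=
        (congrArg (fun y => (mfderiv (𝓡 3) 𝓘(ℝ, ℝ) f y (show TangentSpace (𝓡 3) y from w) : ℝ))
          hps).symm.trans h1
      have h2' : (mfderiv (𝓡 3) 𝓘(ℝ, ℝ) (fun y => F₀ y - a) s
          (show TangentSpace (𝓡 3) s from w) : ℝ) ≠ 0 := by
        intro h
        have h4 := (mfderiv_sub_const_apply ((hF₀ s).mdifferentiableAt (by norm_num)) a w).symm.trans h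
        exact h2 ((congrArg (fun y => (mfderiv (𝓡 3) 𝓘(ℝ, ℝ) F₀ y
          (show TangentSpace (𝓡 3) y from w) : ℝ)) hps).trans h4)
      obtain ⟨r, hr, e, he, hsub, heF⟩ := exists_isSliceChart (φ := fun y => F₀ y - a) hO hN hf hf'
        hp hpO hpN hsO hsN hs0 ((hF₀ s).sub contMDiffAt_const) h1' h2'
        (inter_mem hG (hO.mem_nhds hsO))
      refine ⟨r, hr, e, ⟨he, fun x hx hfx => ?_⟩, fun x hx => (hsub hx).1⟩
      rw [heF x hx, hpO x (hsub hx).2 hfx, sub_nonneg]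
      exact ⟨fun h => h.2.2, fun h => ⟨hmemt x h, hfx, h⟩⟩
    -- At an interior point the first coordinate is shifted to equal `1` at `s`. In a small chart it
    -- stays positive, and the half-plane condition holds throughout.
    · obtain ⟨φ, hφ, w, hfw, hφw⟩ := exists_independent_function (f := f) (s := s)
      have hφ' : ContMDiffAt (𝓡 3) 𝓘(ℝ, ℝ) 3 (fun y => φ y - (φ s - 1)) s :=
        hφ.sub contMDiffAt_const
      have hφw' : mfderiv (𝓡 3) 𝓘(ℝ, ℝ) (fun y => φ y - (φ s - 1)) s w ≠ 0 := fun h =>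
        hφw ((mfderiv_sub_const_apply (hφ.mdifferentiableAt (by norm_num)) (φ s - 1) w).symm.trans h)
      have hpos : ∀ᶠ x in 𝓝 s, 0 < φ (p x) - (φ s - 1) := by
        have h1 : ContinuousAt (fun x => φ (p x) - (φ s - 1)) s := by
          refine ContinuousAt.comp (g := fun y => φ y - (φ s - 1)) ?_ hp.continuous.continuousAt
          rw [hps]
          exact hφ'.continuousAt
        refine h1.eventually_const_lt ?_
        simp only [hps]
        linarith
      have hFs : ∀ᶠ x in 𝓝 s, a < F₀ x := hF₀.continuous.continuousAt.eventually_const_lt has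
      obtain ⟨r, hr, e, he, hsub, heF⟩ := exists_isSliceChart (φ := fun y => φ y - (φ s - 1))
        hO hN hf hf' hp hpO hpN hsO hsN hs0 hφ' hfw hφw' (inter_mem hG (hpos.and hFs))
      refine ⟨r, hr, e, ⟨he, fun x hx hfx => ?_⟩, fun x hx => (hsub hx).1⟩
      obtain ⟨-, h1, h2⟩ := hsub hx
      rw [heF x hx]
      exact ⟨fun _ => h1.le, fun _ => ⟨hmemt x h2.le, hfx, h2.le⟩⟩
  · intro x hx
    show a < F₀ (p x)
    rw [hpO x (hKO hx) (hK0 x hx), hFK x hx]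
    exact ha1
  · intro x hx
    refine ⟨interior_subset (hKt hx), hK0 x hx, ?_⟩
    rw [hFK x hx]
    exact ha1.le
  · intro x hx hxS
    have hpp := (hSprop _ hxS).2.2
    have hpN' : p x ∈ N := (htW hxS.1).2
    have h1 : ∀ᶠ y in 𝓝 (p x), a < F₀ (p y) := by
      refine hFp.continuous.continuousAt.eventually_const_lt ?_
      rw [Function.comp_apply, hpp]
      exact hx
    filter_upwards [h1, hN.mem_nhds hpN'] with y hy hyN
    exact ⟨hmemt _ hy.le, (hpN y hyN).2, hy.le⟩

end RegularSurface

/-! ### Disjoint foliated boxes -/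

section FoliatedNeighbourhoods

variable {M : Type u} [EMetricSpace M] [ChartedSpace E3 M] [IsManifold (𝓡 3) ∞ M]
  [RiemannianBundle (fun x : M => TangentSpace (𝓡 3) x)] [SigmaCompactSpace M]

/-- `A` is a compact set trivially foliated by the level sets of `f`, and the points of `V ∩ A` do
not lie on the boundary of their leaf. -/
structure IsFoliatedBox (f : M → ℝ) (V : Set M) (ε : ℝ) (A : Set M) : Prop where
  isCompact : IsCompact A
  closure_interior : closure (interior A) = A
  exists_foliation : ∃ (S : Type u) (_ : TopologicalSpace S)
    (_ : ChartedSpace (EuclideanHalfSpace 2) S) (Φ : S × ℝ → M) (ϖ : M → S),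
    IsManifold (𝓡∂ 2) 3 S ∧ T2Space S ∧ CompactSpace S ∧ ConnectedSpace S ∧
    IsTrivialFoliation 3 (interior A) f ε Φ ϖ ∧
    ∀ x ∈ A ∩ V, ϖ x ∉ (𝓡∂ 2).boundary S

/-- A compact part of a regular level set is covered by the interiors of finitely many disjoint
foliated boxes. -/
theorem exists_isFoliatedBox {f : M → ℝ} {O K : Set M} (hO : IsOpen O)
    (hf : ContMDiffOn (𝓡 3) 𝓘(ℝ, ℝ) 3 f O)
    (hf' : ∀ x ∈ O, mfderiv (𝓡 3) 𝓘(ℝ, ℝ) f x ≠ 0) (hK : IsCompact K) (hKO : K ⊆ O)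
    (hK0 : ∀ x ∈ K, f x = 0) :
    ∃ (ι : Type u) (_ : Finite ι) (V : Set M), IsOpen V ∧ K ⊆ V ∧
      ∀ᶠ ε in 𝓝[>] (0 : ℝ), ∃ A : ι → Set M, (∀ i, IsFoliatedBox f V ε (A i)) ∧
        (∀ i, A i ⊆ O) ∧ Pairwise (Function.onFun Disjoint A) ∧ K ⊆ ⋃ i, interior (A i) := by
  obtain ⟨p, S, V, hp, hSc, hS, hchart, hV, hKV, hKS, hVp⟩ :=
    exists_regular_surface hO hf hf' hK hKO hK0
  -- The surface charts make `S` locally connected, so its components are relatively open and, by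
  -- compactness, finite in number.
  have hlc : LocallyConnectedSpace S := by
    obtain ⟨C, -⟩ := exists_chartedSpace_surface (f := f) (p := p) (T := S)
      (fun x hx => (hS x hx).2.1) fun s hs => by
        obtain ⟨r, -, e, he, -⟩ := hchart s hs univ univ_mem
        exact ⟨r, e, he⟩
    exact ChartedSpace.locallyConnectedSpace (EuclideanHalfSpace 2) S
  obtain ⟨ι, hι, T, hTc, hTconn, hTd, hTS, hTG⟩ := exists_finite_components hSc
  choose G hG hGT using hTG
  have hTsub : ∀ i, T i ⊆ S := fun i => by rw [hGT i]; exact inter_subset_right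
  have hTp : ∀ i, ∀ s ∈ T i, p ⁻¹' S ∈ 𝓝 s → p ⁻¹' T i ∈ 𝓝 s := by
    intro i s hs h
    have h1 : p ⁻¹' G i ∈ 𝓝 s := hp.continuous.continuousAt.preimage_mem_nhds ((hG i).mem_nhds (by
      rw [(hS s (hTsub i hs)).2.2]
      rw [hGT i] at hs
      exact hs.1))
    filter_upwards [h, h1] with y hy hy'
    rw [mem_preimage, hGT i]
    exact ⟨hy', hy⟩
  have hfol := fun i => exists_isTrivialFoliation (f := f) (G := O) hp (hTc i) (hTconn i)
    (fun x hx => (hS x (hTsub i hx)).2.1) (fun x hx => (hS x (hTsub i hx)).2.2)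
    -- A chart of `S` contained in the open set `G i` is a chart of the component `G i ∩ S`.
    (fun s hs H hH => by
      have hsG : s ∈ G i := by
        rw [hGT i] at hs
        exact hs.1
      obtain ⟨r, hr, e, he, hsub⟩ := hchart s (hTsub i hs) (H ∩ G i)
        (inter_mem hH ((hG i).mem_nhds hsG))
      refine ⟨r, hr, e, ⟨he.toIsSliceChart, fun x hx hfx => ?_⟩, fun x hx => (hsub hx).1⟩
      rw [← he.mem_iff x hx hfx, hGT i]
      exact ⟨fun h => h.2, fun h => ⟨(hsub hx).2, h⟩⟩)
    (hO.mem_nhdsSet.2 fun x hx => (hS x (hTsub i hx)).1)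
  refine ⟨ι, hι, V, hV, hKV, ?_⟩
  filter_upwards [eventually_all.2 hfol] with ε hε
  choose A hAc hAO hAp hAcl hAint C Φ ϖ hman hbd hϖ hfoliation using hε
  refine ⟨A, fun i => ⟨hAc i, hAcl i, T i, inferInstance, C i, Φ i, ϖ i,
    hman i, inferInstance, isCompact_iff_compactSpace.1 (hTc i),
    isConnected_iff_connectedSpace.1 (hTconn i), hfoliation i, ?_⟩, hAO, ?_, ?_⟩
  · rintro x ⟨hx, hxV⟩ hb
    refine hbd i _ hb ?_
    rw [hϖ i x hx]
    have h1 := (hAp i x hx).1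
    exact hTp i _ h1 (hVp x hxV (hTsub i h1))
  · intro i j hij
    refine disjoint_left.2 fun x hx hx' => ?_
    exact disjoint_left.1 (hTd hij) (hAp i x hx).1 (hAp j x hx').1
  · intro x hx
    have hxS := hKS hx
    obtain ⟨i, hi⟩ := mem_iUnion.1 (hTS.symm.subset hxS)
    refine mem_iUnion.2 ⟨i, hAint i x hi (hTp i x hi ?_)⟩
    have h1 := hVp x (hKV hx)
    rw [(hS x hxS).2.2] at h1
    exact h1 hxS

end FoliatedNeighbourhoods

end PreparedTriples

namespace PreparedTriples

/-! ### Locality of the index at a point -/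

section IndexLocality

variable {M : Type u} [TopologicalSpace M] [ChartedSpace E3 M]
  {X Z : ∀ x : M, TangentSpace (𝓡 3) x}

theorem HasIndexAt.congr {x : M} {n : ℤ} (h : ∀ᶠ y in 𝓝 x, X y = Z y) (hX : HasIndexAt X x n) :
    HasIndexAt Z x n := by
  have h1 : ∀ᶠ y in 𝓝 (extChartAt (𝓡 3) x x), X ((extChartAt (𝓡 3) x).symm y) =
      Z ((extChartAt (𝓡 3) x).symm y) := by
    have h2 := (continuousAt_extChartAt_symm (I := 𝓡 3) x).tendsto
    rw [extChartAt_to_inv] at h2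
    exact h2.eventually h
  obtain ⟨r, hr, hball⟩ := Metric.eventually_nhds_iff.1 h1
  have h3 : ∀ᶠ ρ in 𝓝[>] (0 : ℝ), 0 < ρ ∧ ρ < r :=
    eventually_mem_nhdsWithin.and ((eventually_lt_nhds hr).filter_mono nhdsWithin_le_nhds)
  filter_upwards [hX, h3] with ρ ⟨g, hg, hgn⟩ ⟨hρ, hρr⟩
  refine ⟨g, fun u => ?_, hgn⟩
  have hu : ‖(u : E3)‖ = 1 := by simp
  have h4 : X ((extChartAt (𝓡 3) x).symm (extChartAt (𝓡 3) x x + ρ • (u : E3))) =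
      Z ((extChartAt (𝓡 3) x).symm (extChartAt (𝓡 3) x x + ρ • (u : E3))) := by
    refine hball ?_
    rw [dist_eq_norm, add_sub_cancel_left, norm_smul, hu, mul_one, Real.norm_eq_abs, abs_of_pos hρ]
    exact hρr
  have h5 : chartExpression X x (extChartAt (𝓡 3) x x + ρ • (u : E3)) =
      chartExpression Z x (extChartAt (𝓡 3) x x + ρ • (u : E3)) := by
    unfold chartExpression
    rw [h4]
  rw [← h5]
  exact hg u

/-- The index of a zero depends only on the germ of the vector field. -/
theorem indexAt_congr {x : M} (h : ∀ᶠ y in 𝓝 x, X y = Z y) : indexAt X x = indexAt Z x := by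
  have h1 : HasIndexAt X x = HasIndexAt Z x := by
    funext n
    exact propext ⟨fun h' => h'.congr h, fun h' => h'.congr (h.mono fun y hy => hy.symm)⟩
  classical
  have h2 : ∀ P Q : ℤ → Prop, P = Q → (if h : ∃ n, P n then h.choose else (0 : ℤ)) =
      if h : ∃ n, Q n then h.choose else 0 := by
    rintro P _ rfl
    rfl
  convert! h2 _ _ h1

end IndexLocality

/-! ### Distribution of the index over disjoint compact sets -/

section IndexAdditivity

variable {M : Type u} [EMetricSpace M] [ChartedSpace E3 M] [IsManifold (𝓡 3) ∞ M]
  [RiemannianBundle (fun x : M => TangentSpace (𝓡 3) x)]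
  [IsContMDiffRiemannianBundle (𝓡 3) ∞ E3 (fun x : M => TangentSpace (𝓡 3) x)]
  {X : ∀ x : M, TangentSpace (𝓡 3) x} {U : Set M}

theorem continuous_add_sum_smul_sub {ι : Type*} [Fintype ι]
    (hX : Continuous (fun x => (⟨x, X x⟩ : TangentBundle (𝓡 3) M)))
    {χ : ι → M → ℝ} (hχ : ∀ i, Continuous (χ i)) {Z : ι → ∀ x : M, TangentSpace (𝓡 3) x}
    (hZ : ∀ i, Continuous (fun x => (⟨x, Z i x⟩ : TangentBundle (𝓡 3) M))) :
    Continuous (fun x =>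
      (⟨x, X x + ∑ i, χ i x • (Z i x - X x)⟩ : TangentBundle (𝓡 3) M)) := by
  have h1 : IsManifold (𝓡 3) (0 + 1) M := IsManifold.of_le (n := ∞) (by
    rw [zero_add]; exact ENat.LEInfty.out)
  have h2 : IsManifold (𝓡 3) 1 M := IsManifold.of_le (n := ∞) ENat.LEInfty.out
  have hX' : ContMDiff (𝓡 3) (𝓡 3).tangent 0 (fun x => (⟨x, X x⟩ : TangentBundle (𝓡 3) M)) :=
    contMDiff_zero_iff.2 hX
  have hZ' : ∀ i, ContMDiff (𝓡 3) (𝓡 3).tangent 0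
      (fun x => (⟨x, Z i x⟩ : TangentBundle (𝓡 3) M)) := fun i => contMDiff_zero_iff.2 (hZ i)
  have hχ' : ∀ i, ContMDiff (𝓡 3) 𝓘(ℝ, ℝ) 0 (χ i) := fun i => contMDiff_zero_iff.2 (hχ i)
  have hsum : ContMDiff (𝓡 3) (𝓡 3).tangent 0
      (fun x => (⟨x, ∑ i, χ i x • (Z i x - X x)⟩ : TangentBundle (𝓡 3) M)) :=
    ContMDiff.sum_section (t := fun i x => χ i x • (Z i x - X x)) fun i _ =>
      (hχ' i).smul_section ((hZ' i).sub_section hX')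
  exact (hX'.add_section hsum).continuous

/-- Approximations of `X` on disjoint compact sets whose interiors contain all zeros of `X` in `U`
can be glued to an approximation of `X`, and the index sums add up. -/
theorem exists_glued_vectorField [SigmaCompactSpace M] {ι : Type*} [Fintype ι] {A : ι → Set M}
    (hX : Continuous (fun x => (⟨x, X x⟩ : TangentBundle (𝓡 3) M)))
    (hA : ∀ i, IsCompact (A i)) (hAd : Pairwise (Function.onFun Disjoint A)) (hAU : ∀ i, A i ⊆ U)
    (hK : ∀ x ∈ U, X x = 0 → ∃ i, x ∈ interior (A i)) :
    ∃ δ₁ : ℝ, 0 < δ₁ ∧ ∀ δ : ℝ, 0 < δ → δ ≤ δ₁ → ∀ Z : ι → ∀ x : M, TangentSpace (𝓡 3) x,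
      (∀ i, Continuous (fun x => (⟨x, Z i x⟩ : TangentBundle (𝓡 3) M))) →
      (∀ i, ∀ x ∈ A i, ‖Z i x - X x‖ < δ) →
      (∀ i, (zeroSet (Z i) ∩ interior (A i)).Finite) →
      ∃ X' : ∀ x : M, TangentSpace (𝓡 3) x,
        Continuous (fun x => (⟨x, X' x⟩ : TangentBundle (𝓡 3) M)) ∧
        (∀ x, ‖X' x - X x‖ < δ) ∧ (zeroSet X' ∩ U).Finite ∧
        ∑ᶠ x ∈ zeroSet X' ∩ U, indexAt X' x =
          ∑ i, ∑ᶠ x ∈ zeroSet (Z i) ∩ interior (A i), indexAt (Z i) x := by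
  have hKA : ∀ i, IsCompact (A i ∩ zeroSet X) := fun i => (hA i).inter_right (isClosed_zeroSet hX)
  have hKint : ∀ i, A i ∩ zeroSet X ⊆ interior (A i) := by
    rintro i x ⟨hx, h0⟩
    obtain ⟨j, hj⟩ := hK x (hAU i hx) h0
    by_cases hij : i = j
    · rwa [hij]
    · exact (disjoint_left.1 (hAd hij) hx (interior_subset hj)).elim
  -- The cutoff is supported in the interior of `A i` and equals `1` near the zeros of `X`, so the
  -- glued field is `X` outside the interiors and `Z i` near the zeros.
  have hcut : ∀ i, ∃ χ : M → ℝ, Continuous χ ∧ (∀ᶠ x in 𝓝ˢ (A i ∩ zeroSet X), χ x = 1) ∧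
      (∀ x ∉ interior (A i), χ x = 0) ∧ ∀ x, χ x ∈ Icc (0 : ℝ) 1 := by
    intro i
    obtain ⟨χ, h1, h2, h3⟩ := exists_contMDiffMap_one_nhds_of_subset_interior (𝓡 3) (n := 0)
      (hKA i).isClosed (by rw [interior_interior]; exact hKint i)
    exact ⟨χ, χ.contMDiff.continuous, h1, h2, h3⟩
  choose χ hχc hχ1 hχ0 hχI using hcut
  set L : ι → Set M := fun i => interior {x | χ i x = 1} with hL
  have hKL : ∀ i, A i ∩ zeroSet X ⊆ L i := fun i => subset_interior_iff_mem_nhdsSet.2 (hχ1 i)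
  -- Where the cutoff may differ from `1` on `A i`, `‖X‖` is bounded below. For `δ` under this bound
  -- neither `Z i` nor the glued field can vanish there, so both have the same zeros and germs.
  have hδex : ∀ i, ∃ m : ℝ, 0 < m ∧ ∀ x ∈ A i \ L i, m ≤ ‖X x‖ := fun i =>
    exists_le_norm_of_isCompact ((hA i).diff isOpen_interior) hX fun x hx h0 =>
      hx.2 (hKL i ⟨hx.1, h0⟩)
  choose m hm hmX using hδex
  obtain ⟨δ₁, hδ₁, hδm⟩ : ∃ δ₁ : ℝ, 0 < δ₁ ∧ ∀ i, δ₁ ≤ m i := by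
    have hev : ∀ᶠ δ in 𝓝[>] (0 : ℝ), 0 < δ ∧ ∀ i, δ < m i :=
      eventually_mem_nhdsWithin.and (eventually_all.2 fun i =>
        (eventually_lt_nhds (hm i)).filter_mono nhdsWithin_le_nhds)
    obtain ⟨δ, h1, h2⟩ := hev.exists
    exact ⟨δ, h1, fun i => (h2 i).le⟩
  refine ⟨δ₁, hδ₁, fun δ hδ hδle Z hZ hZX hZfin => ?_⟩
  set X' : ∀ x : M, TangentSpace (𝓡 3) x := fun x => X x + ∑ i, χ i x • (Z i x - X x) with hX'
  have hin : ∀ i, ∀ x ∈ A i, X' x = X x + χ i x • (Z i x - X x) := by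
    intro i x hx
    simp only [hX']
    rw [Fintype.sum_eq_single i]
    intro j hj
    rw [hχ0 j x fun h => disjoint_left.1 (hAd hj) (interior_subset h) hx, zero_smul]
  have hout : ∀ x, (∀ i, x ∉ interior (A i)) → X' x = X x := by
    intro x hx
    simp only [hX']
    rw [Finset.sum_eq_zero, add_zero]
    intro i _
    rw [hχ0 i x (hx i), zero_smul]
  have hsmul : ∀ i, ∀ x ∈ A i, ‖χ i x • (Z i x - X x)‖ < δ := by
    intro i x hx
    rw [norm_smul, Real.norm_eq_abs, abs_of_nonneg (hχI i x).1]
    exact (mul_le_of_le_one_left (norm_nonneg _) (hχI i x).2).trans_lt (hZX i x hx)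
  have hX'X : ∀ x, ‖X' x - X x‖ < δ := by
    intro x
    by_cases hx : ∃ i, x ∈ interior (A i)
    · obtain ⟨i, hi⟩ := hx
      rw [hin i x (interior_subset hi), add_sub_cancel_left]
      exact hsmul i x (interior_subset hi)
    · push Not at hx
      rw [hout x hx, sub_self, norm_zero]
      exact hδ
  have hXL : ∀ i, ∀ x ∈ L i ∩ interior (A i), ∀ᶠ y in 𝓝 x, X' y = Z i y := by
    intro i x hx
    filter_upwards [isOpen_interior.mem_nhds hx.1, isOpen_interior.mem_nhds hx.2] with y hy hy'
    rw [hin i y (interior_subset hy'), show χ i y = 1 from interior_subset (s := {x | χ i x = 1}) hy,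
      one_smul]
    abel
  have hne : ∀ i, ∀ x ∈ A i \ L i, ∀ v : TangentSpace (𝓡 3) x, ‖v - X x‖ < δ → v ≠ 0 := by
    intro i x hx v hv h0
    rw [h0, zero_sub, norm_neg] at hv
    linarith [hmX i x hx, hδm i]
  have hzero : zeroSet X' ∩ U = ⋃ i, zeroSet (Z i) ∩ interior (A i) := by
    ext x
    simp only [mem_iUnion]
    constructor
    · rintro ⟨h0, hxU⟩
      have hx : ∃ i, x ∈ interior (A i) := by
        by_contra! h
        have h0' : X' x = 0 := h0
        rw [hout x h] at h0'
        obtain ⟨i, hi⟩ := hK x hxU h0'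
        exact h i hi
      obtain ⟨i, hi⟩ := hx
      have hxL : x ∈ L i := by
        by_contra h
        exact hne i x ⟨interior_subset hi, h⟩ (X' x) (hX'X x) h0
      exact ⟨i, ((hXL i x ⟨hxL, hi⟩).self_of_nhds.symm.trans h0 : Z i x = 0), hi⟩
    · rintro ⟨i, h0, hi⟩
      have hxL : x ∈ L i := by
        by_contra h
        exact hne i x ⟨interior_subset hi, h⟩ (Z i x) (hZX i x (interior_subset hi)) h0
      exact ⟨((hXL i x ⟨hxL, hi⟩).self_of_nhds.trans h0 : X' x = 0), hAU i (interior_subset hi)⟩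
  refine ⟨X', continuous_add_sum_smul_sub hX hχc hZ, hX'X, ?_, ?_⟩
  · rw [hzero]
    exact finite_iUnion hZfin
  · rw [hzero, finsum_mem_iUnion _ hZfin, finsum_eq_sum_of_fintype]
    · refine Finset.sum_congr rfl fun i _ => finsum_mem_congr rfl fun x hx => ?_
      have hxL : x ∈ L i := by
        by_contra h
        exact hne i x ⟨interior_subset hx.2, h⟩ (Z i x) (hZX i x (interior_subset hx.2)) hx.1
      exact indexAt_congr (hXL i x ⟨hxL, hx.2⟩)
    · intro i j hij
      exact (hAd hij).mono (inter_subset_right.trans interior_subset)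
        (inter_subset_right.trans interior_subset)

/-- If `X` has nonzero index in `U`, it has nonzero index in the interior of one of finitely many
disjoint compact sets whose interiors contain all zeros of `X` in `U`. -/
theorem HasIndex.exists_ne_zero [SigmaCompactSpace M] {ι : Type*} [Finite ι] {A : ι → Set M} {n : ℤ}
    (h : HasIndex X U n) (hn : n ≠ 0)
    (hX : Continuous (fun x => (⟨x, X x⟩ : TangentBundle (𝓡 3) M)))
    (hA : ∀ i, IsCompact (A i)) (hAd : Pairwise (Function.onFun Disjoint A)) (hAU : ∀ i, A i ⊆ U)
    (hAcl : ∀ i, closure (interior (A i)) = A i)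
    (hK : ∀ x ∈ U, X x = 0 → ∃ i, x ∈ interior (A i)) :
    ∃ i, ∃ m : ℤ, m ≠ 0 ∧ HasIndex X (interior (A i)) m := by
  classical
  cases nonempty_fintype ι
  obtain ⟨δ₀, hδ₀, H⟩ := h
  obtain ⟨δ₁, hδ₁, hglue⟩ := exists_glued_vectorField hX hA hAd hAU hK
  by_contra! hno
  set δ := min δ₀ δ₁ with hδdef
  have hδ : 0 < δ := lt_min hδ₀ hδ₁
  have key : ∀ Z : ι → ∀ x : M, TangentSpace (𝓡 3) x,
      (∀ i, Continuous (fun x => (⟨x, Z i x⟩ : TangentBundle (𝓡 3) M))) →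
      (∀ i, ∀ x ∈ A i, ‖Z i x - X x‖ < δ) →
      (∀ i, (zeroSet (Z i) ∩ interior (A i)).Finite) →
      ∑ i, ∑ᶠ x ∈ zeroSet (Z i) ∩ interior (A i), indexAt (Z i) x = n := by
    intro Z hZ hZX hZfin
    obtain ⟨X', h1, h2, h3, h4⟩ := hglue δ hδ (min_le_right _ _) Z hZ hZX hZfin
    rw [← h4]
    exact H X' h1 (fun x _ => (h2 x).trans_le (min_le_left _ _)) h3
  -- otherwise the index is vacuously defined
  have hex : ∀ i, ∃ Z : ∀ x : M, TangentSpace (𝓡 3) x,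
      Continuous (fun x => (⟨x, Z x⟩ : TangentBundle (𝓡 3) M)) ∧
      (∀ x ∈ A i, ‖Z x - X x‖ < δ) ∧ (zeroSet Z ∩ interior (A i)).Finite := by
    intro i
    by_contra! hcon
    refine hno i 1 one_ne_zero ⟨δ, hδ, fun Z hZ hZX hZfin => ?_⟩
    rw [hAcl i] at hZX
    exact (hcon Z hZ hZX hZfin).elim
  choose Z hZ hZX hZfin using hex
  -- The total is always `n`, so replacing only the `i`-th approximation cannot change the `i`-th
  -- sum. That sum is thus an index of `X` on the interior of `A i`, and must vanish by assumption.
  -- Hence `n = 0`, without any appeal to the general theory of the index.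
  have hzero : ∀ i, ∑ᶠ x ∈ zeroSet (Z i) ∩ interior (A i), indexAt (Z i) x = 0 := by
    intro i
    by_contra hi
    refine hno i _ hi ⟨δ, hδ, fun Z' hZ' hZX' hZfin' => ?_⟩
    rw [hAcl i] at hZX'
    have h1 := key Z hZ hZX hZfin
    have h2 := key (Function.update Z i Z')
      (fun j => by
        by_cases hj : j = i
        · subst hj; simpa using hZ'
        · simpa [Function.update_of_ne hj] using hZ j)
      (fun j => by
        by_cases hj : j = i
        · subst hj; simpa using hZX'
        · simpa [Function.update_of_ne hj] using hZX j)
      (fun j => by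
        by_cases hj : j = i
        · subst hj; simpa using hZfin'
        · simpa [Function.update_of_ne hj] using hZfin j)
    rw [← Finset.add_sum_erase _ _ (Finset.mem_univ i)] at h1 h2
    have h3 : ∑ j ∈ Finset.univ.erase i,
        ∑ᶠ x ∈ zeroSet (Function.update Z i Z' j) ∩ interior (A j),
          indexAt (Function.update Z i Z' j) x =
        ∑ j ∈ Finset.univ.erase i, ∑ᶠ x ∈ zeroSet (Z j) ∩ interior (A j), indexAt (Z j) x := by
      refine Finset.sum_congr rfl fun j hj => ?_
      rw [Function.update_of_ne (Finset.ne_of_mem_erase hj)]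
    rw [h3, Function.update_self] at h2
    linarith
  refine hn ?_
  rw [← key Z hZ hZX hZfin]
  exact Finset.sum_eq_zero fun i _ => hzero i

end IndexAdditivity

end PreparedTriples

namespace PreparedTriples

/-! ### Assembly of the prepared counterexample -/

section Prepared

variable {M : Type u} [EMetricSpace M] [ChartedSpace E3 M] [IsManifold (𝓡 3) ∞ M]
  [RiemannianBundle (fun x : M => TangentSpace (𝓡 3) x)]
  [IsContMDiffRiemannianBundle (𝓡 3) ∞ E3 (fun x : M => TangentSpace (𝓡 3) x)]
  {X Y : ∀ x : M, TangentSpace (𝓡 3) x} {U : Set M}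

theorem mem_levelZeros {c : ℝ} {x : M} :
    x ∈ levelZeros U X Y c ↔ X x - c • Y x = 0 ∧ x ∈ closure U := Iff.rfl

/-- If the zeros of `X` in `closure U` lie in `U` and persist as zeros of `X - cY` nearby, then
`c ↦ levelZeros U X Y c` is continuous at `0` for the Hausdorff distance. -/
theorem tendsto_hausdorffEDist_levelZeros
    (hX : Continuous (fun x => (⟨x, X x⟩ : TangentBundle (𝓡 3) M)))
    (hY : Continuous (fun x => (⟨x, Y x⟩ : TangentBundle (𝓡 3) M)))
    (hU : IsOpen U) (hUc : IsCompact (closure U)) (hfr : ∀ x ∈ closure U, X x = 0 → x ∈ U)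
    (hlsc : ∀ x ∈ U, X x = 0 → ∀ V ∈ 𝓝 x, ∀ᶠ c in 𝓝 (0 : ℝ), ∃ y ∈ V, X y - c • Y y = 0) :
    Tendsto (fun c : ℝ => Metric.hausdorffEDist (levelZeros U X Y c) (levelZeros U X Y 0))
      (𝓝 0) (𝓝 0) := by
  have hmem0 : ∀ x, x ∈ levelZeros U X Y 0 ↔ X x = 0 ∧ x ∈ closure U := fun x => by
    rw [mem_levelZeros, zero_smul, sub_zero]
  have hc0 : IsCompact (levelZeros U X Y 0) := by
    have : levelZeros U X Y 0 = closure U ∩ zeroSet X := by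
      ext x
      rw [hmem0]
      exact and_comm
    rw [this]
    exact hUc.inter_right (isClosed_zeroSet hX)
  rw [ENNReal.tendsto_nhds_zero]
  intro δ hδ
  have hδ2 : 0 < δ / 2 := ENNReal.half_pos hδ.ne'
  -- upper semicontinuity
  set N : Set M := ⋃ y ∈ levelZeros U X Y 0, Metric.eball y δ with hN
  have hNo : IsOpen N := isOpen_biUnion fun y _ => Metric.isOpen_eball
  have hup : ∀ᶠ c in 𝓝 (0 : ℝ), ∀ x ∈ closure U \ N, X x - c • Y x ≠ 0 :=
    eventually_sub_smul_ne_zero (hUc.diff hNo) hX hY fun x hx h0 =>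
      hx.2 (mem_biUnion ((hmem0 x).2 ⟨h0, hx.1⟩) (Metric.mem_eball_self hδ))
  -- lower semicontinuity
  obtain ⟨t, ht, htc⟩ := hc0.elim_nhds_subcover (fun x => Metric.eball x (δ / 2))
    fun x _ => Metric.eball_mem_nhds x hδ2
  have hlow : ∀ᶠ c in 𝓝 (0 : ℝ), ∀ x ∈ t, ∃ y ∈ Metric.eball x (δ / 2) ∩ U, X y - c • Y y = 0 := by
    refine (Finset.eventually_all t).2 fun x hx => ?_
    obtain ⟨h0, hxU⟩ := (hmem0 x).1 (ht x hx)
    have hxU' := hfr x hxU h0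
    exact hlsc x hxU' h0 _ (inter_mem (Metric.eball_mem_nhds x hδ2) (hU.mem_nhds hxU'))
  filter_upwards [hup, hlow] with c hc1 hc2
  refine Metric.hausdorffEDist_le_of_mem_edist ?_ ?_
  · intro x hx
    have hxN : x ∈ N := by
      by_contra h
      exact hc1 x ⟨hx.2, h⟩ hx.1
    simp only [hN, mem_iUnion] at hxN
    obtain ⟨y, hy, hxy⟩ := hxN
    exact ⟨y, hy, (Metric.mem_eball.1 hxy).le⟩
  · intro x hx
    obtain ⟨z, hz, hxz⟩ := mem_iUnion₂.1 (htc hx)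
    obtain ⟨y, ⟨hyz, hyU⟩, hy⟩ := hc2 z hz
    refine ⟨y, ⟨hy, subset_closure hyU⟩, ?_⟩
    calc edist x y ≤ edist x z + edist z y := edist_triangle _ _ _
      _ ≤ δ / 2 + δ / 2 := by
        refine add_le_add (Metric.mem_eball.1 hxz).le ?_
        rw [edist_comm]
        exact (Metric.mem_eball.1 hyz).le
      _ = δ := ENNReal.add_halves δ

/-- The coefficient of collinearity is merely shifted by `c₀`, and the union over all coefficients
forgets the shift. -/
theorem collinearityLocus_sub_smul {U' : Set M} (hU' : U' ⊆ U) (c₀ : ℝ) :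
    collinearityLocus U' (fun x => X x - c₀ • Y x) Y =
      collinearityLocus U X Y ∩ closure U' := by
  ext x
  simp only [collinearityLocus, mem_iUnion, mem_inter_iff, mem_levelZeros]
  constructor
  · rintro ⟨c, h, hx⟩
    rw [sub_smul_sub_smul] at h
    exact ⟨⟨c₀ + c, h, closure_mono hU' hx⟩, hx⟩
  · rintro ⟨⟨c, h, -⟩, hx⟩
    refine ⟨c - c₀, ?_, hx⟩
    rw [sub_smul_sub_smul, add_sub_cancel]
    exact h

theorem IsTriple.of_subset {r : ℕ∞ω} (h : IsTriple r U X Y) {U' : Set M} (hU' : U' ⊆ U)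
    (hU'o : IsOpen U') (hfr : zeroSet X ∩ frontier U' = ∅) : IsTriple r U' X Y where
  isOpen := hU'o
  isCompact_closure := h.isCompact_closure.of_isClosed_subset isClosed_closure (closure_mono hU')
  contMDiff_left := h.contMDiff_left
  contMDiff_right := h.contMDiff_right
  complete_left := h.complete_left
  complete_right := h.complete_right
  commute := h.commute
  zeroSet_right := subset_eq_empty (inter_subset_inter_right _ hU') h.zeroSet_right
  zeroSet_left := hfr

/-- The generic case. The zeros form a compact part of a regular level, which finitely many foliated
boxes cover, and a box with nonzero index is selected. The hypothesis of persistence enters only in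
the continuity of `c ↦ K_c`. -/
theorem IsCounterexample.exists_prepared [SigmaCompactSpace M] (h : IsCounterexample 3 U X Y)
    (hreg : ∀ x ∈ U, X x = 0 → mfderiv (𝓡 3) 𝓘(ℝ, ℝ) (quotientFunction X Y) x ≠ 0)
    (hlsc : ∀ x ∈ U, X x = 0 → ∀ V ∈ 𝓝 x, ∀ᶠ c in 𝓝 (0 : ℝ), ∃ y ∈ V, X y - c • Y y = 0) :
    ∃ U' ⊆ U, IsPreparedCounterexample 3 U' X Y := by
  obtain ⟨hT, n, hn, hind⟩ := h
  have hXc := hT.contMDiff_left.continuous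
  have hYc := hT.contMDiff_right.continuous
  set f := quotientFunction X Y with hfdef
  have hfU : ContMDiffOn (𝓡 3) 𝓘(ℝ, ℝ) 3 f U :=
    (contMDiffOn_quotientFunction hT.contMDiff_left hT.contMDiff_right).mono
      fun x hx => hT.ne_zero hx
  have hzeroU : ∀ x ∈ closure U, X x = 0 → x ∈ U := by
    intro x hx h0
    by_contra hxU
    exact (hT.zeroSet_left.subset ⟨h0, hx, fun h => hxU (interior_subset h)⟩ : x ∈ (∅ : Set M))
  set K : Set M := closure U ∩ zeroSet X with hKdef
  have hK : IsCompact K := hT.isCompact_closure.inter_right (isClosed_zeroSet hXc)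
  have hX0 : ∀ x, X x = 0 → X x = (0 : ℝ) • Y x := fun x hx => by rw [hx, zero_smul]
  -- Boxes are to be built inside `O`, where `μ` is regular and `Y` is not orthogonal to its levels.
  -- This open set contains the zeros, since `Y` is tangent to the level there.
  set B : Set M := {x | ∃ v : TangentSpace (𝓡 3) x,
    mfderiv (𝓡 3) 𝓘(ℝ, ℝ) f x v = 0 ∧ inner ℝ (Y x) v ≠ 0} with hB
  set O : Set M := {x ∈ U | mfderiv (𝓡 3) 𝓘(ℝ, ℝ) f x ≠ 0} ∩ interior B with hO
  have hOo : IsOpen O := (isOpen_mfderiv_ne_zero hT.isOpen hfU).inter isOpen_interior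
  have hOU : O ⊆ U := fun x hx => hx.1.1
  have hKO : K ⊆ O := by
    rintro x ⟨hx, h0⟩
    have hxU := hzeroU x hx h0
    refine ⟨⟨hxU, hreg x hxU h0⟩, mem_interior_iff_mem_nhds.2 ?_⟩
    exact eventually_exists_inner_ne_zero hT.contMDiff_right
      (hfU.contMDiffAt (hT.isOpen.mem_nhds hxU)) (hreg x hxU h0) (hT.ne_zero hxU)
      (mfderiv_quotientFunction_apply hT.contMDiff_left hT.contMDiff_right hT.commute
        hT.complete_right (hT.ne_zero hxU) (hX0 x h0))
  have hK0 : ∀ x ∈ K, f x = 0 := fun x hx =>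
    quotientFunction_eq (hT.ne_zero (hOU (hKO hx))) (hX0 x hx.2)
  obtain ⟨ι, hι, V, hV, hKV, hbox⟩ := exists_isFoliatedBox hOo (hfU.mono hOU)
    (fun x hx => hx.1.2) hK hKO hK0
  -- For `|c| < η` all zeros of `X - cY` in the closure of `U` lie in `V`, where points of a box are
  -- not over the boundary of the surface. The height `ε` is then taken below `η`.
  have hev := eventually_sub_smul_ne_zero (hT.isCompact_closure.diff hV) hXc hYc
    fun x hx h0 => hx.2 (hKV ⟨hx.1, h0⟩)
  obtain ⟨η, hη, hball⟩ := Metric.eventually_nhds_iff.1 hev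
  have hε : ∀ᶠ ε in 𝓝[>] (0 : ℝ), 0 < ε ∧ ε < η :=
    eventually_mem_nhdsWithin.and ((eventually_lt_nhds hη).filter_mono nhdsWithin_le_nhds)
  obtain ⟨ε, ⟨A, hA, hAO, hAd, hAK⟩, hε0, hεη⟩ := (hbox.and hε).exists
  have hAU : ∀ i, A i ⊆ U := fun i => (hAO i).trans hOU
  have hKA : ∀ x ∈ U, X x = 0 → ∃ i, x ∈ interior (A i) := fun x hx h0 =>
    mem_iUnion.1 (hAK ⟨subset_closure hx, h0⟩)
  obtain ⟨i, m, hm, him⟩ := hind.exists_ne_zero hn hXc (fun i => (hA i).isCompact) hAd hAU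
    (fun i => (hA i).closure_interior) hKA
  -- A zero in `A i` is interior to some box, and disjointness leaves only `A i` itself; so the
  -- frontier of the selected box carries no zero.
  have hzeroA : ∀ x ∈ A i, X x = 0 → x ∈ interior (A i) := by
    intro x hx h0
    obtain ⟨j, hj⟩ := hKA x (hAU i hx) h0
    by_cases hij : i = j
    · rwa [hij]
    · exact (disjoint_left.1 (hAd hij) hx (interior_subset hj)).elim
  have hcl := (hA i).closure_interior
  have hTi : IsTriple 3 (interior (A i)) X Y := by
    refine hT.of_subset (interior_subset.trans (hAU i)) isOpen_interior ?_
    ext x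
    simp only [mem_inter_iff, mem_empty_iff_false, iff_false, not_and]
    intro h0 hx
    have hx' : x ∈ closure (interior (A i)) := frontier_subset_closure hx
    rw [hcl] at hx'
    exact (isOpen_interior.frontier_eq.subset hx).2 (hzeroA x hx' h0)
  obtain ⟨S, hS, C, Φ, ϖ, hman, ht2, hcs, hconn, hfol, hbd⟩ := (hA i).exists_foliation
  refine ⟨interior (A i), interior_subset.trans (hAU i), ⟨hTi, ε, S, hS, C, Φ, ϖ, hε0, hman, ht2,
    hcs, hconn, hfol, ?_, ?_, ?_⟩, m, hm, him⟩
  · intro x hx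
    rw [hcl] at hx
    exact interior_subset (s := B) (hAO i hx).2
  · refine tendsto_hausdorffEDist_levelZeros hXc hYc isOpen_interior hTi.isCompact_closure ?_ ?_
    · intro x hx h0
      rw [hcl] at hx
      exact hzeroA x hx h0
    · exact fun x hx => hlsc x (hAU i (interior_subset hx))
  -- A point of `K_c` in the box lies in `V` because `|c| ≤ ε < η`, hence not over the boundary of
  -- the surface.
  · intro c hc s hs hΦ
    have hx : Φ (s, c) ∈ A i := hcl.subset hΦ.2
    refine hbd (Φ (s, c)) ⟨hx, ?_⟩ ?_
    · by_contra hxV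
      refine hball (y := c) ?_ (Φ (s, c)) ⟨subset_closure (hAU i hx), hxV⟩ hΦ.1
      rw [Real.dist_0_eq_abs]
      exact (abs_le.2 hc).trans_lt hεη
    · rw [hfol.left_inv s c hc]
      exact hs

end Prepared

end PreparedTriples

end

theorem mainTheorem5 {M : Type u} [EMetricSpace M] [SigmaCompactSpace M]
    [ChartedSpace PreparedTriples.E3 M] [IsManifold (𝓡 3) ∞ M]
    [RiemannianBundle (fun x : M => TangentSpace (𝓡 3) x)]
    [IsContMDiffRiemannianBundle (𝓡 3) ∞ PreparedTriples.E3
      (fun x : M => TangentSpace (𝓡 3) x)]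
    [IsRiemannianManifold (𝓡 3) M]
    (U : Set M) (X Y : ∀ x : M, TangentSpace (𝓡 3) x)
    (h : PreparedTriples.IsCounterexample 3 U X Y) :
    ∃ (U' : Set M) (X' : ∀ x : M, TangentSpace (𝓡 3) x),
      U' ⊆ U ∧
      PreparedTriples.collinearityLocus U' X' Y =
        PreparedTriples.collinearityLocus U X Y ∩ closure U' ∧
      PreparedTriples.IsPreparedCounterexample 3 U' X' Y := by
  obtain ⟨c₀, hc₀, hreg, hlsc⟩ := h.exists_generic
  obtain ⟨U', hU', hprep⟩ := hc₀.exists_prepared hreg hlsc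
  exact ⟨U', fun x => X x - c₀ • Y x, hU', PreparedTriples.collinearityLocus_sub_smul hU' c₀, hprep⟩
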